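/- Let $\mathcal C$ be a category, $\otimes:\mathcal C\times\mathcal C\to\mathcal C$ a bifunctor, and let $a_{\alpha,\beta,\gamma}:(\alpha\otimes\beta)\otimes\gamma\to\alpha\otimes(\beta\otimes\gamma)$ and $q_{\alpha,\beta}:\alpha\otimes\beta\to\alpha\otimes\beta$ be natural isomorphisms. Suppose that $(\mathcal C,\otimes,a,q)$ is $q$-pseudomonoidal, that is, for all objects $\alpha,\beta,\gamma,\delta,\epsilon$ the following hold (composites are written in diagrammatic order, "$f;g$" meaning first $f$, then $g$; a dot abbreviates $\otimes$, and $1$ is an identity). * $q$-Pentagon: $a_{\alpha.\beta,\gamma,\delta};\,q_{\alpha.\beta,\gamma.\delta};\,a_{\alpha,\beta,\gamma.\delta}=(a_{\alpha,\beta,\gamma}.1);\,a_{\alpha,\beta.\gamma,\delta};\,(1.a_{\beta,\gamma,\delta})$. * $q$-Squares: $q_{(\alpha.\beta).\gamma,\delta.\epsilon};(a_{\alpha,\beta,\gamma}.1)=(a_{\alpha,\beta,\gamma}.1);q_{\alpha.(\beta.\gamma),\delta.\epsilon}$ and $q_{\alpha.\beta,(\gamma.\delta).\epsilon};(1.a_{\gamma,\delta,\epsilon})=(1.a_{\gamma,\delta,\epsilon});q_{\alpha.\beta,\gamma.(\delta.\epsilon)}$.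 * Dodecagon: $a_{\alpha,\beta,\gamma};(1.q_{\beta,\gamma});a^{-1}_{\alpha,\beta,\gamma};(q_{\alpha,\beta}.1);a_{\alpha,\beta,\gamma};(1.q_{\beta,\gamma})=(q_{\alpha,\beta}.1);a_{\alpha,\beta,\gamma};(1.q_{\beta,\gamma});a^{-1}_{\alpha,\beta,\gamma};(q_{\alpha,\beta}.1);a_{\alpha,\beta,\gamma}$. * First Quaddecagon: $(a_{\alpha,\beta,\gamma}.1);(q_{\alpha,\beta.\gamma}.1);a_{\alpha,\beta.\gamma,\delta};q_{\alpha,(\beta.\gamma).\delta};(1.a_{\beta,\gamma,\delta});q^{-1}_{\alpha,\beta.(\gamma.\delta)};a^{-1}_{\alpha,\beta,\gamma.\delta}=a_{\alpha.\beta,\gamma,\delta};(q^{-1}_{\alpha,\beta}.1);q_{\alpha.\beta,\gamma.\delta};a_{\alpha,\beta,\gamma.\delta};(1.q_{\beta,\gamma.\delta});a^{-1}_{\alpha,\beta,\gamma.\delta};(q_{\alpha,\beta}.1)$. * Second Quaddecagon: $a^{-1}_{\alpha.\beta,\gamma,\delta};q^{-1}_{(\alpha.\beta).\gamma,\delta};(a_{\alpha,\beta,\gamma}.1);q_{\alpha.(\beta.\gamma),\delta};a_{\alpha,\beta.\gamma,\delta};(1.q_{\beta.\gamma,\delta});(1.a_{\beta,\gamma,\delta})=(1.q_{\gamma,\delta});a^{-1}_{\alpha.\beta,\gamma,\delta};(q_{\alpha.\beta,\gamma}.1);a_{\alpha.\beta,\gamma,\delta};q_{\alpha.\beta,\gamma.\delta};(1.q^{-1}_{\gamma,\delta});a_{\alpha,\beta,\gamma.\delta}$.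 Suppose moreover that $q$ is symmetric, i.e. $q_{\alpha,\beta};q_{\alpha,\beta}=1$, and let $c_{\alpha,\beta}:\alpha\otimes\beta\to\beta\otimes\alpha$ be a natural isomorphism that is symmetric, i.e. $c_{\alpha,\beta};c_{\beta,\alpha}=1$. A *numbered RB tree* of length $n$ is a rooted planar binary tree with $n$ leaves whose $2n-1$ nodes are assigned the distinct levels $0,1,\dots,2n-2$, increasing away from the root, and whose leaves are assigned the distinct numbers $1,\dots,n$. It determines the functor $\mathcal C^n\to\mathcal C$ given by bracketing with $\otimes$ according to the tree, the leaf numbered $i$ standing for the $i$-th argument. The groupoid NRBTree is the free groupoid on the following primitive arrows between such trees, each of which acts at one internal node (the pivot) $p$: * reattachment: $((A\,B)\,D)\to(A\,(B\,D))$ at $p$, the internal child of $p$ having the same level before and after; * interchange of the levels of the two children of $p$, the lower one being on the right in the source; * swap of the two subtrees above $p$, together with their levels and numbers. The canonical functor $\mathbf{can}:\mathrm{NRBTree}\to\coprod_n[\mathcal C^n,\mathcal C]$ sends a tree to its functor and these arrows to the corresponding iterates of $a$, $q$ and $c$ respectively (and inverses to inverses). The structure is *symmetric $q$-pseudomonoidal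 coherent* if $\mathbf{can}(f)=\mathbf{can}(g)$, at all objects $c_1,\dots,c_n$, for every two parallel arrows $f,g$ of NRBTree. **Theorem.** The structure $(\mathcal C,\otimes,a,q,c)$ is symmetric $q$-pseudomonoidal coherent if and only if the following four diagrams commute for all objects $\alpha,\beta,\gamma$: * Square: $c_{\alpha,\beta}=q_{\alpha,\beta};c^{-1}_{\beta,\alpha};q_{\beta,\alpha}$; * Hexagon: $a_{\alpha,\beta,\gamma};c_{\alpha,\beta.\gamma};a_{\beta,\gamma,\alpha}=(c_{\alpha,\beta}.1);a_{\beta,\alpha,\gamma};(1.c_{\alpha,\gamma})$; * first Decagon: $(c^{-1}_{\beta,\alpha}.1);(q_{\beta,\alpha}.1);a_{\beta,\alpha,\gamma};(1.q^{-1}_{\alpha,\gamma});a^{-1}_{\beta,\alpha,\gamma}=a_{\alpha,\beta,\gamma};(1.q^{-1}_{\beta,\gamma});a^{-1}_{\alpha,\beta,\gamma};(q^{-1}_{\alpha,\beta}.1);(c_{\alpha,\beta}.1)$; * second Decagon: $(1.c^{-1}_{\gamma,\beta});(1.q_{\gamma,\beta});a^{-1}_{\alpha,\gamma,\beta};(q^{-1}_{\alpha,\gamma}.1);a_{\alpha,\gamma,\beta}=a^{-1}_{\alpha,\beta,\gamma};(q^{-1}_{\alpha,\beta}.1);a_{\alpha,\beta,\gamma};(1.q^{-1}_{\beta,\gamma});(1.c_{\beta,\gamma})$.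 -/

import Mathlib

open CategoryTheory

universe v u

/-- A category with a bifunctor `tensor`, a natural isomorphism
`assoc : ⊗ (⊗ × 1) ≅ ⊗ (1 × ⊗)` and a natural automorphism `q : ⊗ ≅ ⊗`. No equation is imposed. -/
structure QTensor (C : Type u) [Category.{v} C] where
  tensor : C × C ⥤ C
  assoc : tensor.prod (𝟭 C) ⋙ tensor ≅
    CategoryTheory.prod.associator C C C ⋙ (𝟭 C).prod tensor ⋙ tensor
  q : tensor ≅ tensor

namespace QTensor

variable {C : Type u} [Category.{v} C] (S : QTensor C)

/-- The object `X ⊗ Y`. -/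
def ob (X Y : C) : C := S.tensor.obj (X, Y)

/-- The arrow `f ⊗ g`. -/
def hm {X X' Y Y' : C} (f : X ⟶ X') (g : Y ⟶ Y') : S.ob X Y ⟶ S.ob X' Y' :=
  S.tensor.map (Prod.mkHom f g)

/-- The arrow `f ⊗ 1`. -/
def onL {X X' : C} (f : X ⟶ X') (Y : C) : S.ob X Y ⟶ S.ob X' Y := S.hm f (𝟙 Y)

/-- The arrow `1 ⊗ g`. -/
def onR (X : C) {Y Y' : C} (g : Y ⟶ Y') : S.ob X Y ⟶ S.ob X Y' := S.hm (𝟙 X) g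

/-- The component `(X ⊗ Y) ⊗ Z ≅ X ⊗ (Y ⊗ Z)` of the associativity. -/
def aIso (X Y Z : C) : S.ob (S.ob X Y) Z ≅ S.ob X (S.ob Y Z) := S.assoc.app ((X, Y), Z)

/-- `a : (X ⊗ Y) ⊗ Z ⟶ X ⊗ (Y ⊗ Z)`. -/
def a (X Y Z : C) : S.ob (S.ob X Y) Z ⟶ S.ob X (S.ob Y Z) := (S.aIso X Y Z).hom

/-- `a⁻¹ : X ⊗ (Y ⊗ Z) ⟶ (X ⊗ Y) ⊗ Z`. -/
def a' (X Y Z : C) : S.ob X (S.ob Y Z) ⟶ S.ob (S.ob X Y) Z := (S.aIso X Y Z).inv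

/-- The component `X ⊗ Y ≅ X ⊗ Y` of `q`. -/
def qIso (X Y : C) : S.ob X Y ≅ S.ob X Y := S.q.app (X, Y)

/-- `q : X ⊗ Y ⟶ X ⊗ Y`. -/
def qq (X Y : C) : S.ob X Y ⟶ S.ob X Y := (S.qIso X Y).hom

/-- `q⁻¹ : X ⊗ Y ⟶ X ⊗ Y`. -/
def qq' (X Y : C) : S.ob X Y ⟶ S.ob X Y := (S.qIso X Y).inv

/-- The four variable automorphism `q` of `(α ⊗ β) ⊗ (γ ⊗ δ)`, which in the strong setting is
`q` at `α ⊗ β`, `γ ⊗ δ`. -/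
def q₄ (α β γ δ : C) : S.ob (S.ob α β) (S.ob γ δ) ⟶ S.ob (S.ob α β) (S.ob γ δ) :=
  S.qq (S.ob α β) (S.ob γ δ)

/-- The `q`-Pentagon diagram. -/
def QPentagon : Prop := ∀ α β γ δ : C,
  S.a (S.ob α β) γ δ ≫ S.q₄ α β γ δ ≫ S.a α β (S.ob γ δ) =
    S.onL (S.a α β γ) δ ≫ S.a α (S.ob β γ) δ ≫ S.onR α (S.a β γ δ)

/-- The first `q`-Square diagram. -/
def QSquare₁ : Prop := ∀ α β γ δ ε : C,
  S.q₄ (S.ob α β) γ δ ε ≫ S.onL (S.a α β γ) (S.ob δ ε) =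
    S.onL (S.a α β γ) (S.ob δ ε) ≫ S.q₄ α (S.ob β γ) δ ε

/-- The second `q`-Square diagram. -/
def QSquare₂ : Prop := ∀ α β γ δ ε : C,
  S.q₄ α β (S.ob γ δ) ε ≫ S.onR (S.ob α β) (S.a γ δ ε) =
    S.onR (S.ob α β) (S.a γ δ ε) ≫ S.q₄ α β γ (S.ob δ ε)

/-- The Dodecagon diagram. -/
def Dodecagon : Prop := ∀ α β γ : C,
  S.a α β γ ≫ S.onR α (S.qq β γ) ≫ S.a' α β γ ≫ S.onL (S.qq α β) γ ≫ S.a α β γ ≫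
      S.onR α (S.qq β γ) =
    S.onL (S.qq α β) γ ≫ S.a α β γ ≫ S.onR α (S.qq β γ) ≫ S.a' α β γ ≫ S.onL (S.qq α β) γ ≫
      S.a α β γ

/-- The first Quaddecagon diagram. -/
def Quaddecagon₁ : Prop := ∀ α β γ δ : C,
  S.onL (S.a α β γ) δ ≫ S.onL (S.qq α (S.ob β γ)) δ ≫ S.a α (S.ob β γ) δ ≫
      S.qq α (S.ob (S.ob β γ) δ) ≫ S.onR α (S.a β γ δ) ≫ S.qq' α (S.ob β (S.ob γ δ)) ≫
      S.a' α β (S.ob γ δ) =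
    S.a (S.ob α β) γ δ ≫ S.onL (S.qq' α β) (S.ob γ δ) ≫ S.qq (S.ob α β) (S.ob γ δ) ≫
      S.a α β (S.ob γ δ) ≫ S.onR α (S.qq β (S.ob γ δ)) ≫ S.a' α β (S.ob γ δ) ≫
      S.onL (S.qq α β) (S.ob γ δ)

/-- The second Quaddecagon diagram. -/
def Quaddecagon₂ : Prop := ∀ α β γ δ : C,
  S.a' (S.ob α β) γ δ ≫ S.qq' (S.ob (S.ob α β) γ) δ ≫ S.onL (S.a α β γ) δ ≫
      S.qq (S.ob α (S.ob β γ)) δ ≫ S.a α (S.ob β γ) δ ≫ S.onR α (S.qq (S.ob β γ) δ) ≫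
      S.onR α (S.a β γ δ) =
    S.onR (S.ob α β) (S.qq γ δ) ≫ S.a' (S.ob α β) γ δ ≫ S.onL (S.qq (S.ob α β) γ) δ ≫
      S.a (S.ob α β) γ δ ≫ S.qq (S.ob α β) (S.ob γ δ) ≫ S.onR (S.ob α β) (S.qq' γ δ) ≫
      S.a α β (S.ob γ δ)

/-- `(C, ⊗, a, q)` is a `q`-pseudomonoidal category. -/
structure IsQPseudomonoidal : Prop where
  qPentagon : S.QPentagon
  qSquare₁ : S.QSquare₁
  qSquare₂ : S.QSquare₂
  dodecagon : S.Dodecagon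
  quaddecagon₁ : S.Quaddecagon₁
  quaddecagon₂ : S.Quaddecagon₂

/-- `q` is symmetric: it is its own inverse. -/
def QSymmetric : Prop := ∀ X Y : C, S.qq X Y ≫ S.qq X Y = 𝟙 (S.ob X Y)

/-- A commutativity: a natural isomorphism `c : ⊗ ≅ ⊗ τ`, where `τ` is the flip functor. -/
abbrev Commutativity : Type max u v := S.tensor ≅ CategoryTheory.Prod.swap C C ⋙ S.tensor

variable {S}

/-- The component `X ⊗ Y ≅ Y ⊗ X` of a commutativity. -/
def Commutativity.iso (c : S.Commutativity) (X Y : C) : S.ob X Y ≅ S.ob Y X :=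
  CategoryTheory.Iso.app c (X, Y)

/-- `c : X ⊗ Y ⟶ Y ⊗ X`. -/
def Commutativity.cc (c : S.Commutativity) (X Y : C) : S.ob X Y ⟶ S.ob Y X := (c.iso X Y).hom

/-- `(c X Y)⁻¹ : Y ⊗ X ⟶ X ⊗ Y`. -/
def Commutativity.cc' (c : S.Commutativity) (X Y : C) : S.ob Y X ⟶ S.ob X Y := (c.iso X Y).inv

/-- `c` is symmetric. -/
def Commutativity.Symmetric (c : S.Commutativity) : Prop :=
  ∀ X Y : C, c.cc X Y ≫ c.cc Y X = 𝟙 (S.ob X Y)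

/-- The Square diagram. -/
def Commutativity.Square (c : S.Commutativity) : Prop := ∀ α β : C,
  c.cc α β = S.qq α β ≫ c.cc' β α ≫ S.qq β α

/-- The Hexagon diagram. -/
def Commutativity.Hexagon (c : S.Commutativity) : Prop := ∀ α β γ : C,
  S.a α β γ ≫ c.cc α (S.ob β γ) ≫ S.a β γ α =
    S.onL (c.cc α β) γ ≫ S.a β α γ ≫ S.onR β (c.cc α γ)

/-- The first Decagon diagram. -/
def Commutativity.Decagon₁ (c : S.Commutativity) : Prop := ∀ α β γ : C,
  S.onL (c.cc' β α) γ ≫ S.onL (S.qq β α) γ ≫ S.a β α γ ≫ S.onR β (S.qq' α γ) ≫ S.a' β α γ =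
    S.a α β γ ≫ S.onR α (S.qq' β γ) ≫ S.a' α β γ ≫ S.onL (S.qq' α β) γ ≫ S.onL (c.cc α β) γ

/-- The second Decagon diagram. -/
def Commutativity.Decagon₂ (c : S.Commutativity) : Prop := ∀ α β γ : C,
  S.onR α (c.cc' γ β) ≫ S.onR α (S.qq γ β) ≫ S.a' α γ β ≫ S.onL (S.qq' α γ) β ≫ S.a α γ β =
    S.a' α β γ ≫ S.onL (S.qq' α β) γ ≫ S.a α β γ ≫ S.onR α (S.qq' β γ) ≫ S.onR α (c.cc β γ)

end QTensor

/-- Rooted planar binary trees with a level at every node and a number in `Fin n` at every leaf.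
The root has level `0` and carries no label. `node x L y R` is the tree whose root has the left
subtree `L`, with root at level `x`, and the right subtree `R`, with root at level `y`. -/
inductive LTree (n : ℕ) : Type
  | leaf (i : Fin n) : LTree n
  | node (x : ℕ) (L : LTree n) (y : ℕ) (R : LTree n) : LTree n

namespace LTree

variable {n : ℕ}

/-- The levels of all nodes other than the root. -/
def levels : LTree n → List ℕ
  | leaf _ => []
  | node x L y R => x :: y :: (L.levels ++ R.levels)

/-- The numbers of the leaves, from left to right. -/
def numbers : LTree n → List (Fin n)
  | leaf i => [i]
  | node _ L _ R => L.numbers ++ R.numbers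

/-- Levels increase strictly away from the root, the root being at level `k`. -/
def Grows : ℕ → LTree n → Prop
  | _, leaf _ => True
  | k, node x L y R => k < x ∧ k < y ∧ L.Grows x ∧ R.Grows y

end LTree

/-- The numbered resolved binary trees of length `n`: the tree grows upward, its `2 n - 1` nodes
occupy each of the levels `0, …, 2 n - 2` exactly once, the root being at level `0`, and its `n`
leaves carry each of the `n` numbers exactly once. -/
structure NRBTree (n : ℕ) : Type where
  tree : LTree n
  grows : tree.Grows 0
  levels : (0 :: tree.levels).Perm (List.range (2 * n - 1))
  numbers : tree.numbers.Perm (List.finRange n)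

/-- The primitive operations. They act at a node (the pivot) of the tree, which is reached from
the root through `left` and `right`.
* `assoc`: reattachment of an edge. The left terminate of the pivot is an internal node at level
  `l`; after the operation the right terminate is an internal node at level `l`.
* `inter`: interchange of the levels of the two terminates of the pivot, the source having the
  lower terminate on the right.
* `swap`: the two subtrees on the terminates of the pivot, with their levels and numbers, change
  places. -/
inductive Prim {n : ℕ} : LTree n → LTree n → Type
  | assoc (l x y z : ℕ) (A B C : LTree n) :
      Prim (.node l (.node x A y B) z C) (.node x A l (.node y B z C))
  | inter (x y : ℕ) (A B : LTree n) (h : y < x) : Prim (.node x A y B) (.node y A x B)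
  | swap (x y : ℕ) (A B : LTree n) : Prim (.node x A y B) (.node y B x A)
  | left (x y : ℕ) {A A' : LTree n} (f : Prim A A') (B : LTree n) :
      Prim (.node x A y B) (.node x A' y B)
  | right (x y : ℕ) (A : LTree n) {B B' : LTree n} (f : Prim B B') :
      Prim (.node x A y B) (.node x A y B')

/-- The primitive arrows between numbered resolved binary trees: the primitive operations that
lead from one such tree to another. The coherence groupoid in length `n` is the free groupoid
`Quiver.FreeGroupoid (NRBTree n)` on this quiver. -/
instance (n : ℕ) : Quiver.{0} (NRBTree n) where
  Hom B B' := Prim B.tree B'.tree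

namespace QTensor

variable {C : Type u} [Category.{v} C] (S : QTensor C)

/-- The functor `Cⁿ ⥤ C` given by bracketing according to the tree, the leaf with number `i`
standing for the `i`-th argument. -/
def canObj {n : ℕ} : LTree n → ((Fin n → C) ⥤ C)
  | .leaf i => CategoryTheory.Pi.eval (fun _ => C) i
  | .node _ L _ R => (canObj L).prod' (canObj R) ⋙ S.tensor

variable {S}

/-- The iterate of `a`, `q` or `c` that belongs to a primitive operation. -/
def canPrim (c : S.Commutativity) {n : ℕ} : {A B : LTree n} → Prim A B → (S.canObj A ≅ S.canObj B)
  | _, _, .assoc _ _ _ _ A B D =>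
      Functor.isoWhiskerLeft (((S.canObj A).prod' (S.canObj B)).prod' (S.canObj D)) S.assoc
  | _, _, .inter _ _ A B _ => Functor.isoWhiskerLeft ((S.canObj A).prod' (S.canObj B)) S.q
  | _, _, .swap _ _ A B => Functor.isoWhiskerLeft ((S.canObj A).prod' (S.canObj B)) c
  | _, _, .left _ _ f B =>
      NatIso.ofComponents
        (fun w => S.tensor.mapIso
          (CategoryTheory.Iso.prod ((canPrim c f).app w) (Iso.refl ((S.canObj B).obj w))))
        (fun {w w'} t => by
          have h := (canPrim c f).hom.naturality t
          simp only [canObj, Functor.comp_map, Functor.mapIso_hom, ← Functor.map_comp]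
          exact congrArg S.tensor.map (Prod.ext h (by simp)))
  | _, _, .right _ _ A f =>
      NatIso.ofComponents
        (fun w => S.tensor.mapIso
          (CategoryTheory.Iso.prod (Iso.refl ((S.canObj A).obj w)) ((canPrim c f).app w)))
        (fun {w w'} t => by
          have h := (canPrim c f).hom.naturality t
          simp only [canObj, Functor.comp_map, Functor.mapIso_hom, ← Functor.map_comp]
          exact congrArg S.tensor.map (Prod.ext (by simp) h))

/-- The canonical functor from the coherence groupoid of length `n` to the functor category
`[Cⁿ, C]`; it sends the inverse of a primitive arrow to the inverse natural isomorphism. -/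
def can (c : S.Commutativity) (n : ℕ) :
    Quiver.FreeGroupoid (NRBTree n) ⥤ ((Fin n → C) ⥤ C) :=
  Quiver.FreeGroupoid.lift (V' := Core ((Fin n → C) ⥤ C))
    { obj := fun B => ⟨S.canObj B.tree⟩
      map := fun f => ⟨canPrim c f⟩ } ⋙ Core.inclusion ((Fin n → C) ⥤ C)

/-- Symmetric `q`-pseudomonoidal coherence: every diagram in the coherence groupoid, that is,
every pair of parallel arrows, becomes commutative in `C` for all objects `w 0, …, w (n - 1)`. -/
def Commutativity.Coherent (c : S.Commutativity) : Prop :=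
  ∀ (n : ℕ) (B B' : Quiver.FreeGroupoid (NRBTree n)) (f g : B ⟶ B') (w : Fin n → C),
    ((can c n).map f).app w = ((can c n).map g).app w

end QTensor

/-!
Coherence implies the four diagrams because each of them is the image of a pair of parallel arrows
between trees with two or three leaves (`Coherent.square`, `Coherent.hexagon`, `Coherent.decagon₁`,
`Coherent.decagon₂`).

Conversely, fix objects `w`. A tree is dismantled from its root upwards, which leads through
forests: lists of trees, each with a level for its root, called its tag. The value of a forest is
the product of the values of its trees, bracketed to the left, so that splitting a tree at the first
place does not change the value. On a product with two adjacent factors there act `c`, which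
interchanges the factors and their tags, and `q`, which exchanges the tags only. The hypotheses say
that `q` and `c` generate an action of the product of two symmetric groups, one permuting the tags
and one permuting the factors: this is a `TaggedFamily`, and `Moves.unique` is its coherence
theorem. The `q`-Pentagon transports the relations from `(X ⊗ Y) ⊗ Z` to
`((W ⊗ X) ⊗ Y) ⊗ Z` (`Compatible.family`); the Dodecagon, the Hexagon, the Square and the Decagons
are the relations themselves.

A reduction of a forest (`Red`) repeatedly moves a tree at a low level to the first place, gives it
the lowest tag and splits it, until the leaves are left, which are sorted. The core of the argument
is that a forest has only one reduction and that reductions are compatible with interchanges of low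
trees (`agree`). It goes by induction on the number of internal nodes. Two reductions that split
different trees first are compared by splitting the other tree next; this is the identity
`split_comm`, a consequence of the `q`-Pentagon and the Hexagon. Two forests that differ by
interchanges of low trees have a tree in common that can be split in both (`exists_common`).

Finally a primitive arrow at a tree in the first place of a forest is compatible with the reductions
before and after it (`primAgree`), again by induction: trees at lower levels are split first, and
then either the arrow acts above the split, or it is one of the interchanges, or it is a
reattachment. The last case uses the second Quaddecagon (`assoc_tag`) to reach the lowest tag, where
splitting the two internal nodes of the source, or those of the target, gives the same forest. Hence
the reductions of trees form a cocone of isomorphisms over the images of all arrows, so that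
parallel arrows have equal images (`coherent`).
-/

/-! ### Words of endofunctors and interchanges of adjacent letters -/

section Words

variable {E : Type*} [Category E] {X : Type*} (R : X → E ⥤ E)

/-- The composite of the endofunctors `R x` along a list, the head acting first. -/
def word : List X → E ⥤ E
  | [] => 𝟭 E
  | x :: l => R x ⋙ word l

variable {R}

/-- A transformation of the tail, behind the letter `x`. -/
def under (x : X) {l l' : List X} (f : word R l ⟶ word R l') :
    word R (x :: l) ⟶ word R (x :: l') :=
  Functor.whiskerLeft (R x) f

/-- A transformation of the two leading letters. -/
def front {x y x' y' : X} (s : R x ⋙ R y ⟶ R x' ⋙ R y') (l : List X) :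
    word R (x :: y :: l) ⟶ word R (x' :: y' :: l) :=
  Functor.whiskerRight s (word R l)

@[simp] theorem under_id (x : X) (l : List X) : under x (𝟙 (word R l)) = 𝟙 _ := rfl

theorem under_comp (x : X) {l l' l'' : List X} (f : word R l ⟶ word R l')
    (g : word R l' ⟶ word R l'') : under x (f ≫ g) = under x f ≫ under x g := rfl

/-- Transformations of two leading letters and of the rest commute. -/
theorem front_under {x y x' y' : X} (s : R x ⋙ R y ⟶ R x' ⋙ R y') {l l' : List X}
    (f : word R l ⟶ word R l') :
    front s l ≫ under x' (under y' f) = under x (under y f) ≫ front s l' := by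
  ext P
  exact f.naturality (s.app P)

variable (sw : ∀ x y, R x ⋙ R y ⟶ R y ⋙ R x)

/-- `f` moves the head `x` to some place in `l`. -/
inductive Inserts (x : X) : (l l' : List X) → (word R (x :: l) ⟶ word R l') → Prop
  | here (l) : Inserts x l (x :: l) (𝟙 _)
  | there (y l l' f) : Inserts x l l' f →
      Inserts x (y :: l) (y :: l') (front (sw x y) l ≫ under y f)

/-- `f` is the composite of the successive insertions that lead from `l` to `l'`. -/
inductive Sorts : (l l' : List X) → (word R l ⟶ word R l') → Prop
  | nil : Sorts [] [] (𝟙 _)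
  | cons (x l m l' g f) : Sorts l m g → Inserts sw x m l' f → Sorts (x :: l) l' (under x g ≫ f)

/-- `f` is an interchange of two adjacent letters. -/
inductive Adj : (l l' : List X) → (word R l ⟶ word R l') → Prop
  | swap (x y l) : Adj (x :: y :: l) (y :: x :: l) (front (sw x y) l)
  | cons (x l l' f) : Adj l l' f → Adj (x :: l) (x :: l') (under x f)

/-- `f` is a composite of interchanges of adjacent letters. -/
inductive Adjs : (l l' : List X) → (word R l ⟶ word R l') → Prop
  | refl (l) : Adjs l l (𝟙 _)
  | step (l l' l'' f g) : Adj sw l l' f → Adjs l' l'' g → Adjs l l'' (f ≫ g)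

variable {sw}

theorem Inserts.perm {x : X} {l l' : List X} {f} (h : Inserts sw x l l' f) :
    (x :: l).Perm l' := by
  induction h with
  | here => exact .refl _
  | there y l l' f _ ih => exact (List.Perm.swap y x l).trans (ih.cons y)

theorem Inserts.unique {x : X} {l l' m : List X} {f f'} (h : Inserts sw x l m f)
    (h' : Inserts sw x l' m f') (hm : m.Nodup) : l = l' ∧ HEq f f' := by
  induction h generalizing l' with
  | here l =>
    cases h' with
    | here => exact ⟨rfl, HEq.rfl⟩
    | there _ _ _ _ h' =>
      exact absurd (h'.perm.subset (List.mem_cons_self)) (List.nodup_cons.1 hm).1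
  | there y l m f h ih =>
    cases h' with
    | here => exact absurd (h.perm.subset (List.mem_cons_self)) (List.nodup_cons.1 hm).1
    | there _ l' _ f' h' =>
      obtain ⟨rfl, e⟩ := ih h' (List.nodup_cons.1 hm).2
      cases e
      exact ⟨rfl, HEq.rfl⟩

theorem Sorts.unique {l m : List X} {f f'} (h : Sorts sw l m f) (h' : Sorts sw l m f')
    (hm : m.Nodup) : f = f' := by
  induction h with
  | nil => cases h'; rfl
  | cons x l m' m g f h hi ih =>
    cases h' with
    | cons _ _ m'' _ g' f' h' hi' =>
      obtain ⟨rfl, e⟩ := hi.unique hi' hm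
      cases e
      rw [ih h' ((List.nodup_cons.1 (hi.perm.nodup_iff.2 hm)).2)]

theorem Sorts.refl (l : List X) : Sorts sw l l (𝟙 _) := by
  induction l with
  | nil => exact .nil
  | cons x l ih =>
    have := Sorts.cons x l l (x :: l) _ _ ih (Inserts.here l)
    simpa using this

/-- The pasting of the braid relation for three letters (`b`) with two naturality squares (`n₁`, `n₂`)
and an inductive hypothesis (`e`). -/
theorem paste_hexagon {A A₁ A₂ A₃ A₄ A₅ A₆ B B' : E} {a₁ : A ⟶ A₁} {a₂ : A₁ ⟶ A₂}
    {a₃ : A₂ ⟶ A₃} {c₁ : A ⟶ A₄} {c₂ : A₄ ⟶ A₅} {c₃ : A₅ ⟶ A₃} {f₁ : A₂ ⟶ A₆} {f₂ : A₃ ⟶ B}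
    {m : A₆ ⟶ B} {D D' : E} {g : B ⟶ D} {p : A₅ ⟶ B'} {g' : B' ⟶ D} {p' : A₄ ⟶ D'}
    {m' : D' ⟶ B'} (n₁ : a₃ ≫ f₂ = f₁ ≫ m) (b : a₁ ≫ a₂ ≫ a₃ = c₁ ≫ c₂ ≫ c₃)
    (e : c₃ ≫ f₂ ≫ g = p ≫ g') (n₂ : c₂ ≫ p = p' ≫ m') :
    a₁ ≫ (a₂ ≫ f₁) ≫ m ≫ g = (c₁ ≫ p') ≫ m' ≫ g' := by
  rw [Category.assoc, ← reassoc_of% n₁, reassoc_of% b, e, reassoc_of% n₂, Category.assoc]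

section

variable (symm : ∀ x y P, (sw x y).app P ≫ (sw y x).app P = 𝟙 _)
  (braid : ∀ x y z P, (R z).map ((sw x y).app P) ≫ (sw x z).app ((R y).obj P) ≫
    (R x).map ((sw y z).app P) = (sw y z).app ((R x).obj P) ≫ (R y).map ((sw x z).app P) ≫
      (sw x y).app ((R z).obj P))

include symm braid

/-- The letters `x` and `y` can be inserted in either order, up to an interchange of the two. -/
theorem Inserts.comm {x y : X} {l m n : List X} {f g} (hf : Inserts sw x l m f)
    (hg : Inserts sw y m n g) : ∃ m' f' g', Inserts sw y l m' f' ∧ Inserts sw x m' n g' ∧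
      front (sw x y) l ≫ under y f ≫ g = under x f' ≫ g' := by
  induction hf generalizing n with
  | here l =>
    cases hg with
    | here => exact ⟨_, _, _, .here l, .there y _ _ _ (.here l), by simp⟩
    | there _ _ n g hg =>
      refine ⟨n, g, _, hg, .here n, ?_⟩
      ext P
      have := congrArg (fun k => (word R l).map k ≫ g.app ((R x).obj P)) (symm x y P)
      simp only [Functor.map_comp, CategoryTheory.Functor.map_id] at this
      exact (congrArg _ (Category.id_comp _)).trans ((Category.assoc _ _ _).symm.trans
        (this.trans ((Category.id_comp _).trans (Category.comp_id _).symm)))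
  | there z l m f hf ih =>
    cases hg with
    | here => exact ⟨_, _, _, .here _, .there y _ _ _ (.there z _ _ _ hf), by simp⟩
    | there _ _ n g hg =>
      obtain ⟨m', f', g', hf', hg', e⟩ := ih hg
      refine ⟨_, _, _, .there z _ _ _ hf', .there z _ _ _ hg', ?_⟩
      ext P
      have b := congrArg (fun k => (word R l).map k) (braid x y z P)
      simp only [Functor.map_comp] at b
      have n1 := f.naturality ((sw y z).app P)
      have n2 := f'.naturality ((sw x z).app P)
      have e' := congrArg (fun k => k.app ((R z).obj P)) e
      exact paste_hexagon n1 b e' n2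

/-- An interchange of adjacent letters before successive insertions gives successive insertions. -/
theorem Sorts.step {l l' m : List X} {f g} (h : Adj sw l l' f) (hg : Sorts sw l' m g) :
    Sorts sw l m (f ≫ g) := by
  induction h generalizing m with
  | swap x y l =>
    cases hg with
    | cons _ _ _ _ g f h hi =>
      cases h with
      | cons _ _ _ _ g' f' h hi' =>
        obtain ⟨m', p, q, hp, hq, e⟩ := hi'.comm symm braid hi
        have := Sorts.cons x _ _ _ _ _ (Sorts.cons y _ _ _ _ _ h hp) hq
        convert this using 1
        rw [under_comp, under_comp, Category.assoc, Category.assoc, ← e,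
          ← Category.assoc, ← Category.assoc, front_under, Category.assoc, Category.assoc]
  | cons x l l' f _ ih =>
    cases hg with
    | cons _ _ _ _ g f h hi =>
      rw [← Category.assoc, ← under_comp]
      exact .cons _ _ _ _ _ _ (ih h) hi

theorem Adjs.sorts {l l' : List X} {f} (h : Adjs sw l l' f) : Sorts sw l l' f := by
  induction h with
  | refl l => exact .refl l
  | step _ _ _ _ _ h _ ih => exact ih.step symm braid h

/-- Coherence for one braided symmetric family: a composite of interchanges of adjacent letters
is determined by its source and its target, if the letters are distinct. -/
theorem Adjs.unique {l l' : List X} {f g} (hf : Adjs sw l l' f) (hg : Adjs sw l l' g)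
    (hl : l'.Nodup) : f = g :=
  (hf.sorts symm braid).unique (hg.sorts symm braid) hl

end

end Words

/-! ### Letters with tags -/

section Tagged

section ThreeLetters

variable {E : Type*} [Category E] {X : Type*} {O : X → X → X → E}
  {S₁ S₂ : ∀ x y z, O x y z ⟶ O x y z} {C₁ T₁ : ∀ x y z, O x y z ⟶ O y x z}
  {C₂ T₂ : ∀ x y z, O x y z ⟶ O x z y}
  (ss₁ : ∀ x y z, S₁ x y z ≫ S₁ x y z = 𝟙 _) (ss₂ : ∀ x y z, S₂ x y z ≫ S₂ x y z = 𝟙 _)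
  (cc₁ : ∀ x y z, C₁ x y z ≫ C₁ y x z = 𝟙 _) (cc₂ : ∀ x y z, C₂ x y z ≫ C₂ x z y = 𝟙 _)
  (sc₁ : ∀ x y z, S₁ x y z ≫ C₁ x y z = C₁ x y z ≫ S₁ y x z)
  (sc₂ : ∀ x y z, S₂ x y z ≫ C₂ x y z = C₂ x y z ≫ S₂ x z y)
  (sbr : ∀ x y z, S₁ x y z ≫ S₂ x y z ≫ S₁ x y z = S₂ x y z ≫ S₁ x y z ≫ S₂ x y z)
  (cbr : ∀ x y z, C₁ x y z ≫ C₂ y x z ≫ C₁ y z x = C₂ x y z ≫ C₁ x z y ≫ C₂ z x y)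
  (m₁ : ∀ x y z, C₁ x y z ≫ S₂ y x z = S₁ x y z ≫ S₂ x y z ≫ S₁ x y z ≫ C₁ x y z)
  (m₂ : ∀ x y z, C₂ x y z ≫ S₁ x z y = S₂ x y z ≫ S₁ x y z ≫ S₂ x y z ≫ C₂ x y z)
  (t₁ : ∀ x y z, T₁ x y z = S₁ x y z ≫ C₁ x y z) (t₂ : ∀ x y z, T₂ x y z = S₂ x y z ≫ C₂ x y z)

/-! In the lemmas on three letters `S` exchanges two adjacent tags, `C` interchanges two adjacent
letters together with their tags, and `T = S ≫ C` interchanges the letters only; the index is the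
place. -/

include ss₁ m₁ t₁ in
theorem exchange_tag (x y z : X) : T₁ x y z ≫ S₂ y x z = S₂ x y z ≫ S₁ x y z ≫ C₁ x y z := by
  rw [t₁, Category.assoc, m₁, reassoc_of% ss₁]

include ss₂ m₂ t₂ in
theorem exchange_tag' (x y z : X) : T₂ x y z ≫ S₁ x z y = S₁ x y z ≫ S₂ x y z ≫ C₂ x y z := by
  rw [t₂, Category.assoc, m₂, reassoc_of% ss₂]

include ss₁ ss₂ sc₁ sc₂ sbr cbr m₁ m₂ t₁ t₂ in
theorem exchange_braid (x y z : X) :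
    T₁ x y z ≫ T₂ y x z ≫ T₁ y z x = T₂ x y z ≫ T₁ x z y ≫ T₂ z x y := by
  have k₁ : ∀ x y z, T₁ x y z ≫ S₂ y x z = S₂ x y z ≫ T₁ x y z := fun x y z => by
    rw [exchange_tag ss₁ m₁ t₁, t₁]
  have k₂ : ∀ x y z, T₂ x y z ≫ S₁ x z y = S₁ x y z ≫ T₂ x y z := fun x y z => by
    rw [exchange_tag' ss₂ m₂ t₂, t₂]
  have l₁ : ∀ x y z, T₁ x y z ≫ S₁ y x z = S₁ x y z ≫ T₁ x y z := fun x y z => by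
    rw [t₁, Category.assoc, ← sc₁]
  have l₂ : ∀ x y z, T₂ x y z ≫ S₂ x z y = S₂ x y z ≫ T₂ x y z := fun x y z => by
    rw [t₂, Category.assoc, ← sc₂]
  have c₁ : ∀ x y z, C₁ x y z = S₁ x y z ≫ T₁ x y z := fun x y z => by
    rw [t₁, reassoc_of% ss₁]
  have c₂ : ∀ x y z, C₂ x y z = S₂ x y z ≫ T₂ x y z := fun x y z => by
    rw [t₂, reassoc_of% ss₂]
  -- `S` commutes with `T` at both places, so the braid relation of `S` cancels from that of `C = S ≫ T`
  have e := cbr x y z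
  simp only [c₁, c₂, Category.assoc] at e
  rw [reassoc_of% k₂, reassoc_of% k₁, reassoc_of% l₁, reassoc_of% k₁, reassoc_of% k₂,
    reassoc_of% l₂, ← reassoc_of% sbr] at e
  have := congrArg (fun f => S₁ x y z ≫ S₂ x y z ≫ S₁ x y z ≫ f) e
  simpa only [reassoc_of% ss₁, reassoc_of% ss₂] using this

include ss₁ ss₂ cc₁ sc₁ m₂ t₁ t₂ in
theorem carry_exchange_left (x y z : X) : C₁ x y z ≫ T₂ y x z =
    T₁ x y z ≫ T₂ y x z ≫ T₁ y z x ≫ C₁ z y x := by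
  have l₁ : ∀ x y z, T₁ x y z ≫ S₁ y x z = S₁ x y z ≫ T₁ x y z := fun x y z => by
    rw [t₁, Category.assoc, ← sc₁]
  have c₁ : ∀ x y z, C₁ x y z = S₁ x y z ≫ T₁ x y z := fun x y z => by
    rw [t₁, reassoc_of% ss₁]
  rw [t₁ y z x, Category.assoc, cc₁, Category.comp_id, exchange_tag' ss₂ m₂ t₂,
    reassoc_of% l₁, c₁, Category.assoc, t₂]

include ss₁ ss₂ cc₂ sc₂ m₁ t₁ t₂ in
theorem carry_exchange_right (x y z : X) : C₂ x y z ≫ T₁ x z y =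
    T₂ x y z ≫ T₁ x z y ≫ T₂ z x y ≫ C₂ z y x := by
  have l₂ : ∀ x y z, T₂ x y z ≫ S₂ x z y = S₂ x y z ≫ T₂ x y z := fun x y z => by
    rw [t₂, Category.assoc, ← sc₂]
  have c₂ : ∀ x y z, C₂ x y z = S₂ x y z ≫ T₂ x y z := fun x y z => by
    rw [t₂, reassoc_of% ss₂]
  rw [t₂ z x y, Category.assoc, cc₂, Category.comp_id, exchange_tag ss₁ m₁ t₁,
    reassoc_of% l₂, c₂, Category.assoc, t₁]

end ThreeLetters

/-- Endofunctors `act x` with natural transformations for lists of letters with tags: `tag`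
exchanges the tags of two adjacent letters, `car` interchanges two adjacent letters together with
their tags. They satisfy the relations of a product of two symmetric groups: `tag` permutes the tags,
`tag ≫ car` permutes the letters, and `car` acts diagonally. -/
structure TaggedFamily (E : Type*) [Category E] (X : Type*) where
  act : X → E ⥤ E
  tag : ∀ x y, act x ⋙ act y ⟶ act x ⋙ act y
  car : ∀ x y, act x ⋙ act y ⟶ act y ⋙ act x
  tag_tag : ∀ x y P, (tag x y).app P ≫ (tag x y).app P = 𝟙 _
  car_car : ∀ x y P, (car x y).app P ≫ (car y x).app P = 𝟙 _
  tag_car : ∀ x y P, (tag x y).app P ≫ (car x y).app P = (car x y).app P ≫ (tag y x).app P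
  tag_braid : ∀ x y z P, (act z).map ((tag x y).app P) ≫ (tag y z).app ((act x).obj P) ≫
    (act z).map ((tag x y).app P) = (tag y z).app ((act x).obj P) ≫ (act z).map ((tag x y).app P) ≫
      (tag y z).app ((act x).obj P)
  car_braid : ∀ x y z P, (act z).map ((car x y).app P) ≫ (car x z).app ((act y).obj P) ≫
    (act x).map ((car y z).app P) = (car y z).app ((act x).obj P) ≫ (act y).map ((car x z).app P) ≫
      (car x y).app ((act z).obj P)
  car_tag_left : ∀ x y z P, (act z).map ((car x y).app P) ≫ (tag x z).app ((act y).obj P) =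
    (act z).map ((tag x y).app P) ≫ (tag y z).app ((act x).obj P) ≫
      (act z).map ((tag x y).app P) ≫ (act z).map ((car x y).app P)
  car_tag_right : ∀ x y z P, (car y z).app ((act x).obj P) ≫ (act y).map ((tag x z).app P) =
    (tag y z).app ((act x).obj P) ≫ (act z).map ((tag x y).app P) ≫
      (tag y z).app ((act x).obj P) ≫ (car y z).app ((act x).obj P)

namespace TaggedFamily

variable {E : Type*} [Category E] {X : Type*} (T : TaggedFamily E X)

/-- The interchange of two adjacent letters that leaves the tags in their places. -/
def exc (x y : X) : T.act x ⋙ T.act y ⟶ T.act y ⋙ T.act x := T.tag x y ≫ T.car x y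

theorem exc_app (x y : X) (P : E) : (T.exc x y).app P = (T.tag x y).app P ≫ (T.car x y).app P :=
  rfl

theorem exc_exc (x y : X) (P : E) : (T.exc x y).app P ≫ (T.exc y x).app P = 𝟙 _ := by
  have h₁ := T.tag_car y x P
  have h₂ := T.car_car x y P
  rw [exc_app, exc_app, h₁, Category.assoc, reassoc_of% h₂]
  exact T.tag_tag x y P

theorem car_exc (x y : X) (P : E) :
    (T.car x y).app P ≫ (T.exc y x).app P = (T.exc x y).app P ≫ (T.car y x).app P := by
  rw [exc_app, exc_app, Category.assoc, ← Category.assoc, ← T.tag_car, Category.assoc]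

section

variable (P : E)

theorem map_tag_tag (x y z : X) :
    (T.act z).map ((T.tag x y).app P) ≫ (T.act z).map ((T.tag x y).app P) = 𝟙 _ := by
  rw [← Functor.map_comp, tag_tag, CategoryTheory.Functor.map_id]

theorem map_car_car (x y z : X) :
    (T.act z).map ((T.car x y).app P) ≫ (T.act z).map ((T.car y x).app P) = 𝟙 _ := by
  rw [← Functor.map_comp, car_car, CategoryTheory.Functor.map_id]

theorem map_tag_car (x y z : X) :
    (T.act z).map ((T.tag x y).app P) ≫ (T.act z).map ((T.car x y).app P) =
      (T.act z).map ((T.car x y).app P) ≫ (T.act z).map ((T.tag y x).app P) := by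
  rw [← Functor.map_comp, tag_car, Functor.map_comp]

theorem map_exc (x y z : X) : (T.act z).map ((T.exc x y).app P) =
    (T.act z).map ((T.tag x y).app P) ≫ (T.act z).map ((T.car x y).app P) := by
  rw [← Functor.map_comp, exc_app]

theorem exc_braid (x y z : X) : (T.act z).map ((T.exc x y).app P) ≫
    (T.exc x z).app ((T.act y).obj P) ≫ (T.act x).map ((T.exc y z).app P) =
      (T.exc y z).app ((T.act x).obj P) ≫ (T.act y).map ((T.exc x z).app P) ≫
        (T.exc x y).app ((T.act z).obj P) :=
  exchange_braid (O := fun x y z => (T.act z).obj ((T.act y).obj ((T.act x).obj P)))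
    (S₂ := fun x y z => (T.tag y z).app ((T.act x).obj P))
    (C₂ := fun x y z => (T.car y z).app ((T.act x).obj P))
    (T₂ := fun x y z => (T.exc y z).app ((T.act x).obj P))
    (T.map_tag_tag P) (fun _ _ _ => T.tag_tag _ _ _) (T.map_tag_car P)
    (fun _ _ _ => T.tag_car _ _ _) (fun x y z => T.tag_braid x y z P)
    (fun x y z => T.car_braid x y z P) (fun x y z => T.car_tag_left x y z P)
    (fun x y z => T.car_tag_right x y z P) (T.map_exc P) (fun _ _ _ => rfl) x y z

theorem car_exc_left (x y z : X) :
    (T.act z).map ((T.car x y).app P) ≫ (T.exc x z).app ((T.act y).obj P) =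
      (T.act z).map ((T.exc x y).app P) ≫ (T.exc x z).app ((T.act y).obj P) ≫
        (T.act x).map ((T.exc y z).app P) ≫ (T.act x).map ((T.car z y).app P) :=
  carry_exchange_left (O := fun x y z => (T.act z).obj ((T.act y).obj ((T.act x).obj P)))
    (S₂ := fun x y z => (T.tag y z).app ((T.act x).obj P))
    (C₂ := fun x y z => (T.car y z).app ((T.act x).obj P))
    (T₂ := fun x y z => (T.exc y z).app ((T.act x).obj P))
    (T.map_tag_tag P) (fun _ _ _ => T.tag_tag _ _ _) (T.map_car_car P) (T.map_tag_car P)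
    (fun x y z => T.car_tag_right x y z P) (T.map_exc P) (fun _ _ _ => rfl) x y z

theorem car_exc_right (x y z : X) :
    (T.car y z).app ((T.act x).obj P) ≫ (T.act y).map ((T.exc x z).app P) =
      (T.exc y z).app ((T.act x).obj P) ≫ (T.act y).map ((T.exc x z).app P) ≫
        (T.exc x y).app ((T.act z).obj P) ≫ (T.car y x).app ((T.act z).obj P) :=
  carry_exchange_right (O := fun x y z => (T.act z).obj ((T.act y).obj ((T.act x).obj P)))
    (S₂ := fun x y z => (T.tag y z).app ((T.act x).obj P))
    (T₂ := fun x y z => (T.exc y z).app ((T.act x).obj P))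
    (C₂ := fun x y z => (T.car y z).app ((T.act x).obj P))
    (T.map_tag_tag P) (fun _ _ _ => T.tag_tag _ _ _) (fun _ _ _ => T.car_car _ _ _)
    (fun _ _ _ => T.tag_car _ _ _) (fun x y z => T.car_tag_left x y z P)
    (T.map_exc P) (fun _ _ _ => rfl) x y z

end

end TaggedFamily

variable {E : Type*} [Category E] {X : Type*} (T : TaggedFamily E X)

/-- The functor of a list of letters with tags; it does not depend on the tags. -/
abbrev tagged (l : List (X × ℕ)) : E ⥤ E := word T.act (l.map Prod.fst)

namespace TaggedFamily

/-- An interchange of two adjacent letters together with their tags. -/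
inductive Carry : (l l' : List (X × ℕ)) → (tagged T l ⟶ tagged T l') → Prop
  | swap (x y i j l) : Carry ((x, i) :: (y, j) :: l) ((y, j) :: (x, i) :: l)
      (front (T.car x y) (l.map Prod.fst))
  | cons (p l l' f) : Carry l l' f → Carry (p :: l) (p :: l') (under p.1 f)

/-- An interchange of two adjacent letters that leaves the tags in place. -/
inductive Exchange : (l l' : List (X × ℕ)) → (tagged T l ⟶ tagged T l') → Prop
  | swap (x y i j l) : Exchange ((x, i) :: (y, j) :: l) ((y, i) :: (x, j) :: l)
      (front (T.exc x y) (l.map Prod.fst))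
  | cons (p l l' f) : Exchange l l' f → Exchange (p :: l) (p :: l') (under p.1 f)

variable {T}

/-- The composites of the given elementary moves. -/
inductive Chain (M : (l l' : List (X × ℕ)) → (tagged T l ⟶ tagged T l') → Prop) :
    (l l' : List (X × ℕ)) → (tagged T l ⟶ tagged T l') → Prop
  | refl (l) : Chain M l l (𝟙 _)
  | step (l l' l'' f g) : M l l' f → Chain M l' l'' g → Chain M l l'' (f ≫ g)

variable (T) in
/-- The composites of interchanges of both kinds. -/
abbrev Moves : (l l' : List (X × ℕ)) → (tagged T l ⟶ tagged T l') → Prop :=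
  Chain fun l l' f => T.Carry l l' f ∨ T.Exchange l l' f

theorem Chain.single {M : (l l' : List (X × ℕ)) → (tagged T l ⟶ tagged T l') → Prop}
    {l l' f} (h : M l l' f) : Chain M l l' f := by
  have := Chain.step _ _ _ _ _ h (.refl _)
  simpa using this

theorem Chain.trans {M : (l l' : List (X × ℕ)) → (tagged T l ⟶ tagged T l') → Prop}
    {l l' l'' f g} (h : Chain M l l' f) (h' : Chain M l' l'' g) : Chain M l l'' (f ≫ g) := by
  induction h with
  | refl => simpa using h'
  | step l l' l'' f g hf _ ih => rw [Category.assoc]; exact .step _ _ _ _ _ hf (ih h')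

theorem Chain.cons {M : (l l' : List (X × ℕ)) → (tagged T l ⟶ tagged T l') → Prop}
    (hM : ∀ p l l' f, M l l' f → M (p :: l) (p :: l') (under p.1 f))
    {l l' f} (h : Chain M l l' f) (p : X × ℕ) : Chain M (p :: l) (p :: l') (under p.1 f) := by
  induction h with
  | refl => exact .refl _
  | step l l' l'' f g hf _ ih => exact .step _ _ _ _ _ (hM p _ _ _ hf) ih

theorem Moves.cons {l l' f} (h : T.Moves l l' f) (p : X × ℕ) :
    T.Moves (p :: l) (p :: l') (under p.1 f) :=
  Chain.cons (fun p l l' f h => h.imp (.cons p l l' f) (.cons p l l' f)) h p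

theorem Moves.swap (p q : X × ℕ) (l) : T.Moves (p :: q :: l) (q :: p :: l)
    (front (T.car p.1 q.1) (l.map Prod.fst)) :=
  .single (.inl (.swap p.1 q.1 p.2 q.2 l))

theorem Moves.exchange (x y i j l) : T.Moves ((x, i) :: (y, j) :: l) ((y, i) :: (x, j) :: l)
    (front (T.exc x y) (l.map Prod.fst)) :=
  .single (.inr (.swap x y i j l))

theorem Moves.tags (x y i j l) : T.Moves ((x, i) :: (y, j) :: l) ((x, j) :: (y, i) :: l)
    (front (T.tag x y) (l.map Prod.fst)) := by
  have := (Moves.exchange (T := T) x y i j l).trans (Moves.swap (y, i) (x, j) l)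
  convert this using 1
  ext P
  have e : (T.exc x y).app P ≫ (T.car y x).app P = (T.tag x y).app P := by
    rw [exc_app, Category.assoc, car_car]; exact Category.comp_id _
  exact (congrArg (word T.act (l.map Prod.fst)).map e.symm).trans (Functor.map_comp _ _ _)

theorem Carry.perm {l l' f} (h : T.Carry l l' f) : l.Perm l' := by
  induction h with
  | swap => exact .swap _ _ _
  | cons p _ _ _ _ ih => exact ih.cons p

theorem Exchange.perm {l l' f} (h : T.Exchange l l' f) :
    (l.map Prod.fst).Perm (l'.map Prod.fst) := by
  induction h with
  | swap => exact .swap _ _ _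
  | cons p _ _ _ _ ih => exact ih.cons p.1

theorem Exchange.tags {l l' f} (h : T.Exchange l l' f) : l.map Prod.snd = l'.map Prod.snd := by
  induction h with
  | swap => rfl
  | cons p _ _ _ _ ih => simp [ih]

theorem Carry.adj {l l' f} (h : T.Carry l l' f) :
    Adj T.car (l.map Prod.fst) (l'.map Prod.fst) f := by
  induction h with
  | swap => exact .swap _ _ _
  | cons p _ _ _ _ ih => exact .cons _ _ _ _ ih

theorem Exchange.adj {l l' f} (h : T.Exchange l l' f) :
    Adj T.exc (l.map Prod.fst) (l'.map Prod.fst) f := by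
  induction h with
  | swap => exact .swap _ _ _
  | cons p _ _ _ _ ih => exact .cons _ _ _ _ ih

theorem Moves.perm_fst {l l' f} (h : T.Moves l l' f) :
    (l.map Prod.fst).Perm (l'.map Prod.fst) := by
  induction h with
  | refl => exact .refl _
  | step _ _ _ _ _ h _ ih =>
    exact (h.elim (fun h => h.perm.map _) (fun h => h.perm)).trans ih

theorem Moves.perm_snd {l l' f} (h : T.Moves l l' f) :
    (l.map Prod.snd).Perm (l'.map Prod.snd) := by
  induction h with
  | refl => exact .refl _
  | step _ _ _ _ _ h _ ih =>
    exact (h.elim (fun h => h.perm.map _) (fun h => .of_eq h.tags)).trans ih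

/-- An exchange after a carrying interchange can be replaced by exchanges before it. -/
theorem Carry.exchange {l m n f g} (hf : T.Carry l m f) (hg : T.Exchange m n g) :
    ∃ m' g' f', Chain T.Exchange l m' g' ∧ T.Carry m' n f' ∧ f ≫ g = g' ≫ f' := by
  have sing : ∀ {l l' f}, T.Exchange l l' f → Chain T.Exchange l l' f := fun h => .single h
  induction hf generalizing n with
  | swap x y i j l =>
    cases hg with
    | swap =>
      refine ⟨_, _, _, sing (.swap _ _ _ _ _), .swap _ _ _ _ _, ?_⟩
      ext P
      have := congrArg (word T.act (l.map Prod.fst)).map (T.car_exc x y P)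
      simp only [Functor.map_comp] at this
      exact this
    | cons _ _ n g hg =>
      cases hg with
      | swap _ z _ k l =>
        refine ⟨_, _, _, .step _ _ _ _ _ (.swap _ _ _ _ _) (.step _ _ _ _ _
          (.cons _ _ _ _ (.swap _ _ _ _ _)) (sing (.swap _ _ _ _ _))), .swap _ _ _ _ _, ?_⟩
        ext P
        have := congrArg (word T.act (l.map Prod.fst)).map (T.car_exc_left P x y z)
        simp only [Functor.map_comp] at this
        simp only [Category.assoc]
        exact this
      | cons _ _ n g hg =>
        exact ⟨_, _, _, sing (.cons _ _ _ _ (.cons _ _ _ _ hg)), .swap _ _ _ _ _,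
          front_under _ _⟩
  | cons p l m f hf ih =>
    cases hg with
    | swap x z i k l' =>
      cases hf with
      | swap y _ j _ l =>
        refine ⟨_, _, _, .step _ _ _ _ _ (.cons _ _ _ _ (.swap _ _ _ _ _)) (.step _ _ _ _ _
          (.swap _ _ _ _ _) (sing (.cons _ _ _ _ (.swap _ _ _ _ _)))),
          .cons _ _ _ _ (.swap _ _ _ _ _), ?_⟩
        ext P
        have := congrArg (word T.act (l.map Prod.fst)).map (T.car_exc_right P x y z)
        simp only [Functor.map_comp] at this
        simp only [Category.assoc]
        exact this
      | cons _ l m f hf =>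
        exact ⟨_, _, _, sing (.swap _ _ _ _ _), .cons _ _ _ _ (.cons _ _ _ _ hf),
          (front_under _ _).symm⟩
    | cons _ _ n g hg =>
      obtain ⟨m', g', f', h1, h2, e⟩ := ih hg
      exact ⟨_, _, _, Chain.cons (fun _ _ _ _ h => .cons _ _ _ _ h) h1 p, .cons _ _ _ _ h2,
        congrArg (under p.1) e⟩

theorem Carry.exchanges {l m n f g} (hf : T.Carry l m f) (hg : Chain T.Exchange m n g) :
    ∃ m' g' f', Chain T.Exchange l m' g' ∧ T.Carry m' n f' ∧ f ≫ g = g' ≫ f' := by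
  induction hg generalizing l with
  | refl => exact ⟨_, _, _, .refl _, hf, by simp⟩
  | step _ _ _ g₁ g₂ h _ ih =>
    obtain ⟨m₁, k₁, f₁, h₁, hf₁, e₁⟩ := hf.exchange h
    obtain ⟨m₂, k₂, f₂, h₂, hf₂, e₂⟩ := ih hf₁
    exact ⟨m₂, _, f₂, h₁.trans h₂, hf₂, by rw [reassoc_of% e₁, e₂, Category.assoc]⟩

/-- All interchanges that leave the tags in place can be done first. -/
theorem Moves.split {l n f} (h : T.Moves l n f) : ∃ m g k, Chain T.Exchange l m g ∧
    Chain T.Carry m n k ∧ f = g ≫ k := by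
  induction h with
  | refl => exact ⟨_, _, _, .refl _, .refl _, by simp⟩
  | step _ _ _ f₁ f₂ h _ ih =>
    obtain ⟨m, g, k, hg, hk, rfl⟩ := ih
    rcases h with h | h
    · obtain ⟨m', g', f', h1, h2, e⟩ := h.exchanges hg
      exact ⟨m', g', _, h1, .step _ _ _ _ _ h2 hk, by rw [reassoc_of% e]⟩
    · exact ⟨m, _, k, .step _ _ _ _ _ h hg, hk, by simp⟩

theorem Chain.carry_perm {l m f} (h : Chain T.Carry l m f) : l.Perm m := by
  induction h with
  | refl => exact .refl _
  | step _ _ _ _ _ h _ ih => exact h.perm.trans ih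

theorem Chain.exchange_tags {l m f} (h : Chain T.Exchange l m f) :
    l.map Prod.snd = m.map Prod.snd := by
  induction h with
  | refl => rfl
  | step _ _ _ _ _ h _ ih => exact h.tags.trans ih

theorem Chain.carry_adjs {l m f} (h : Chain T.Carry l m f) :
    Adjs T.car (l.map Prod.fst) (m.map Prod.fst) f := by
  induction h with
  | refl => exact .refl _
  | step _ _ _ _ _ h _ ih => exact .step _ _ _ _ _ h.adj ih

theorem Chain.exchange_adjs {l m f} (h : Chain T.Exchange l m f) :
    Adjs T.exc (l.map Prod.fst) (m.map Prod.fst) f := by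
  induction h with
  | refl => exact .refl _
  | step _ _ _ _ _ h _ ih => exact .step _ _ _ _ _ h.adj ih

end TaggedFamily

theorem List.Perm.eq_of_map_snd {l m : List (X × ℕ)} (h : l.Perm m)
    (e : l.map Prod.snd = m.map Prod.snd) (hl : (l.map Prod.snd).Nodup) : l = m := by
  induction l generalizing m with
  | nil => exact (List.nil_perm.1 h).symm
  | cons p l ih =>
    cases m with
    | nil => simp at e
    | cons q m =>
      simp only [List.map_cons, List.cons.injEq] at e
      have : p = q := List.inj_on_of_nodup_map hl List.mem_cons_self
        (h.symm.subset List.mem_cons_self) e.1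
      subst this
      rw [ih h.cons_inv e.2 (List.nodup_cons.1 hl).2]

namespace TaggedFamily

variable {T}

/-- Coherence for tagged families: a composite of interchanges of both kinds is determined by its
source and its target, if the letters are distinct and the tags are distinct. -/
theorem Moves.unique {l n f g} (hf : T.Moves l n f) (hg : T.Moves l n g)
    (h₁ : (n.map Prod.fst).Nodup) (h₂ : (n.map Prod.snd).Nodup) : f = g := by
  obtain ⟨m, f₁, f₂, hf₁, hf₂, rfl⟩ := hf.split
  obtain ⟨m', g₁, g₂, hg₁, hg₂, rfl⟩ := hg.split
  have hm := hf₂.carry_perm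
  obtain rfl : m = m' := (hm.trans hg₂.carry_perm.symm).eq_of_map_snd
    (hf₁.exchange_tags.symm.trans hg₁.exchange_tags) ((hm.map _).nodup_iff.2 h₂)
  rw [hf₁.exchange_adjs.unique T.exc_exc (fun x y z P => T.exc_braid P x y z) hg₁.exchange_adjs
      ((hm.map _).nodup_iff.2 h₁),
    hf₂.carry_adjs.unique T.car_car T.car_braid hg₂.carry_adjs h₁]

theorem Moves.of_perm {l l' : List (X × ℕ)} (h : l.Perm l') : ∃ f, T.Moves l l' f := by
  induction h with
  | nil => exact ⟨_, .refl _⟩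
  | cons x _ ih => exact ⟨_, ih.choose_spec.cons x⟩
  | swap x y l => exact ⟨_, .swap y x l⟩
  | trans _ _ ih ih' => exact ⟨_, ih.choose_spec.trans ih'.choose_spec⟩

/-- The letters can be rearranged while the list `t` of tags stays in place. -/
theorem Moves.of_perm_zip {a b : List X} (h : a.Perm b) (t : List ℕ) (ht : a.length ≤ t.length) :
    ∃ f, T.Moves (a.zip t) (b.zip t) f := by
  induction h generalizing t with
  | nil => exact ⟨_, .refl _⟩
  | cons x _ ih =>
    cases t with
    | nil => simp at ht
    | cons i t => exact ⟨_, (ih t (by simpa using ht)).choose_spec.cons (x, i)⟩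
  | swap x y l =>
    match t with
    | [] | [i] => simp at ht
    | i :: j :: t => exact ⟨_, .exchange y x i j _⟩
  | trans h _ ih ih' =>
    exact ⟨_, (ih t ht).choose_spec.trans (ih' t (h.length_eq ▸ ht)).choose_spec⟩

end TaggedFamily

theorem List.exists_perm_map_snd {l : List (X × ℕ)} {t : List ℕ} (h : (l.map Prod.snd).Perm t) :
    ∃ m, l.Perm m ∧ m.map Prod.snd = t := by
  induction t generalizing l with
  | nil => exact ⟨l, .refl _, List.perm_nil.1 h⟩
  | cons i t ih =>
    obtain ⟨p, hp, rfl⟩ := List.mem_map.1 (h.symm.subset List.mem_cons_self)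
    obtain ⟨a, b, rfl⟩ := List.append_of_mem hp
    obtain ⟨m, hm, rfl⟩ := ih (l := a ++ b) (by
      refine List.Perm.cons_inv (a := p.2) (List.Perm.trans ?_ h)
      exact (List.perm_middle (a := p).map Prod.snd).symm)
    exact ⟨p :: m, List.perm_middle.trans (hm.cons p), rfl⟩

namespace TaggedFamily

/-- Any rearrangement of the letters and of the tags is achieved by interchanges. -/
theorem Moves.exists {l l' : List (X × ℕ)} (h₁ : (l.map Prod.fst).Perm (l'.map Prod.fst))
    (h₂ : (l.map Prod.snd).Perm (l'.map Prod.snd)) : ∃ f, T.Moves l l' f := by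
  obtain ⟨m, hm, e⟩ := List.exists_perm_map_snd h₂
  obtain ⟨f, hf⟩ := Moves.of_perm (T := T) hm
  have key : ∀ m₁ m₂, m₁ = (m.map Prod.fst).zip (l'.map Prod.snd) →
      m₂ = (l'.map Prod.fst).zip (l'.map Prod.snd) → ∃ g, T.Moves m₁ m₂ g := by
    rintro _ _ rfl rfl
    exact Moves.of_perm_zip ((hm.map Prod.fst).symm.trans h₁) _ (by simp [← e])
  obtain ⟨g, hg⟩ := key m l' (List.zip_of_prod rfl e) (List.zip_of_prod rfl rfl)
  exact ⟨_, hf.trans hg⟩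

theorem Carry.isIso {l l' f} (h : T.Carry l l' f) : IsIso f := by
  induction h with
  | swap x y i j l =>
    refine ⟨front (T.car y x) _, ?_, ?_⟩ <;> ext P
    · have := congrArg (word T.act (l.map Prod.fst)).map (T.car_car x y P)
      rw [Functor.map_comp, CategoryTheory.Functor.map_id] at this
      exact this
    · have := congrArg (word T.act (l.map Prod.fst)).map (T.car_car y x P)
      rw [Functor.map_comp, CategoryTheory.Functor.map_id] at this
      exact this
  | cons p _ _ f _ ih => exact inferInstanceAs (IsIso (Functor.whiskerLeft (T.act p.1) f))

theorem Exchange.isIso {l l' f} (h : T.Exchange l l' f) : IsIso f := by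
  induction h with
  | swap x y i j l =>
    refine ⟨front (T.exc y x) _, ?_, ?_⟩ <;> ext P
    · have := congrArg (word T.act (l.map Prod.fst)).map (T.exc_exc x y P)
      rw [Functor.map_comp, CategoryTheory.Functor.map_id] at this
      exact this
    · have := congrArg (word T.act (l.map Prod.fst)).map (T.exc_exc y x P)
      rw [Functor.map_comp, CategoryTheory.Functor.map_id] at this
      exact this
  | cons p _ _ f _ ih => exact inferInstanceAs (IsIso (Functor.whiskerLeft (T.act p.1) f))

theorem Moves.isIso {l l' f} (h : T.Moves l l' f) : IsIso f := by
  induction h with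
  | refl => infer_instance
  | step _ _ _ f g h _ ih =>
    have : IsIso f := h.elim (fun h => h.isIso) (fun h => h.isIso)
    infer_instance

end TaggedFamily
end Tagged

/-! ### Elementary identities for `a`, `q` and `c` -/

namespace QTensor

variable {C : Type u} [Category.{v} C] {S : QTensor C}

section Basic

theorem hm_comp {X X' X'' Y Y' Y'' : C} (f : X ⟶ X') (f' : X' ⟶ X'') (g : Y ⟶ Y') (g' : Y' ⟶ Y'') :
    S.hm (f ≫ f') (g ≫ g') = S.hm f g ≫ S.hm f' g' :=
  S.tensor.map_comp (Prod.mkHom f g) (Prod.mkHom f' g')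

theorem hm_id (X Y : C) : S.hm (𝟙 X) (𝟙 Y) = 𝟙 (S.ob X Y) := S.tensor.map_id (X, Y)

theorem onL_comp {X X' X'' : C} (f : X ⟶ X') (f' : X' ⟶ X'') (Y : C) :
    S.onL (f ≫ f') Y = S.onL f Y ≫ S.onL f' Y := by
  simp only [onL, ← hm_comp, Category.comp_id]

theorem onR_comp (X : C) {Y Y' Y'' : C} (g : Y ⟶ Y') (g' : Y' ⟶ Y'') :
    S.onR X (g ≫ g') = S.onR X g ≫ S.onR X g' := by
  simp only [onR, ← hm_comp, Category.comp_id]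

theorem onL_id (X Y : C) : S.onL (𝟙 X) Y = 𝟙 (S.ob X Y) := S.hm_id X Y

theorem onR_id (X Y : C) : S.onR X (𝟙 Y) = 𝟙 (S.ob X Y) := S.hm_id X Y

theorem onL_onR {X X' Y Y' : C} (f : X ⟶ X') (g : Y ⟶ Y') :
    S.onL f Y ≫ S.onR X' g = S.onR X g ≫ S.onL f Y' := by
  simp only [onL, onR, ← hm_comp, Category.comp_id, Category.id_comp]

theorem a_a' (X Y Z : C) : S.a X Y Z ≫ S.a' X Y Z = 𝟙 _ := (S.aIso X Y Z).hom_inv_id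

theorem a'_a (X Y Z : C) : S.a' X Y Z ≫ S.a X Y Z = 𝟙 _ := (S.aIso X Y Z).inv_hom_id

theorem hm_a {X X' Y Y' Z Z' : C} (f : X ⟶ X') (g : Y ⟶ Y') (h : Z ⟶ Z') :
    S.hm (S.hm f g) h ≫ S.a X' Y' Z' = S.a X Y Z ≫ S.hm f (S.hm g h) :=
  S.assoc.hom.naturality (X := ((X, Y), Z)) (Y := ((X', Y'), Z'))
    (Prod.mkHom (Prod.mkHom f g) h)

theorem onL_onL_a {X X' : C} (f : X ⟶ X') (Y Z : C) :
    S.onL (S.onL f Y) Z ≫ S.a X' Y Z = S.a X Y Z ≫ S.onL f (S.ob Y Z) := by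
  simp only [onL, hm_a, hm_id]

theorem onL_onR_a (X : C) {Y Y' : C} (g : Y ⟶ Y') (Z : C) :
    S.onL (S.onR X g) Z ≫ S.a X Y' Z = S.a X Y Z ≫ S.onR X (S.onL g Z) := by
  simp only [onL, onR, hm_a]

theorem onR_a (X Y : C) {Z Z' : C} (h : Z ⟶ Z') :
    S.onR (S.ob X Y) h ≫ S.a X Y Z' = S.a X Y Z ≫ S.onR X (S.onR Y h) := by
  simp only [onR, ← hm_id, hm_a]

theorem onL_a' {X X' : C} (f : X ⟶ X') (Y Z : C) :
    S.onL f (S.ob Y Z) ≫ S.a' X' Y Z = S.a' X Y Z ≫ S.onL (S.onL f Y) Z := by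
  have e := S.onL_onL_a f Y Z
  have e₁ := S.a_a' X' Y Z
  have e₂ := S.a'_a X Y Z
  have := congrArg (fun k => S.a' X Y Z ≫ k ≫ S.a' X' Y Z) e
  simpa only [Category.assoc, e₁, reassoc_of% e₂, Category.comp_id] using this.symm

theorem hm_qq {X X' Y Y' : C} (f : X ⟶ X') (g : Y ⟶ Y') :
    S.hm f g ≫ S.qq X' Y' = S.qq X Y ≫ S.hm f g :=
  S.q.hom.naturality (X := (X, Y)) (Y := (X', Y')) (Prod.mkHom f g)

theorem onL_qq {X X' : C} (f : X ⟶ X') (Y : C) :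
    S.onL f Y ≫ S.qq X' Y = S.qq X Y ≫ S.onL f Y := S.hm_qq f _

theorem onR_qq (X : C) {Y Y' : C} (g : Y ⟶ Y') :
    S.onR X g ≫ S.qq X Y' = S.qq X Y ≫ S.onR X g := S.hm_qq _ g

theorem qq_qq' (X Y : C) : S.qq X Y ≫ S.qq' X Y = 𝟙 _ := (S.qIso X Y).hom_inv_id

variable (c : S.Commutativity)

theorem hm_cc {X X' Y Y' : C} (f : X ⟶ X') (g : Y ⟶ Y') :
    S.hm f g ≫ c.cc X' Y' = c.cc X Y ≫ S.hm g f :=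
  c.hom.naturality (X := (X, Y)) (Y := (X', Y')) (Prod.mkHom f g)

theorem onR_cc (X : C) {Y Y' : C} (g : Y ⟶ Y') :
    S.onR X g ≫ c.cc X Y' = c.cc X Y ≫ S.onL g X := hm_cc c _ g

theorem cc'_cc (X Y : C) : c.cc' X Y ≫ c.cc X Y = 𝟙 _ := (c.iso X Y).inv_hom_id

end Basic

/-- The hypotheses of the coherence theorem that enter its proof: `q` and `c` are symmetric, `q`
satisfies the Pentagon, the Dodecagon and the second Quaddecagon, and `c` satisfies the Square, the
Hexagon and the Decagons. -/
structure Commutativity.Compatible (c : S.Commutativity) : Prop where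
  qPentagon : S.QPentagon
  dodecagon : S.Dodecagon
  quaddecagon : S.Quaddecagon₂
  qSymmetric : S.QSymmetric
  symmetric : c.Symmetric
  square : c.Square
  hexagon : c.Hexagon
  decagon₁ : c.Decagon₁
  decagon₂ : c.Decagon₂

/-- The arrow `(W ⊗ X) ⊗ Y ⟶ (W ⊗ X') ⊗ Y'` that corresponds to `g : X ⊗ Y ⟶ X' ⊗ Y'`. -/
def onMid (S : QTensor C) (W : C) {X Y X' Y' : C} (g : S.ob X Y ⟶ S.ob X' Y') :
    S.ob (S.ob W X) Y ⟶ S.ob (S.ob W X') Y' :=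
  S.a W X Y ≫ S.onR W g ≫ S.a' W X' Y'

theorem onMid_comp (W : C) {X Y X' Y' X'' Y'' : C} (g : S.ob X Y ⟶ S.ob X' Y')
    (h : S.ob X' Y' ⟶ S.ob X'' Y'') : S.onMid W (g ≫ h) = S.onMid W g ≫ S.onMid W h := by
  have := S.a'_a W X' Y'
  simp only [onMid, Category.assoc, reassoc_of% this, onR_comp]

theorem onMid_id (W X Y : C) : S.onMid W (𝟙 (S.ob X Y)) = 𝟙 _ := by
  rw [onMid, onR_id, Category.id_comp, a_a']

theorem onL_onMid {W W' : C} (f : W ⟶ W') {X Y X' Y' : C} (g : S.ob X Y ⟶ S.ob X' Y') :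
    S.onL (S.onL f X) Y ≫ S.onMid W' g = S.onMid W g ≫ S.onL (S.onL f X') Y' := by
  have h₁ := S.onL_onL_a f X Y
  have h₅ := S.onL_onR f g
  have h₆ := (S.onL_a' f X' Y').symm
  simp only [onMid, Category.assoc, h₆]
  rw [reassoc_of% h₁, reassoc_of% h₅]

/-- The isomorphism `((W ⊗ X) ⊗ Y) ⊗ Z ⟶ W ⊗ ((X ⊗ Y) ⊗ Z)`. -/
def gather (S : QTensor C) (W X Y Z : C) :
    S.ob (S.ob (S.ob W X) Y) Z ⟶ S.ob W (S.ob (S.ob X Y) Z) :=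
  S.onL (S.a W X Y) Z ≫ S.a W (S.ob X Y) Z

instance (W X Y Z : C) : IsIso (S.gather W X Y Z) := by
  refine ⟨S.a' W (S.ob X Y) Z ≫ S.onL (S.a' W X Y) Z, ?_, ?_⟩
  · have := S.a_a' W (S.ob X Y) Z
    simp only [gather, Category.assoc, reassoc_of% this, ← onL_comp, a_a', onL_id]
  · have := congrArg (S.onL · Z) (S.a'_a W X Y)
    simp only [onL_comp, onL_id] at this
    simp only [gather, Category.assoc, reassoc_of% this, a'_a]

theorem onL_onMid_gather (W : C) {X Y X' Y' : C} (g : S.ob X Y ⟶ S.ob X' Y') (Z : C) :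
    S.onL (S.onMid W g) Z ≫ S.gather W X' Y' Z = S.gather W X Y Z ≫ S.onR W (S.onL g Z) := by
  have := congrArg (S.onL · Z) (S.a'_a W X' Y')
  simp only [onL_comp, onL_id] at this
  simp only [gather, onMid, onL_comp, Category.assoc, reassoc_of% this, onL_onR_a]

theorem onMid_gather (hP : S.QPentagon) (W X : C) {Y Z Y' Z' : C} (g : S.ob Y Z ⟶ S.ob Y' Z') :
    S.onMid (S.ob W X) g ≫ S.gather W X Y' Z' = S.gather W X Y Z ≫ S.onR W (S.onMid X g) := by
  have e : ∀ Y Z, S.gather W X Y Z ≫ S.onR W (S.a X Y Z) =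
      S.a (S.ob W X) Y Z ≫ S.qq (S.ob W X) (S.ob Y Z) ≫ S.a W X (S.ob Y Z) := fun Y Z => by
    rw [gather, Category.assoc]; exact (hP W X Y Z).symm
  have i : IsIso (S.onR W (S.a X Y' Z')) := by
    refine ⟨S.onR W (S.a' X Y' Z'), ?_, ?_⟩
    · rw [← onR_comp, a_a', onR_id]
    · rw [← onR_comp, a'_a, onR_id]
  rw [← cancel_mono (S.onR W (S.a X Y' Z')), Category.assoc, e, Category.assoc, ← onR_comp]
  have h₁ := S.a'_a (S.ob W X) Y' Z'
  have h₂ := S.onR_qq (S.ob W X) g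
  simp only [onMid, Category.assoc, reassoc_of% h₁, a'_a, Category.comp_id, onR_comp]
  have e' := e Y Z
  rw [reassoc_of% e', reassoc_of% h₂, onR_a]

end QTensor

/-! ### Objects as letters -/

namespace QTensor

variable {C : Type u} [Category.{v} C] {S : QTensor C} {c : S.Commutativity}

namespace Commutativity.Compatible

variable (h : c.Compatible)
include h

theorem qq'_eq (X Y : C) : S.qq' X Y = S.qq X Y := by
  have := congrArg (S.qq X Y ≫ ·) (S.qq_qq' X Y)
  have e := h.qSymmetric X Y
  simpa only [reassoc_of% e, Category.comp_id] using this

theorem cc'_eq (X Y : C) : c.cc' X Y = c.cc Y X := by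
  have := congrArg (· ≫ c.cc Y X) (cc'_cc c X Y)
  have e := h.symmetric X Y
  simpa only [Category.assoc, e, Category.comp_id, Category.id_comp] using this

theorem qq_cc (X Y : C) : S.qq X Y ≫ c.cc X Y = c.cc X Y ≫ S.qq Y X := by
  have e := h.square X Y
  have e' := h.qSymmetric X Y
  rw [h.cc'_eq] at e
  conv_lhs => rw [e]
  rw [reassoc_of% e']

/-- The Dodecagon in terms of the exchanges of tags at the two adjacent places. -/
theorem tag_braid (X Y Z : C) :
    S.onL (S.qq X Y) Z ≫ S.onMid X (S.qq Y Z) ≫ S.onL (S.qq X Y) Z =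
      S.onMid X (S.qq Y Z) ≫ S.onL (S.qq X Y) Z ≫ S.onMid X (S.qq Y Z) := by
  have := congrArg (· ≫ S.a' X Y Z) (h.dodecagon X Y Z)
  simp only [Category.assoc, a_a', Category.comp_id] at this
  simp only [onMid, Category.assoc]
  exact this.symm

/-- The Hexagon: the commutativity carries `X` across `Y ⊗ Z` in two steps. -/
theorem hexagon' (X Y Z : C) : S.onL (c.cc X Y) Z ≫ S.onMid Y (c.cc X Z) =
    S.a X Y Z ≫ c.cc X (S.ob Y Z) := by
  have := congrArg (· ≫ S.a' Y Z X) (h.hexagon X Y Z)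
  simp only [Category.assoc, a_a', Category.comp_id] at this
  simp only [onMid]
  exact this.symm

theorem car_braid (X Y Z : C) :
    S.onL (c.cc X Y) Z ≫ S.onMid Y (c.cc X Z) ≫ S.onL (c.cc Y Z) X =
      S.onMid X (c.cc Y Z) ≫ S.onL (c.cc X Z) Y ≫ S.onMid Z (c.cc X Y) := by
  have h₁ := h.hexagon' X Y Z
  have h₂ := S.a'_a X Z Y
  rw [reassoc_of% h₁, h.hexagon', onMid, Category.assoc, Category.assoc, reassoc_of% h₂, onR_cc]

theorem car_tag_left (X Y Z : C) : S.onL (c.cc X Y) Z ≫ S.onMid Y (S.qq X Z) =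
    S.onL (S.qq X Y) Z ≫ S.onMid X (S.qq Y Z) ≫ S.onL (S.qq X Y) Z ≫ S.onL (c.cc X Y) Z := by
  have e := h.decagon₁ X Y Z
  simp only [h.qq'_eq, h.cc'_eq] at e
  rw [← Category.assoc (S.onL _ _), ← onL_comp, ← h.qq_cc, onL_comp, Category.assoc] at e
  have := congrArg (S.onL (S.qq X Y) Z ≫ ·) e
  have e' := congrArg (S.onL · Z) (h.qSymmetric X Y)
  simp only [onL_comp, onL_id] at e'
  simp only [reassoc_of% e'] at this
  simpa only [onMid, Category.assoc] using this

theorem car_tag_right (X Y Z : C) : S.onMid X (c.cc Y Z) ≫ S.onL (S.qq X Z) Y =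
    S.onMid X (S.qq Y Z) ≫ S.onL (S.qq X Y) Z ≫ S.onMid X (S.qq Y Z) ≫
      S.onMid X (c.cc Y Z) := by
  have e := congrArg (fun f => S.a X Y Z ≫ f ≫ S.a' X Z Y) (h.decagon₂ X Y Z)
  have i := S.a_a' X Y Z
  simp only [h.qq'_eq, h.cc'_eq, Category.assoc, a_a', Category.comp_id, reassoc_of% i] at e
  have e₁ : S.onMid X (c.cc Y Z ≫ S.qq Z Y) ≫ S.onL (S.qq X Z) Y =
      S.onL (S.qq X Y) Z ≫ S.onMid X (S.qq Y Z ≫ c.cc Y Z) := by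
    simpa only [onMid, Category.assoc, onR_comp] using e
  rw [← h.qq_cc, onMid_comp, Category.assoc] at e₁
  have := congrArg (S.onMid X (S.qq Y Z) ≫ ·) e₁
  have e' := congrArg (S.onMid X ·) (h.qSymmetric Y Z)
  simp only [onMid_comp, onMid_id] at e'
  simpa only [reassoc_of% e', onMid_comp, Category.assoc] using this

end Commutativity.Compatible

/-- The objects of `C` and one more object, `empty`, with no arrows between the two sorts. It serves
as the unit that `C` need not have: the product of an empty list. -/
inductive Pre (C : Type u) : Type u
  | empty : Pre C
  | of (X : C) : Pre C

/-- The arrows of `Pre C`. -/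
def Pre.Hom : Pre C → Pre C → Type v
  | .empty, .empty => PUnit
  | .of X, .of Y => X ⟶ Y
  | _, _ => PEmpty

instance : Category.{v} (Pre C) where
  Hom := Pre.Hom
  id
    | .empty => PUnit.unit
    | .of X => 𝟙 X
  comp {P Q R} f g :=
    match P, Q, R, f, g with
    | .empty, .empty, .empty, _, _ => PUnit.unit
    | .of _, .of _, .of _, f, g => CategoryStruct.comp (obj := C) f g
  id_comp {P Q} f := by
    cases P <;> cases Q <;> first | rfl | exact f.elim | exact Category.id_comp (obj := C) f
  comp_id {P Q} f := by
    cases P <;> cases Q <;> first | rfl | exact f.elim | exact Category.comp_id (obj := C) f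
  assoc {P Q R T} f g k := by
    cases P <;> cases Q <;> cases R <;> cases T <;>
      first | rfl | exact f.elim | exact g.elim | exact k.elim | exact Category.assoc (obj := C) f g k

/-- An arrow of `C` as an arrow of `Pre C`. -/
def Pre.homOf {X Y : C} (f : X ⟶ Y) : Pre.of X ⟶ Pre.of Y := f

theorem Pre.homOf_comp {X Y Z : C} (f : X ⟶ Y) (g : Y ⟶ Z) :
    Pre.homOf (f ≫ g) = Pre.homOf f ≫ Pre.homOf g := rfl

theorem Pre.homOf_id (X : C) : Pre.homOf (𝟙 X) = 𝟙 _ := rfl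

/-- Multiplication by `X` on the right; the product of `empty` and `X` is `X`. -/
def mulRight (S : QTensor C) (X : C) : Pre C ⥤ Pre C where
  obj
    | .empty => .of X
    | .of W => .of (S.ob W X)
  map {P Q} f :=
    match P, Q, f with
    | .empty, .empty, _ => 𝟙 (Pre.of X)
    | .of _, .of _, f => Pre.homOf (S.onL f X)
  map_id P := by
    cases P
    · rfl
    · exact S.onL_id _ _
  map_comp {P Q R} f g := by
    cases P <;> cases Q <;> cases R <;>
      first
        | exact f.elim
        | exact g.elim
        | exact (Category.id_comp (obj := C) _).symm
        | exact S.onL_comp (C := C) f g _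

/-- The transformation of products with two adjacent factors given by `g`. -/
def pair (S : QTensor C) {X Y X' Y' : C} (g : S.ob X Y ⟶ S.ob X' Y') :
    S.mulRight X ⋙ S.mulRight Y ⟶ S.mulRight X' ⋙ S.mulRight Y' where
  app
    | .empty => Pre.homOf g
    | .of W => Pre.homOf (S.onMid W g)
  naturality P Q f := by
    cases P <;> cases Q <;> first | exact f.elim | skip
    · exact ((S.mulRight X ⋙ S.mulRight Y).map_id .empty ▸ Category.id_comp _).trans
        ((S.mulRight X' ⋙ S.mulRight Y').map_id .empty ▸ Category.comp_id _).symm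
    · exact S.onL_onMid (C := C) f g

theorem onL_onMid_eq (W : C) {X Y X' Y' : C} (g : S.ob X Y ⟶ S.ob X' Y') (Z : C) :
    S.onL (S.onMid W g) Z =
      S.gather W X Y Z ≫ S.onR W (S.onL g Z) ≫ inv (S.gather W X' Y' Z) := by
  rw [← Category.assoc, ← onL_onMid_gather, Category.assoc, IsIso.hom_inv_id, Category.comp_id]

theorem onMid_onMid_eq (hP : S.QPentagon) (W X : C) {Y Z Y' Z' : C}
    (g : S.ob Y Z ⟶ S.ob Y' Z') : S.onMid (S.ob W X) g =
      S.gather W X Y Z ≫ S.onR W (S.onMid X g) ≫ inv (S.gather W X Y' Z') := by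
  rw [← Category.assoc, ← onMid_gather hP, Category.assoc, IsIso.hom_inv_id, Category.comp_id]

/-- The letters of a type `L` stand for objects of `C` and act by multiplication on the right; `q`
exchanges tags and `c` interchanges letters. The relations hold at `empty` by hypothesis; they hold
at `W` because `gather` conjugates the two operations on `((W ⊗ X) ⊗ Y) ⊗ Z` into those on
`(X ⊗ Y) ⊗ Z`, by the `q`-Pentagon. -/
def Commutativity.Compatible.family (h : c.Compatible) {L : Type*} (ev : L → C) :
    TaggedFamily (Pre C) L where
  act x := S.mulRight (ev x)
  tag x y := S.pair (S.qq (ev x) (ev y))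
  car x y := S.pair (c.cc (ev x) (ev y))
  tag_tag x y
    | .empty => h.qSymmetric _ _
    | .of W => (S.onMid_comp W _ _).symm.trans ((congrArg (S.onMid W) (h.qSymmetric _ _)).trans
        (S.onMid_id W _ _))
  car_car x y
    | .empty => h.symmetric _ _
    | .of W => (S.onMid_comp W _ _).symm.trans ((congrArg (S.onMid W) (h.symmetric _ _)).trans
        (S.onMid_id W _ _))
  tag_car x y
    | .empty => h.qq_cc _ _
    | .of W => (S.onMid_comp W _ _).symm.trans ((congrArg (S.onMid W) (h.qq_cc _ _)).trans
        (S.onMid_comp W _ _))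
  tag_braid x y z
    | .empty => h.tag_braid _ _ _
    | .of W => by
      have e := congrArg (S.onR W) (h.tag_braid (ev x) (ev y) (ev z))
      change S.onL (S.onMid W _) _ ≫ S.onMid (S.ob W _) _ ≫ S.onL (S.onMid W _) _ =
        S.onMid (S.ob W _) _ ≫ S.onL (S.onMid W _) _ ≫ S.onMid (S.ob W _) _
      simp only [onR_comp] at e
      simp only [onL_onMid_eq, onMid_onMid_eq h.qPentagon, Category.assoc,
        IsIso.inv_hom_id_assoc, reassoc_of% e]
  car_braid x y z
    | .empty => h.car_braid _ _ _
    | .of W => by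
      have e := congrArg (S.onR W) (h.car_braid (ev x) (ev y) (ev z))
      change S.onL (S.onMid W _) _ ≫ S.onMid (S.ob W _) _ ≫ S.onL (S.onMid W _) _ =
        S.onMid (S.ob W _) _ ≫ S.onL (S.onMid W _) _ ≫ S.onMid (S.ob W _) _
      simp only [onR_comp] at e
      simp only [onL_onMid_eq, onMid_onMid_eq h.qPentagon, Category.assoc,
        IsIso.inv_hom_id_assoc, reassoc_of% e]
  car_tag_left x y z
    | .empty => h.car_tag_left _ _ _
    | .of W => by
      have e := congrArg (S.onR W) (h.car_tag_left (ev x) (ev y) (ev z))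
      change S.onL (S.onMid W _) _ ≫ S.onMid (S.ob W _) _ = S.onL (S.onMid W _) _ ≫
        S.onMid (S.ob W _) _ ≫ S.onL (S.onMid W _) _ ≫ S.onL (S.onMid W _) _
      simp only [onR_comp] at e
      simp only [onL_onMid_eq, onMid_onMid_eq h.qPentagon, Category.assoc,
        IsIso.inv_hom_id_assoc, reassoc_of% e]
  car_tag_right x y z
    | .empty => h.car_tag_right _ _ _
    | .of W => by
      have e := congrArg (S.onR W) (h.car_tag_right (ev x) (ev y) (ev z))
      change S.onMid (S.ob W _) _ ≫ S.onL (S.onMid W _) _ = S.onMid (S.ob W _) _ ≫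
        S.onL (S.onMid W _) _ ≫ S.onMid (S.ob W _) _ ≫ S.onMid (S.ob W _) _
      simp only [onR_comp] at e
      simp only [onL_onMid_eq, onMid_onMid_eq h.qPentagon, Category.assoc,
        IsIso.inv_hom_id_assoc, reassoc_of% e]

namespace Commutativity.Compatible

variable (h : c.Compatible)
include h

/-- Reattachment agrees with splitting the right hand factor, carried to the front. -/
theorem assoc_split (α β γ : C) :
    S.a α β γ ≫ c.cc α (S.ob β γ) ≫ S.onMid β (c.cc γ α) ≫ S.onL (c.cc β α) γ = 𝟙 _ := by
  have e := h.hexagon' α β γ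
  have e₁ := congrArg (S.onMid β) (h.symmetric α γ)
  have e₂ := congrArg (S.onL · γ) (h.symmetric α β)
  simp only [onMid_comp, onMid_id] at e₁
  simp only [onL_comp, onL_id] at e₂
  rw [← reassoc_of% e, reassoc_of% e₁, e₂]

/-- The commutativity past a product, followed by the return past its two factors, is a
reattachment. -/
theorem split_front (α β γ : C) :
    c.cc α (S.ob β γ) ≫ S.onMid β (c.cc γ α) ≫ S.onL (c.cc β α) γ = S.a' α β γ := by
  have := congrArg (S.a' α β γ ≫ ·) (h.assoc_split α β γ)
  have e := S.a'_a α β γ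
  simpa only [reassoc_of% e, Category.comp_id] using this

/-- Splitting `α ⊗ β` and then `Z = γ ⊗ δ`, which is carried to the front, agrees with splitting
`Z` first after the exchange of the tags of `α ⊗ β` and `Z`. -/
theorem split_comm (α β γ δ : C) :
    S.onMid α (c.cc β (S.ob γ δ)) ≫ S.onL (c.cc α (S.ob γ δ)) β ≫
      S.onL (S.onMid γ (c.cc δ α)) β ≫ S.onL (S.onL (c.cc γ α) δ) β ≫
        S.onMid (S.ob α γ) (c.cc δ β) ≫ S.onL (S.onMid α (c.cc γ β)) δ =
    S.qq (S.ob α β) (S.ob γ δ) ≫ S.a' (S.ob α β) γ δ := by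
  have e₁ := congrArg (S.onL · β) (h.split_front α γ δ)
  simp only [onL_comp] at e₁
  have e₂ : S.onMid γ (c.cc δ β) ≫ S.onL (c.cc γ β) δ = c.cc (S.ob γ δ) β ≫ S.a' β γ δ := by
    have := h.symmetric (S.ob γ δ) β
    rw [← h.split_front, reassoc_of% this]
  have e₃ : S.onL (S.a' α γ δ) β ≫ S.gather α γ δ β = S.a α (S.ob γ δ) β := by
    have := congrArg (S.onL · β) (S.a'_a α γ δ)
    simp only [onL_comp, onL_id] at this
    rw [gather, reassoc_of% this]
  have e₄ := congrArg (S.onR α) (h.symmetric β (S.ob γ δ))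
  simp only [onR_comp, onR_id] at e₄
  have e₅ := S.a'_a α (S.ob γ δ) β
  have e₆ := h.qSymmetric (S.ob α β) (S.ob γ δ)
  have e₇ := S.a'_a (S.ob α β) γ δ
  have e₈ := congrArg (S.onR α) (S.a'_a β γ δ)
  simp only [onR_comp, onR_id] at e₈
  have i : IsIso (S.onR α (S.a β γ δ)) := by
    refine ⟨S.onR α (S.a' β γ δ), ?_, ?_⟩
    · rw [← onR_comp, a_a', onR_id]
    · rw [← onR_comp, a'_a, onR_id]
  rw [reassoc_of% e₁, onL_onMid_eq, onMid_onMid_eq h.qPentagon]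
  simp only [Category.assoc, IsIso.inv_hom_id_assoc]
  rw [← reassoc_of% (S.onR_comp α (S.onMid γ (c.cc δ β))), e₂, reassoc_of% e₃, onMid, onR_comp]
  simp only [Category.assoc, reassoc_of% e₅, reassoc_of% e₄]
  rw [← cancel_mono (S.gather α β γ δ ≫ S.onR α (S.a β γ δ))]
  simp only [Category.assoc, IsIso.inv_hom_id_assoc, e₈, Category.comp_id]
  simp only [gather, Category.assoc]
  have p := h.qPentagon α β γ δ
  rw [← p, reassoc_of% e₇]
  simp only [q₄, reassoc_of% e₆]

/-- The second Quaddecagon: the exchange of tags after a reattachment, in terms of exchanges before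
the reattachment. -/
theorem assoc_tag (α β γ δ : C) :
    S.onL (S.a α β γ) δ ≫ S.onMid α (S.qq (S.ob β γ) δ) =
      S.onMid (S.ob α β) (c.cc γ δ) ≫ S.onL (S.qq (S.ob α β) δ) γ ≫
        S.onMid (S.ob α β) (c.cc δ γ) ≫ S.onL (S.a α β γ) δ := by
  have e₁ := h.car_tag_right (S.ob α β) γ δ
  have e₂ := congrArg (S.onMid (S.ob α β)) (h.symmetric γ δ)
  simp only [onMid_comp, onMid_id] at e₂
  rw [reassoc_of% e₁, reassoc_of% e₂]
  have i : IsIso (S.onR α (S.a β γ δ)) := by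
    refine ⟨S.onR α (S.a' β γ δ), ?_, ?_⟩
    · rw [← onR_comp, a_a', onR_id]
    · rw [← onR_comp, a'_a, onR_id]
  have j : IsIso (S.a α (S.ob β γ) δ) := ⟨_, S.a_a' _ _ _, S.a'_a _ _ _⟩
  rw [← cancel_mono (S.a α (S.ob β γ) δ ≫ S.onR α (S.a β γ δ))]
  have p := h.qPentagon α β γ δ
  have Q := congrArg (S.a (S.ob α β) γ δ ≫ ·) (h.quaddecagon α β γ δ)
  have e₃ := S.a_a' (S.ob α β) γ δ
  have e₄ := S.onL_qq (S.a α β γ) δ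
  have e₅ := h.qSymmetric (S.ob (S.ob α β) γ) δ
  have e₆ := S.a'_a α (S.ob β γ) δ
  have e₇ := S.a'_a (S.ob α β) γ δ
  have e₈ := S.onR_qq (S.ob α β) (S.qq γ δ)
  simp only [h.qq'_eq, reassoc_of% e₃, reassoc_of% e₄, reassoc_of% e₅] at Q
  simp only [onMid, Category.assoc, reassoc_of% e₆]
  rw [Q, ← p, q₄, reassoc_of% e₇, reassoc_of% e₈]

end Commutativity.Compatible

end QTensor

/-! ### Forests -/

namespace LTree

variable {n : ℕ}

/-- The number of internal nodes. -/
def size : LTree n → ℕ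
  | leaf _ => 0
  | node _ L _ R => L.size + R.size + 1

theorem Grows.mono {k l : ℕ} {T : LTree n} (h : T.Grows l) (hk : k ≤ l) : T.Grows k := by
  cases T with
  | leaf => trivial
  | node => exact ⟨hk.trans_lt h.1, hk.trans_lt h.2.1, h.2.2⟩

theorem numbers_ne_nil (T : LTree n) : T.numbers ≠ [] := by
  induction T with
  | leaf => simp [numbers]
  | node _ _ _ _ ih => simp [numbers, ih]

theorem exists_node {T : LTree n} (h : T.size ≠ 0) : ∃ x A y B, T = node x A y B := by
  cases T with
  | leaf => exact absurd rfl h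
  | node x A y B => exact ⟨x, A, y, B, rfl⟩

theorem grows_of_size {T : LTree n} (h : T.size = 0) (k : ℕ) : T.Grows k := by
  cases T with
  | leaf => trivial
  | node => simp [size] at h

theorem eq_leaf {T : LTree n} (h : T.size = 0) : ∃ i, T = leaf i := by
  cases T with
  | leaf i => exact ⟨i, rfl⟩
  | node => simp [size] at h

end LTree

/-- Trees with levels for their roots; the levels serve as tags. -/
abbrev Forest (n : ℕ) : Type := List (LTree n × ℕ)

namespace Forest

variable {n : ℕ}

/-- The number of internal nodes. -/
def size (F : Forest n) : ℕ := ((F.map Prod.fst).map LTree.size).sum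

/-- The levels of all nodes are distinct, each number belongs to one leaf, and the levels increase
away from the roots. -/
structure Proper (F : Forest n) : Prop where
  levels : (F.map Prod.snd ++ (F.map Prod.fst).flatMap LTree.levels).Nodup
  numbers : ((F.map Prod.fst).flatMap LTree.numbers).Perm (List.finRange n)
  grows : ∀ p ∈ F, p.1.Grows p.2

/-- The same letters and the same tags, possibly attached to each other in another way. -/
structure Mixes {X : Type*} (F G : List (X × ℕ)) : Prop where
  fst : (F.map Prod.fst).Perm (G.map Prod.fst)
  snd : (F.map Prod.snd).Perm (G.map Prod.snd)

theorem Mixes.symm {X : Type*} {F G : List (X × ℕ)} (h : Mixes F G) : Mixes G F :=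
  ⟨h.fst.symm, h.snd.symm⟩

theorem Mixes.trans {X : Type*} {F G H : List (X × ℕ)} (h : Mixes F G) (h' : Mixes G H) :
    Mixes F H := ⟨h.fst.trans h'.fst, h.snd.trans h'.snd⟩

theorem Mixes.of_perm {X : Type*} {F G : List (X × ℕ)} (h : F.Perm G) : Mixes F G :=
  ⟨h.map _, h.map _⟩

theorem Mixes.cons {X : Type*} {F G : List (X × ℕ)} (h : Mixes F G) (p : X × ℕ) :
    Mixes (p :: F) (p :: G) := ⟨h.fst.cons _, h.snd.cons _⟩

theorem Mixes.cons_inv {X : Type*} {F G : List (X × ℕ)} {p : X × ℕ}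
    (h : Mixes (p :: F) (p :: G)) : Mixes F G := ⟨h.fst.cons_inv, h.snd.cons_inv⟩

theorem Mixes.size {F G : Forest n} (h : Mixes F G) : F.size = G.size :=
  (h.fst.map _).sum_nat

theorem Mixes.exists_fst {X : Type*} {F G : List (X × ℕ)} (h : Mixes F G) {p : X × ℕ}
    (hp : p ∈ F) : ∃ k, (p.1, k) ∈ G := by
  obtain ⟨⟨T, k⟩, hk, e⟩ := List.mem_map.1 (h.fst.subset (List.mem_map_of_mem hp))
  exact ⟨k, by simpa [← e] using hk⟩

namespace Proper

variable {F G : Forest n}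

theorem snd_nodup (h : F.Proper) : (F.map Prod.snd).Nodup := (List.nodup_append.1 h.levels).1

theorem fst_nodup (h : F.Proper) : (F.map Prod.fst).Nodup := by
  have := (h.numbers.nodup_iff.2 (List.nodup_finRange n))
  refine (List.nodup_flatMap.1 this).2.imp fun {T T'} hd e => ?_
  subst e
  obtain ⟨i, hi⟩ := List.exists_mem_of_ne_nil _ T.numbers_ne_nil
  exact hd hi hi

theorem eq_of_fst (h : F.Proper) {p q : LTree n × ℕ} (hp : p ∈ F) (hq : q ∈ F) (e : p.1 = q.1) :
    p = q := List.inj_on_of_nodup_map h.fst_nodup hp hq e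

theorem eq_of_snd (h : F.Proper) {p q : LTree n × ℕ} (hp : p ∈ F) (hq : q ∈ F) (e : p.2 = q.2) :
    p = q := List.inj_on_of_nodup_map h.snd_nodup hp hq e

theorem mixes (h : F.Proper) (hG : Mixes F G) (hg : ∀ p ∈ G, p.1.Grows p.2) : G.Proper where
  levels := (hG.snd.append (hG.fst.flatMap_right _)).nodup_iff.1 h.levels
  numbers := (hG.fst.flatMap_right _).symm.trans h.numbers
  grows := hg

theorem perm (h : F.Proper) (hG : F.Perm G) : G.Proper :=
  h.mixes (.of_perm hG) fun p hp => h.grows p (hG.symm.subset hp)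

/-- A tree at the lowest of all tags can be split at its root. -/
theorem split {x y m : ℕ} {A B : LTree n} {o : Forest n} (h : Proper ((.node x A y B, m) :: o)) :
    Proper ((A, x) :: (B, y) :: o) where
  levels := by
    refine (List.nodup_cons (a := m).1 ((List.Perm.nodup_iff ?_).1 h.levels)).2
    rw [List.perm_iff_count]
    intro a
    simp [LTree.levels, List.count_cons, List.count_append]
    omega
  numbers := by simpa [LTree.numbers] using h.numbers
  grows p hp := by
    have := h.grows _ List.mem_cons_self
    rcases List.mem_cons.1 hp with rfl | hp
    · exact this.2.2.1
    · rcases List.mem_cons.1 hp with rfl | hp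
      · exact this.2.2.2
      · exact h.grows p (List.mem_cons_of_mem _ hp)

end Proper

theorem size_cons (T : LTree n) (k : ℕ) (o : Forest n) :
    size ((T, k) :: o) = T.size + size o := rfl

theorem size_split (x y m : ℕ) (A B : LTree n) (o : Forest n) :
    size ((.node x A y B, m) :: o) = size ((A, x) :: (B, y) :: o) + 1 := by
  simp only [size_cons, LTree.size]; omega

theorem exists_of_size {F : Forest n} (h : F.size ≠ 0) : ∃ p ∈ F, p.1.size ≠ 0 := by
  by_contra! h'
  refine h (List.sum_eq_zero fun k hk => ?_)
  simp only [List.map_map, List.mem_map] at hk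
  obtain ⟨p, hp, rfl⟩ := hk
  exact h' p hp

theorem size_eq_zero {F : Forest n} (h : F.size = 0) {p} (hp : p ∈ F) : p.1.size = 0 := by
  have := (List.sum_eq_zero_iff (l := (F.map Prod.fst).map LTree.size)).1 h
  exact this _ (List.mem_map_of_mem (List.mem_map_of_mem hp))

/-- The trees with tags above `d` are the same. -/
def SameAbove {X : Type*} (d : ℕ) (F G : List (X × ℕ)) : Prop := ∀ p, d < p.2 → (p ∈ F ↔ p ∈ G)

/-- The trees at tags up to `d` could be placed at the tag `d`. -/
def Low (d : ℕ) (F : Forest n) : Prop := ∀ p ∈ F, p.2 ≤ d → p.1.Grows d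

theorem SameAbove.symm {X : Type*} {d : ℕ} {F G : List (X × ℕ)} (h : SameAbove d F G) :
    SameAbove d G F := fun p hp => (h p hp).symm

theorem SameAbove.mono {X : Type*} {d d' : ℕ} {F G : List (X × ℕ)} (h : SameAbove d F G)
    (hd : d ≤ d') : SameAbove d' F G := fun p hp => h p (hd.trans_lt hp)

theorem Mixes.le_of_sameAbove {d : ℕ} {F G : Forest n} (hF : F.Proper) (hm : Mixes F G)
    (hs : SameAbove d F G) {T : LTree n} {i j : ℕ} (hi : (T, i) ∈ G) (hj : (T, j) ∈ F)
    (hd : i ≤ d) : j ≤ d := by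
  by_contra! hl
  have : ((T, i) : LTree n × ℕ) = (T, j) :=
    List.inj_on_of_nodup_map (hm.fst.nodup_iff.1 hF.fst_nodup) hi ((hs _ hl).1 hj) rfl
  simp only [Prod.mk.injEq, true_and] at this
  omega

theorem Low.mixes {d : ℕ} {F G : Forest n} (h : Low d F) (hF : F.Proper) (hm : Mixes F G)
    (hs : SameAbove d F G) : Low d G := fun p hp hd => by
  obtain ⟨k, hk⟩ := hm.symm.exists_fst hp
  exact h (p.1, k) hk (Mixes.le_of_sameAbove (T := p.1) (i := p.2) hF hm hs hp hk hd)

theorem Proper.mixes_low {d : ℕ} {F G : Forest n} (hF : F.Proper) (h : Low d F) (hm : Mixes F G)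
    (hs : SameAbove d F G) : G.Proper := hF.mixes hm fun p hp => by
  by_cases hd : p.2 ≤ d
  · exact (h.mixes hF hm hs p hp hd).mono hd
  · exact hF.grows p ((hs p (by omega)).2 hp)

theorem exists_min {X : Type*} {l : List (X × ℕ)} (hl : l ≠ []) :
    ∃ p ∈ l, ∀ q ∈ l, p.2 ≤ q.2 :=
  Set.exists_min_image {p | p ∈ l} Prod.snd l.finite_toSet (List.exists_mem_of_ne_nil l hl)

theorem exists_perm_cons {X : Type*} {l : List X} {a : X} (h : a ∈ l) :
    ∃ l', l.Perm (a :: l') := by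
  obtain ⟨s, t, rfl⟩ := List.append_of_mem h
  exact ⟨s ++ t, List.perm_middle⟩

/-- The lowest tag can be given to any letter. -/
theorem exists_lowest {X : Type*} {l : List (X × ℕ)} (hl : (l.map Prod.snd).Nodup) {Y : X} {t : ℕ}
    (h : (Y, t) ∈ l) : ∃ m o, m ≤ t ∧ Mixes l ((Y, m) :: o) ∧ (∀ p ∈ o, m < p.2) ∧
      SameAbove t l ((Y, m) :: o) := by
  obtain ⟨⟨I, m⟩, hI, hmin⟩ := exists_min (List.ne_nil_of_mem h)
  have hm : m ≤ t := hmin _ h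
  obtain ⟨l₁, h₁⟩ := exists_perm_cons hI
  have hlt : ∀ q ∈ l₁, m < q.2 := fun q hq => by
    refine lt_of_le_of_ne (hmin q (h₁.symm.subset (List.mem_cons_of_mem _ hq))) fun e => ?_
    exact (List.nodup_cons.1 ((h₁.map Prod.snd).nodup_iff.1 hl)).1
      (List.mem_map.2 ⟨q, hq, e.symm⟩)
  rcases List.mem_cons.1 (h₁.subset h) with e | h
  · obtain ⟨rfl, rfl⟩ := Prod.mk.inj e
    exact ⟨_, l₁, hm, .of_perm h₁, hlt, fun p _ => h₁.mem_iff⟩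
  · obtain ⟨l₂, h₂⟩ := exists_perm_cons h
    have h₁₂ := h₁.trans (h₂.cons _)
    refine ⟨m, (I, t) :: l₂, hm, (Mixes.of_perm h₁₂).trans ⟨.swap _ _ _, .refl _⟩, fun p hp => ?_,
      fun p hp => ?_⟩
    · rcases List.mem_cons.1 hp with rfl | hp
      · exact hlt (Y, t) h
      · exact hlt p (h₂.symm.subset (List.mem_cons_of_mem _ hp))
    · have e : ∀ q : X × ℕ, q.2 ≤ t → p ≠ q := fun q hq e => by subst e; omega
      simp only [h₁₂.mem_iff, List.mem_cons, e (I, m) hm, e (Y, t) le_rfl, e (Y, m) hm,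
        e (I, t) le_rfl, false_or]

/-- Each tree of `F` that is not in `G` with the same tag has a tag up to `d` and could be placed
at the tag `d`. -/
def MovedBelow (d : ℕ) (F G : Forest n) : Prop := ∀ p ∈ F, p ∉ G → p.2 ≤ d ∧ p.1.Grows d

theorem MovedBelow.of_perm {d : ℕ} {F G : Forest n} (h : F.Perm G) : MovedBelow d F G :=
  fun _ hp hn => absurd (h.subset hp) hn

/-- In two forests with the same trees and tags, the same tree can be split, up to a level `e` that
allows the induction to go on. -/
theorem exists_common {d : ℕ} {F G : Forest n} (hF : F.Proper) (hG : G.Proper) (hm : Mixes F G)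
    (h : MovedBelow d F G) (h' : MovedBelow d G F) (hs : F.size ≠ 0) :
    ∃ T t t' e, (T, t) ∈ F ∧ (T, t') ∈ G ∧ T.size ≠ 0 ∧ t ≤ e ∧ t' ≤ e ∧ T.Grows e ∧
      (∀ p ∈ F, p.2 ≤ e → p.1 ≠ T → p.1.Grows (max d e)) ∧
      ∀ p ∈ G, p.2 ≤ e → p.1 ≠ T → p.1.Grows (max d e) := by
  by_cases hc : (∃ q ∈ F, q ∉ G ∧ q.1.size ≠ 0) ∧ ∀ p ∈ F, p ∈ G → p.1.size ≠ 0 → d < p.2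
  · -- all internal nodes up to the level `d` have moved
    obtain ⟨⟨q, hq, hq', hqs⟩, hc⟩ := hc
    obtain ⟨k, hk⟩ := hm.exists_fst hq
    have hk' : (q.1, k) ∉ F := fun hf => hq' (hF.eq_of_fst hq hf rfl ▸ hk)
    have key : ∀ {F G : Forest n}, MovedBelow d F G →
        (∀ p ∈ F, p ∈ G → p.1.size ≠ 0 → d < p.2) →
        ∀ p ∈ F, p.2 ≤ d → p.1 ≠ q.1 → p.1.Grows (max d d) := by
      intro F G h hc p hp hd _
      rw [max_self]
      by_cases hpG : p ∈ G
      · exact LTree.grows_of_size (by_contra fun hs => absurd (hc p hp hpG hs) (by omega)) _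
      · exact (h p hp hpG).2
    exact ⟨q.1, q.2, k, d, hq, hk, hqs, (h q hq hq').1, (h' _ hk hk').1, (h q hq hq').2,
      key h hc, key h' fun p hp hp' => hc p hp' hp⟩
  · -- the lowest of the internal nodes that have not moved
    have hU : ∃ p ∈ F, p ∈ G ∧ p.1.size ≠ 0 := by
      by_contra! hU
      obtain ⟨p, hp, hps⟩ := exists_of_size hs
      exact hc ⟨⟨p, hp, fun hp' => hps (hU p hp hp'), hps⟩, fun p hp hp' hps =>
        absurd (hU p hp hp') hps⟩
    obtain ⟨⟨T, t⟩, ⟨hT, hT', hTs⟩, hmin⟩ := Set.exists_min_image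
      {p | p ∈ F ∧ p ∈ G ∧ p.1.size ≠ 0} Prod.snd (F.finite_toSet.subset fun p hp => hp.1) hU
    have hd : d < t → ∀ p ∈ F, p ∉ G → p.1.size = 0 := by
      intro hd p hp hp'
      by_contra hps
      exact hc ⟨⟨p, hp, hp', hps⟩, fun q hq hq' hqs => hd.trans_le (hmin q ⟨hq, hq', hqs⟩)⟩
    have hd' : d < t → ∀ p ∈ G, p ∉ F → p.1.size = 0 := by
      intro hdt p hp hp'
      obtain ⟨k, hk⟩ := hm.symm.exists_fst hp
      exact hd hdt (p.1, k) hk fun hk' => hp' (hG.eq_of_fst (q := (p.1, k)) hp hk' rfl ▸ hk)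
    have key : ∀ {F G : Forest n}, F.Proper → MovedBelow d F G → (T, t) ∈ F →
        (∀ p ∈ F, p ∈ G → p.1.size ≠ 0 → t ≤ p.2) → (d < t → ∀ p ∈ F, p ∉ G → p.1.size = 0) →
        ∀ p ∈ F, p.2 ≤ t → p.1 ≠ T → p.1.Grows (max d t) := by
      intro F G hF h hT hmin hd p hp hpt hpT
      by_cases hpG : p ∈ G
      · refine LTree.grows_of_size (by_contra fun hs => ?_) _
        exact hpT (congrArg Prod.fst (hF.eq_of_snd hp hT (le_antisymm hpt (hmin p hp hpG hs))))
      · rcases lt_or_ge d t with hdt | hdt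
        · exact LTree.grows_of_size (hd hdt p hp hpG) _
        · rw [max_eq_left hdt]; exact (h p hp hpG).2
    exact ⟨T, t, t, t, hT, hT', hTs, le_rfl, le_rfl, hF.grows _ hT,
      key hF h hT (fun p hp hp' hs => hmin p ⟨hp, hp', hs⟩) hd,
      key hG h' hT' (fun p hp hp' hs => hmin p ⟨hp', hp, hs⟩) hd'⟩

/-- Some tree of a forest with internal nodes can be split: the one at the lowest level. -/
theorem exists_low {F : Forest n} (hF : F.Proper) (hs : F.size ≠ 0) :
    ∃ T t, (T, t) ∈ F ∧ T.size ≠ 0 ∧ Low t F := by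
  obtain ⟨⟨T, t⟩, ⟨hT, hTs⟩, hmin⟩ := Set.exists_min_image {p | p ∈ F ∧ p.1.size ≠ 0} Prod.snd
    (F.finite_toSet.subset fun p hp => hp.1) (exists_of_size hs)
  refine ⟨T, t, hT, hTs, fun p hp hd => ?_⟩
  by_cases hps : p.1.size = 0
  · exact LTree.grows_of_size hps _
  · have := hF.eq_of_snd hp hT (le_antisymm hd (hmin p ⟨hp, hps⟩))
    subst this
    exact hF.grows _ hT

end Forest

/-! ### Reductions of forests -/

namespace QTensor

open TaggedFamily Forest

variable {C : Type u} [Category.{v} C] {S : QTensor C} {c : S.Commutativity}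

namespace Commutativity.Compatible

variable (h : c.Compatible) {n : ℕ} (w : Fin n → C)

/-- The tagged family of the trees: a tree stands for its bracketing of the objects `w`. -/
abbrev trees : TaggedFamily (Pre C) (LTree n) := h.family fun T : LTree n => (S.canObj T).obj w

/-- The product of the objects of the trees, bracketed to the left. -/
abbrev value (F : Forest n) : Pre C := (tagged (h.trees w) F).obj .empty

/-- The product of the objects `w` in their order, bracketed to the left. -/
abbrev normal : Pre C := (word (h.trees w).act ((List.finRange n).map .leaf)).obj .empty

/-- One step of a reduction. The trees at tags up to `d` can be placed at the tag `d`, and `φ` moves one of them to the front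
and gives it the lowest tag without a change of the trees at tags above `d`; this tree is split. -/
structure Step (d : ℕ) (F : Forest n) (x : ℕ) (A : LTree n) (y : ℕ) (B : LTree n) (m : ℕ)
    (o : Forest n) (φ : h.value w F ⟶ h.value w ((A, x) :: (B, y) :: o)) : Prop where
  low : Low d F
  moves : ∃ f, (h.trees w).Moves F ((.node x A y B, m) :: o) f ∧ φ = f.app .empty
  same : SameAbove d F ((.node x A y B, m) :: o)
  min : ∀ p ∈ o, m < p.2
  le : m ≤ d

/-- The reductions of a forest: trees are split until there are only leaves, which are sorted by
their numbers. The tags are permuted along the way; `Step` restricts how. -/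
inductive Red : (F : Forest n) → (h.value w F ⟶ h.normal w) → Prop
  | sort {F G f} (hf : (h.trees w).Moves F G f) (hG : G.map Prod.fst = (List.finRange n).map .leaf)
      (hs : (G.map Prod.snd).Pairwise (· < ·)) :
      Red F (f.app .empty ≫ eqToHom (congrArg (fun l => (word (h.trees w).act l).obj .empty) hG))
  | step {d F x A y B m o φ g} (hφ : h.Step w d F x A y B m o φ)
      (hg : Red ((A, x) :: (B, y) :: o) g) : Red F (φ ≫ g)

variable {h w}

theorem _root_.TaggedFamily.Moves.mixes {E : Type*} [Category E] {X : Type*} {T : TaggedFamily E X}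
    {F G f} (hf : T.Moves F G f) : Mixes F G := ⟨hf.perm_fst, hf.perm_snd⟩

theorem moves_unique {F G : Forest n} (hF : F.Proper) {f g} (hf : (h.trees w).Moves F G f)
    (hg : (h.trees w).Moves F G g) : f = g :=
  hf.unique hg (hf.perm_fst.nodup_iff.1 hF.fst_nodup) (hf.perm_snd.nodup_iff.1 hF.snd_nodup)

namespace Step

variable {d : ℕ} {F : Forest n} {x : ℕ} {A : LTree n} {y : ℕ} {B : LTree n} {m : ℕ}
    {o : Forest n} {φ : h.value w F ⟶ h.value w ((A, x) :: (B, y) :: o)}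

theorem mixes (hφ : h.Step w d F x A y B m o φ) : Mixes F ((.node x A y B, m) :: o) :=
  hφ.moves.choose_spec.1.mixes

theorem proper_target (hφ : h.Step w d F x A y B m o φ) (hF : F.Proper) : Proper ((.node x A y B, m) :: o) :=
  hF.mixes_low hφ.low hφ.mixes hφ.same

theorem low_target (hφ : h.Step w d F x A y B m o φ) (hF : F.Proper) :
    Low d ((.node x A y B, m) :: o) := hφ.low.mixes hF hφ.mixes hφ.same

theorem proper (hφ : h.Step w d F x A y B m o φ) (hF : F.Proper) : Proper ((A, x) :: (B, y) :: o) :=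
  (hφ.proper_target hF).split

theorem size (hφ : h.Step w d F x A y B m o φ) : F.size = Forest.size ((A, x) :: (B, y) :: o) + 1 :=
  hφ.mixes.size.trans (size_split ..)

theorem isIso (hφ : h.Step w d F x A y B m o φ) : IsIso φ := by
  obtain ⟨f, hf, rfl⟩ := hφ.moves
  have := hf.isIso
  exact inferInstanceAs (IsIso (f.app .empty))

end Step

theorem Red.isIso {F : Forest n} {g} (hg : h.Red w F g) : IsIso g := by
  induction hg with
  | sort hf => have := hf.isIso; infer_instance
  | step hφ _ ih => have := hφ.isIso; infer_instance

variable (h w) in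
theorem exists_step {d : ℕ} {F : Forest n} (hF : F.Proper) (hd : Low d F) {x A y B t}
    (ht : (.node x A y B, t) ∈ F) (hl : t ≤ d) : ∃ m o φ, h.Step w d F x A y B m o φ := by
  obtain ⟨m, o, hm, hmix, hmin, hs⟩ := exists_lowest hF.snd_nodup ht
  obtain ⟨f, hf⟩ := Moves.exists (T := h.trees w) hmix.fst hmix.snd
  exact ⟨m, o, f.app .empty, hd, ⟨f, hf, rfl⟩, hs.mono hl, hmin, hm.trans hl⟩

/-- The tags of a forest of leaves can be sorted by the numbers of the leaves. -/
theorem exists_sorted {F : Forest n} (hF : F.Proper) (hs : F.size = 0) : ∃ G, Mixes F G ∧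
    G.map Prod.fst = (List.finRange n).map .leaf ∧ (G.map Prod.snd).Pairwise (· < ·) := by
  have e : ∀ l : List (LTree n), (∀ T ∈ l, T.size = 0) →
      l = (l.flatMap LTree.numbers).map .leaf := by
    intro l hl
    induction l with
    | nil => rfl
    | cons T l ih =>
      obtain ⟨i, rfl⟩ := LTree.eq_leaf (hl T List.mem_cons_self)
      simp [LTree.numbers, ← ih fun T hT => hl T (List.mem_cons_of_mem _ hT)]
  have hp : (F.map Prod.fst).Perm ((List.finRange n).map .leaf) := by
    rw [e (F.map Prod.fst) fun T hT => ?_]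
    · exact hF.numbers.map _
    · obtain ⟨p, hp, rfl⟩ := List.mem_map.1 hT
      exact size_eq_zero hs hp
  have hlen : (F.map Prod.snd).length = ((List.finRange n).map (LTree.leaf (n := n))).length := by
    rw [← hp.length_eq, List.length_map, List.length_map]
  have hm := List.mergeSort_perm (F.map Prod.snd) (· ≤ ·)
  refine ⟨((List.finRange n).map .leaf).zip ((F.map Prod.snd).mergeSort (· ≤ ·)), ⟨?_, ?_⟩, ?_, ?_⟩
  · rwa [List.map_fst_zip (by rw [hm.length_eq, hlen])]
  · rw [List.map_snd_zip (by rw [hm.length_eq, hlen])]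
    exact hm.symm
  · rw [List.map_fst_zip (by rw [hm.length_eq, hlen])]
  · rw [List.map_snd_zip (by rw [hm.length_eq, hlen])]
    have h₁ := List.pairwise_mergeSort' (· ≤ ·) (F.map Prod.snd)
    exact h₁.imp₂ (fun _ _ a b => lt_of_le_of_ne a b) (hm.symm.nodup_iff.1 hF.snd_nodup)

variable (h w) in
/-- Every forest has a reduction: the lowest internal node can always be split. -/
theorem exists_red {F : Forest n} (hF : F.Proper) : ∃ g, h.Red w F g := by
  induction hk : F.size generalizing F with
  | zero =>
    obtain ⟨G, hG, e, hs⟩ := exists_sorted hF hk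
    obtain ⟨f, hf⟩ := Moves.exists (T := h.trees w) hG.fst hG.snd
    exact ⟨_, .sort hf e hs⟩
  | succ k ih =>
    obtain ⟨T, t, hT, hTs, hl⟩ := exists_low hF (by omega)
    obtain ⟨x, A, y, B, rfl⟩ := LTree.exists_node hTs
    obtain ⟨m, o, φ, hφ⟩ := exists_step h w hF hl hT le_rfl
    obtain ⟨g, hg⟩ := ih (hφ.proper hF) (by have := hφ.size; omega)
    exact ⟨_, .step hφ hg⟩

theorem Red.exists_step {F : Forest n} {g} (hg : h.Red w F g) (hs : F.size ≠ 0) :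
    ∃ d x A y B m o φ k, h.Step w d F x A y B m o φ ∧ h.Red w ((A, x) :: (B, y) :: o) k ∧
      g = φ ≫ k := by
  cases hg with
  | sort hf hG =>
    exfalso
    apply hs
    rw [hf.mixes.size, Forest.size, hG]
    exact List.sum_eq_zero fun k hk => by
      obtain ⟨T, hT, rfl⟩ := List.mem_map.1 hk
      obtain ⟨i, -, rfl⟩ := List.mem_map.1 hT
      rfl
  | step hφ hg => exact ⟨_, _, _, _, _, _, _, _, _, hφ, hg, rfl⟩

/-- Forests of leaves: reductions are composites of interchanges, which are determined by their
source and target. -/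
theorem Red.of_size {F F' : Forest n} (hF : F.Proper) {f} (hf : (h.trees w).Moves F F' f) {g g'}
    (hg : h.Red w F g) (hg' : h.Red w F' g') (hs : F.size = 0) : g = f.app .empty ≫ g' := by
  cases hg with
  | step hφ => have := hφ.size; omega
  | @sort _ G f₁ hf₁ hG hGs =>
    cases hg' with
    | step hφ => have := hφ.size; have := hf.mixes.size; omega
    | @sort _ G' f₂ hf₂ hG' hGs' =>
      have e : G = G' := by
        have e₁ : G.map Prod.fst = G'.map Prod.fst := hG.trans hG'.symm
        have e₂ : G.map Prod.snd = G'.map Prod.snd :=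
          ((hf₁.mixes.symm.trans hf.mixes).trans hf₂.mixes).snd.eq_of_pairwise
            (fun _ _ _ _ a b => absurd a (lt_asymm b)) hGs hGs'
        exact (List.zip_of_prod e₁ e₂).trans (List.zip_of_prod rfl rfl).symm
      subst e
      rw [moves_unique hF hf₁ (hf.trans hf₂), NatTrans.comp_app, Category.assoc]

end Commutativity.Compatible

end QTensor

/-! ### Uniqueness of reductions -/

namespace Forest

theorem MovedBelow.cons {n : ℕ} {d : ℕ} {F G : Forest n} (h : MovedBelow d F G)
    (p : LTree n × ℕ) : MovedBelow d (p :: F) (p :: G) := by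
  intro q hq hq'
  simp only [List.mem_cons, not_or] at hq hq'
  exact h q (hq.resolve_left hq'.1) hq'.2

theorem MovedBelow.of_low {n : ℕ} {d : ℕ} {F G : Forest n} {p q : LTree n × ℕ}
    (h : Low d (p :: F)) (hs : SameAbove d (p :: F) (q :: G)) (hq : q.2 ≤ d) :
    MovedBelow d F G := by
  intro r hr hr'
  have hr := List.mem_cons_of_mem p hr
  by_cases hd : r.2 ≤ d
  · exact ⟨hd, h r hr hd⟩
  · rcases List.mem_cons.1 ((hs r (by omega)).1 hr) with rfl | hr
    · exact absurd hq hd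
    · exact absurd hr hr'

theorem SameAbove.trans {X : Type*} {d : ℕ} {F G H : List (X × ℕ)} (h : SameAbove d F G)
    (h' : SameAbove d G H) : SameAbove d F H := fun p hp => (h p hp).trans (h' p hp)

theorem SameAbove.of_perm {X : Type*} {d : ℕ} {F G : List (X × ℕ)} (h : F.Perm G) :
    SameAbove d F G := fun _ _ => h.mem_iff

theorem SameAbove.cons {X : Type*} {d : ℕ} {F G : List (X × ℕ)} (h : SameAbove d F G)
    (p : X × ℕ) : SameAbove d (p :: F) (p :: G) := fun q hq => by
  simp only [List.mem_cons, h q hq]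

theorem Proper.of_moved {n : ℕ} {d : ℕ} {F G : Forest n} (hF : F.Proper) (hm : Mixes F G)
    (h : MovedBelow d G F) : G.Proper :=
  hF.mixes hm fun p hp => by
    by_cases hp' : p ∈ F
    · exact hF.grows p hp'
    · exact (h p hp hp').2.mono (h p hp hp').1

/-- The tag in front is the lowest of all tags, which a mixing preserves. -/
theorem lowest_unique {X : Type*} {F G : List (X × ℕ)} {p q : X × ℕ}
    (h : Mixes (p :: F) (q :: G)) (hp : ∀ r ∈ F, p.2 < r.2) (hq : ∀ r ∈ G, q.2 < r.2) :
    p.2 = q.2 := by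
  have key : ∀ {F G : List (X × ℕ)} {p q : X × ℕ}, Mixes (p :: F) (q :: G) →
      (∀ r ∈ F, p.2 < r.2) → p.2 ≤ q.2 := by
    intro F G p q h hp
    have := h.snd.symm.subset (List.mem_cons_self (a := q.2))
    rcases List.mem_cons.1 this with e | e
    · exact e.ge
    · obtain ⟨r, hr, e⟩ := List.mem_map.1 e
      exact e ▸ (hp r hr).le
  exact le_antisymm (key h hp) (key h.symm hq)

end Forest

namespace QTensor

open TaggedFamily Forest

variable {C : Type u} [Category.{v} C] {S : QTensor C} {c : S.Commutativity}

namespace Commutativity.Compatible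

variable {h : c.Compatible} {n : ℕ} {w : Fin n → C}

variable (h w) in
/-- Reductions of forests with fewer than `k` internal nodes agree along interchanges of low
trees. -/
def Agree (k : ℕ) : Prop := ∀ {F F' : Forest n} {d : ℕ} {f g g'}, F.size < k → F.Proper →
  (h.trees w).Moves F F' f → MovedBelow d F F' → MovedBelow d F' F → h.Red w F g →
  h.Red w F' g' → g = f.app .empty ≫ g'

theorem Agree.perm {k : ℕ} (ih : h.Agree w k) {F F' : Forest n} {f g g'} (hs : F.size < k)
    (hF : F.Proper) (hf : (h.trees w).Moves F F' f) (hp : F.Perm F') (hg : h.Red w F g)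
    (hg' : h.Red w F' g') : g = f.app .empty ≫ g' :=
  ih (d := 0) hs hF hf (.of_perm hp) (.of_perm hp.symm) hg hg'

section

variable {d₁ d₂ : ℕ} {F : Forest n} {x : ℕ} {A : LTree n} {y : ℕ} {B : LTree n} {m₁ m₂ : ℕ}
  {o₁ o₂ : Forest n} {φ₁ : h.value w F ⟶ h.value w ((A, x) :: (B, y) :: o₁)}

/-- Two ways to split the same tree lead to the same reductions. -/
theorem Step.comp_eq {φ₂ : h.value w F ⟶ h.value w ((A, x) :: (B, y) :: o₂)}
    (ih : h.Agree w F.size) (hF : F.Proper)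
    (hφ₁ : h.Step w d₁ F x A y B m₁ o₁ φ₁) (hφ₂ : h.Step w d₂ F x A y B m₂ o₂ φ₂) (hd : d₁ ≤ d₂)
    {g₁ g₂} (hg₁ : h.Red w ((A, x) :: (B, y) :: o₁) g₁)
    (hg₂ : h.Red w ((A, x) :: (B, y) :: o₂) g₂) : φ₁ ≫ g₁ = φ₂ ≫ g₂ := by
  have hm := hφ₁.mixes.symm.trans hφ₂.mixes
  obtain rfl : m₁ = m₂ := lowest_unique hm hφ₁.min hφ₂.min
  obtain ⟨k, hk⟩ := Moves.exists (T := h.trees w) hm.cons_inv.fst hm.cons_inv.snd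
  obtain ⟨f₁, hf₁, rfl⟩ := hφ₁.moves
  obtain ⟨f₂, hf₂, rfl⟩ := hφ₂.moves
  have e := moves_unique hF (hf₁.trans (hk.cons (.node x A y B, m₁))) hf₂
  have hs := (hφ₁.same.mono hd).symm.trans hφ₂.same
  have hl := hφ₂.low.mixes hF hφ₁.mixes (hφ₁.same.mono hd)
  have e' := ih (by have := hφ₁.size; omega) (hφ₁.proper hF) ((hk.cons (B, y)).cons (A, x))
    (((MovedBelow.of_low hl hs hφ₂.le).cons _).cons _)
    (((MovedBelow.of_low (hφ₂.low_target hF) hs.symm (hφ₁.le.trans hd)).cons _).cons _) hg₁ hg₂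
  rw [e', ← e]
  exact (Category.assoc _ _ _).symm

end

theorem paste_split {E : Type*} [Category E] {F G₁ G₂ H₁ H₂ K₁ K N : E} {a₁ : F ⟶ G₁} {b₁ : G₁ ⟶ H₁}
    {p : H₁ ⟶ K₁} {r : K₁ ⟶ K} {k : K ⟶ N} {a₂ : F ⟶ G₂} {b₂ : G₂ ⟶ H₂} {p' : H₂ ⟶ K} {e : H₁ ⟶ H₂}
    (h₁ : (a₁ ≫ b₁) ≫ e = a₂ ≫ b₂) (h₂ : p ≫ r = e ≫ p') :
    a₁ ≫ b₁ ≫ p ≫ r ≫ k = a₂ ≫ b₂ ≫ p' ≫ k := by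
  rw [Category.assoc] at h₁
  rw [reassoc_of% h₂, reassoc_of% h₁]

/-- After the split of the first tree, the tree `Z` at the lowest remaining tag can be carried to
the front and split. -/
theorem Agree.split_next {d : ℕ} {x : ℕ} {A : LTree n} {y : ℕ} {B : LTree n} {m : ℕ}
    {o₁ : Forest n} {x' : ℕ} {A' : LTree n} {y' : ℕ} {B' : LTree n} {m' : ℕ} {o : Forest n}
    (ih : h.Agree w (Forest.size ((.node x A y B, m) :: o₁))) (hG : Proper ((.node x A y B, m) :: o₁))
    (hl : Low d ((.node x A y B, m) :: o₁)) (hm : m ≤ d) {k}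
    (hk : (h.trees w).Moves o₁ ((.node x' A' y' B', m') :: o) k) (hm' : m' ≤ d)
    (hs : SameAbove d o₁ ((.node x' A' y' B', m') :: o)) (hmin : ∀ p ∈ o, m' < p.2) {g g'}
    (hg : h.Red w ((A, x) :: (B, y) :: o₁) g)
    (hg' : h.Red w ((A', x') :: (B', y') :: (A, x) :: (B, y) :: o) g')
    {κ : h.value w ((A, x) :: (B, y) :: o₁) ⟶
      h.value w ((A, x) :: (B, y) :: (.node x' A' y' B', m') :: o)}
    {ψ : h.value w ((A, x) :: (B, y) :: (.node x' A' y' B', m') :: o) ⟶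
      h.value w ((A', x') :: (B', y') :: (A, x) :: (B, y) :: o)}
    (hκ : κ = (under A (under B k)).app .empty)
    (hψ : ψ = (under A (front ((h.trees w).car B (.node x' A' y' B')) (o.map Prod.fst)) ≫
      front ((h.trees w).car A (.node x' A' y' B')) (B :: o.map Prod.fst)).app .empty) :
    g = κ ≫ ψ ≫ g' := by
  have hsY := hs.cons (.node x A y B, m)
  have hmix := hk.mixes.cons (.node x A y B, m)
  have hG' := hG.mixes_low hl hmix hsY
  have hl' := hl.mixes hG hmix hsY
  have hY : (LTree.node x A y B).Grows d := hl _ List.mem_cons_self hm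
  have hstep : h.Step w d ((A, x) :: (B, y) :: (.node x' A' y' B', m') :: o) x' A' y' B' m'
      ((A, x) :: (B, y) :: o) ψ := by
    refine ⟨fun p hp hd => ?_, ⟨_, ((Moves.swap (B, y) (.node x' A' y' B', m') o).cons
      (A, x)).trans (Moves.swap (A, x) (.node x' A' y' B', m') ((B, y) :: o)), hψ⟩,
      .of_perm (((List.Perm.swap _ _ _).cons _).trans (.swap _ _ _)), fun p hp => ?_, hm'⟩
    · rcases List.mem_cons.1 hp with rfl | hp
      · exact absurd hd (not_le_of_gt hY.1)
      · rcases List.mem_cons.1 hp with rfl | hp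
        · exact absurd hd (not_le_of_gt hY.2.1)
        · exact hl' p (List.mem_cons_of_mem _ hp) hd
    · rcases List.mem_cons.1 hp with rfl | hp
      · exact hm'.trans_lt hY.1
      · rcases List.mem_cons.1 hp with rfl | hp
        · exact hm'.trans_lt hY.2.1
        · exact hmin p hp
  have := ih (by rw [size_split]; omega) hG.split ((hk.cons (B, y)).cons (A, x))
    (((MovedBelow.of_low hl hsY hm).cons _).cons _)
    (((MovedBelow.of_low hl' hsY.symm hm).cons _).cons _) hg (.step hstep hg')
  rw [this, hκ]

/-- Two ways to split different trees lead to the same reductions. -/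
theorem Step.comp_eq_of_ne {d₁ d₂ : ℕ} {F : Forest n} {x₁ : ℕ} {A₁ : LTree n} {y₁ : ℕ}
    {B₁ : LTree n} {m₁ : ℕ} {o₁ : Forest n} {x₂ : ℕ} {A₂ : LTree n} {y₂ : ℕ} {B₂ : LTree n} {m₂ : ℕ}
    {o₂ : Forest n} {φ₁ : h.value w F ⟶ h.value w ((A₁, x₁) :: (B₁, y₁) :: o₁)}
    {φ₂ : h.value w F ⟶ h.value w ((A₂, x₂) :: (B₂, y₂) :: o₂)}
    (ih : h.Agree w F.size) (hF : F.Proper) (hφ₁ : h.Step w d₁ F x₁ A₁ y₁ B₁ m₁ o₁ φ₁)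
    (hφ₂ : h.Step w d₂ F x₂ A₂ y₂ B₂ m₂ o₂ φ₂) (hd : d₁ ≤ d₂)
    (hne : LTree.node x₁ A₁ y₁ B₁ ≠ .node x₂ A₂ y₂ B₂)
    {g₁ g₂} (hg₁ : h.Red w ((A₁, x₁) :: (B₁, y₁) :: o₁) g₁)
    (hg₂ : h.Red w ((A₂, x₂) :: (B₂, y₂) :: o₂) g₂) : φ₁ ≫ g₁ = φ₂ ≫ g₂ := by
  have hm := hφ₁.mixes.symm.trans hφ₂.mixes
  obtain rfl : m₁ = m₂ := lowest_unique hm hφ₁.min hφ₂.min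
  have hs₁ := hφ₁.same.mono hd
  have hG₁ := hφ₁.proper_target hF
  have hG₂ := hφ₂.proper_target hF
  have hl₁ := hφ₂.low.mixes hF hφ₁.mixes hs₁
  have hl₂ := hφ₂.low_target hF
  obtain ⟨t, ht⟩ := hm.symm.exists_fst (p := (.node x₂ A₂ y₂ B₂, m₁)) List.mem_cons_self
  have htd := hm.le_of_sameAbove hG₁ (hs₁.symm.trans hφ₂.same) List.mem_cons_self ht hφ₂.le
  have ht' := (List.mem_cons.1 ht).resolve_left fun e => hne (congrArg Prod.fst e).symm
  obtain ⟨m, o, hmt, hmix, hmin, hs⟩ := exists_lowest (List.nodup_cons.1 hG₁.snd_nodup).2 ht'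
  have hmd : m ≤ d₂ := hmt.trans htd
  have hmix₂ : Mixes o₂ ((.node x₁ A₁ y₁ B₁, m) :: o) :=
    Mixes.cons_inv (p := (.node x₂ A₂ y₂ B₂, m₁)) <|
      (hm.symm.trans (hmix.cons _)).trans ⟨.swap _ _ _, .refl _⟩
  have hs₂ : SameAbove d₂ o₂ ((.node x₁ A₁ y₁ B₁, m) :: o) := fun p hp => by
    have e : ∀ q : LTree n × ℕ, q.2 ≤ d₂ → p ≠ q := fun q hq e => by subst e; omega
    have a := (hs.mono htd) p hp
    have b := (hs₁.symm.trans hφ₂.same) p hp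
    simp only [List.mem_cons, e _ (show (_, m).2 ≤ d₂ from hmd),
      e _ (show (_, m₁).2 ≤ d₂ from hφ₂.le), false_or] at a b ⊢
    rw [← a, b]
  obtain ⟨k₁, hk₁⟩ := Moves.exists (T := h.trees w) hmix.fst hmix.snd
  obtain ⟨k₂, hk₂⟩ := Moves.exists (T := h.trees w) hmix₂.fst hmix₂.snd
  have hokH : Proper ((.node x₁ A₁ y₁ B₁, m₁) :: (.node x₂ A₂ y₂ B₂, m) :: o) :=
    hG₁.mixes_low hl₁ (hmix.cons _) ((hs.mono htd).cons _)
  have hok : Proper ((A₂, x₂) :: (B₂, y₂) :: (A₁, x₁) :: (B₁, y₁) :: o) := by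
    refine Proper.split (m := m) (hokH.split.perm ?_)
    exact ((List.Perm.swap _ _ _).cons _).trans (.swap _ _ _)
  have hperm : ((A₂, x₂) :: (B₂, y₂) :: (A₁, x₁) :: (B₁, y₁) :: o).Perm
      ((A₁, x₁) :: (B₁, y₁) :: (A₂, x₂) :: (B₂, y₂) :: o) :=
    (List.perm_append_comm (l₁ := [(A₂, x₂), (B₂, y₂)]) (l₂ := [(A₁, x₁), (B₁, y₁)])).append_right o
  obtain ⟨g, hg⟩ := exists_red h w hok
  obtain ⟨g', hg'⟩ := exists_red h w (hok.perm hperm)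
  have ih₁ : h.Agree w (Forest.size ((.node x₁ A₁ y₁ B₁, m₁) :: o₁)) := by
    rw [← hφ₁.mixes.size]; exact @ih
  have ih₂ : h.Agree w (Forest.size ((.node x₂ A₂ y₂ B₂, m₁) :: o₂)) := by
    rw [← hφ₂.mixes.size]; exact @ih
  have e₁ := Agree.split_next @ih₁ hG₁ hl₁ (hφ₁.le.trans hd) hk₁ hmd
    (hs.mono htd) hmin hg₁ hg rfl rfl
  have e₂ := Agree.split_next @ih₂ hG₂ hl₂ hφ₂.le hk₂ hmd hs₂ hmin
    hg₂ hg' rfl rfl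
  have hr := (((((Moves.swap (T := h.trees w) (B₂, y₂) (A₁, x₁) ((B₁, y₁) :: o)).cons
    (A₂, x₂)).trans (Moves.swap (A₂, x₂) (A₁, x₁) ((B₂, y₂) :: (B₁, y₁) :: o))).trans
    (((Moves.swap (B₂, y₂) (B₁, y₁) o).cons (A₂, x₂)).cons (A₁, x₁))).trans
    ((Moves.swap (A₂, x₂) (B₁, y₁) ((B₂, y₂) :: o)).cons (A₁, x₁)))
  have e₃ := ih.perm (by
    have a := hφ₁.size
    have b := hmix.size
    simp only [size_cons, LTree.size] at a b ⊢
    omega) hok hr hperm hg hg'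
  obtain ⟨f₁, hf₁, rfl⟩ := hφ₁.moves
  obtain ⟨f₂, hf₂, rfl⟩ := hφ₂.moves
  have e₄ := moves_unique hF ((hf₁.trans (hk₁.cons _)).trans (Moves.exchange _ _ _ _ _))
    (hf₂.trans (hk₂.cons _))
  have e₅ := congrArg (fun f => f.app Pre.empty) e₄
  rw [e₁, e₂, e₃]
  refine paste_split e₅ ?_
  -- with `split_front` for the right hand side, the remaining identity is `split_comm`
  have s₁ := h.split_comm ((S.canObj A₁).obj w) ((S.canObj B₁).obj w) ((S.canObj A₂).obj w)
    ((S.canObj B₂).obj w)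
  rw [← h.split_front] at s₁
  obtain ⟨ε, hε⟩ : ∃ ε, ε = S.qq (S.ob ((S.canObj A₁).obj w) ((S.canObj B₁).obj w))
    (S.ob ((S.canObj A₂).obj w) ((S.canObj B₂).obj w)) ≫ c.cc _ _ := ⟨_, rfl⟩
  rw [← reassoc_of% hε] at s₁
  have s₂ := congrArg (fun f => (word (h.trees w).act (o.map Prod.fst)).map (Pre.homOf f)) s₁
  simp only [Pre.homOf_comp, Functor.map_comp] at s₂
  subst hε
  simp only [NatTrans.comp_app, Category.assoc]
  exact (Category.assoc _ _ _).trans s₂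

/-- Two reductions of a forest agree if reductions of smaller forests do. -/
theorem Red.unique_of_agree {F : Forest n} (ih : h.Agree w F.size) (hF : F.Proper) {g g'}
    (hg : h.Red w F g) (hg' : h.Red w F g') : g = g' := by
  by_cases hs : F.size = 0
  · exact (hg.of_size hF (.refl F) hg' hs).trans (Category.id_comp _)
  · obtain ⟨d₁, x₁, A₁, y₁, B₁, m₁, o₁, φ₁, k₁, hφ₁, hk₁, rfl⟩ := hg.exists_step hs
    obtain ⟨d₂, x₂, A₂, y₂, B₂, m₂, o₂, φ₂, k₂, hφ₂, hk₂, rfl⟩ := hg'.exists_step hs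
    by_cases e : LTree.node x₁ A₁ y₁ B₁ = .node x₂ A₂ y₂ B₂
    · obtain ⟨rfl, rfl, rfl, rfl⟩ := LTree.node.inj e
      rcases le_total d₁ d₂ with hd | hd
      · exact Step.comp_eq @ih hF hφ₁ hφ₂ hd hk₁ hk₂
      · exact (Step.comp_eq @ih hF hφ₂ hφ₁ hd hk₂ hk₁).symm
    · rcases le_total d₁ d₂ with hd | hd
      · exact Step.comp_eq_of_ne @ih hF hφ₁ hφ₂ hd e hk₁ hk₂
      · exact (Step.comp_eq_of_ne @ih hF hφ₂ hφ₁ hd (Ne.symm e) hk₂ hk₁).symm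

theorem low_of_others {n : ℕ} {e d : ℕ} {F : Forest n} {T : LTree n} (hT : T.Grows e)
    (h : ∀ p ∈ F, p.2 ≤ e → p.1 ≠ T → p.1.Grows (max d e)) : Low e F := fun p hp hd => by
  by_cases hpT : p.1 = T
  · exact hpT ▸ hT
  · exact (h p hp hd hpT).mono (le_max_right _ _)

/-- After the same tree has been moved to the front of two forests, what remains is still moved
below `max d e`. -/
theorem movedBelow_rest {n : ℕ} {d e m : ℕ} {F F' o o' : Forest n} {T : LTree n} (hF : F.Proper)
    (hd : MovedBelow d F F') (hmix : Mixes F ((T, m) :: o)) (hs : SameAbove e F ((T, m) :: o))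
    (hs' : SameAbove e F' ((T, m) :: o')) (hok : Proper ((T, m) :: o))
    (ho : ∀ p ∈ F, p.2 ≤ e → p.1 ≠ T → p.1.Grows (max d e)) :
    MovedBelow (max d e) o o' := by
  intro p hp hp'
  have hpT : p.1 ≠ T := fun e =>
    (List.nodup_cons.1 hok.fst_nodup).1 (List.mem_map.2 ⟨p, hp, e⟩)
  have hp₁ : p ∈ (T, m) :: o := List.mem_cons_of_mem _ hp
  by_cases hpe : p.2 ≤ e
  · obtain ⟨k, hk⟩ := hmix.symm.exists_fst hp₁
    have := Mixes.le_of_sameAbove (T := p.1) (i := p.2) hF hmix hs hp₁ hk hpe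
    exact ⟨hpe.trans (le_max_right _ _), ho (p.1, k) hk this hpT⟩
  · have hpF := (hs p (by omega)).2 hp₁
    have hpF' : p ∉ F' := fun hpF' => by
      rcases List.mem_cons.1 ((hs' p (by omega)).1 hpF') with e | e
      · exact hpT (congrArg Prod.fst e)
      · exact hp' e
    have := hd p hpF hpF'
    rw [max_eq_left (by omega)]
    exact this

/-- Coherence for reductions of forests: by induction on the number of internal nodes, all
reductions of a forest agree, also after interchanges of low trees. -/
theorem agree (h : c.Compatible) (w : Fin n → C) (k : ℕ) : h.Agree w k := by
  induction k with
  | zero => intro F F' d f g g' hs; omega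
  | succ k ih =>
    intro F F' d f g g' hk hF hf hd hd' hg hg'
    rcases Nat.lt_succ_iff_lt_or_eq.1 hk with hk | rfl
    · exact ih hk hF hf hd hd' hg hg'
    have hF' := hF.of_moved hf.mixes hd'
    by_cases hs : F.size = 0
    · exact hg.of_size hF hf hg' hs
    obtain ⟨T, t, t', e, hT, hT', hTs, hte, hte', hTe, hl, hl'⟩ :=
      exists_common hF hF' hf.mixes hd hd' hs
    obtain ⟨x, A, y, B, rfl⟩ := LTree.exists_node hTs
    obtain ⟨m, o, φ, hφ⟩ := exists_step h w hF (low_of_others hTe hl) hT hte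
    obtain ⟨m', o', φ', hφ'⟩ := exists_step h w hF' (low_of_others hTe hl') hT' hte'
    have hm := (hφ.mixes.symm.trans hf.mixes).trans hφ'.mixes
    obtain rfl : m = m' := lowest_unique hm hφ.min hφ'.min
    obtain ⟨k, hk⟩ := Moves.exists (T := h.trees w) hm.cons_inv.fst hm.cons_inv.snd
    obtain ⟨k₁, hk₁⟩ := exists_red h w (hφ.proper hF)
    obtain ⟨k₂, hk₂⟩ := exists_red h w (hφ'.proper hF')
    have ih' : h.Agree w F'.size := by rw [← hf.mixes.size]; exact @ih
    rw [Red.unique_of_agree @ih hF hg (.step hφ hk₁),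
      Red.unique_of_agree @ih' hF' hg' (.step hφ' hk₂)]
    have e₁ := ih (by have := hφ.size; omega) (hφ.proper hF) ((hk.cons (B, y)).cons (A, x))
      (((movedBelow_rest hF hd hφ.mixes hφ.same hφ'.same (hφ.proper_target hF) hl).cons _).cons _)
      (((movedBelow_rest hF' hd' hφ'.mixes hφ'.same hφ.same (hφ'.proper_target hF')
        hl').cons _).cons _) hk₁ hk₂
    obtain ⟨f₁, hf₁, rfl⟩ := hφ.moves
    obtain ⟨f₂, hf₂, rfl⟩ := hφ'.moves
    have e₂ := congrArg (fun f => f.app Pre.empty)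
      (moves_unique hF (hf₁.trans (hk.cons (.node x A y B, m))) (hf.trans hf₂))
    rw [e₁]
    exact ((Category.assoc _ _ _).symm.trans (congrArg (· ≫ k₂) e₂)).trans (Category.assoc _ _ _)

theorem Red.unique {F : Forest n} (hF : F.Proper) {g g'} (hg : h.Red w F g) (hg' : h.Red w F g') :
    g = g' := hg.unique_of_agree (agree h w F.size) hF hg'

/-- Reductions are compatible with interchanges of low trees. -/
theorem Red.moves {F F' : Forest n} {d : ℕ} {f} (hF : F.Proper) (hf : (h.trees w).Moves F F' f)
    (hd : MovedBelow d F F') (hd' : MovedBelow d F' F) {g g'} (hg : h.Red w F g)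
    (hg' : h.Red w F' g') : g = f.app .empty ≫ g' :=
  agree h w (F.size + 1) (Nat.lt_succ_self _) hF hf hd hd' hg hg'

/-- Reductions are compatible with interchanges of trees together with their tags. -/
theorem Red.perm {F F' : Forest n} {f} (hF : F.Proper) (hf : (h.trees w).Moves F F' f)
    (hp : F.Perm F') {g g'} (hg : h.Red w F g) (hg' : h.Red w F' g') :
    g = f.app .empty ≫ g' :=
  hg.moves (d := 0) hF hf (.of_perm hp) (.of_perm hp.symm) hg'

end Commutativity.Compatible

end QTensor

/-! ### Primitive arrows and reductions -/

namespace Forest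

theorem MovedBelow.of_sameAbove {n : ℕ} {d : ℕ} {F G : Forest n} (h : Low d F)
    (hs : SameAbove d F G) : MovedBelow d F G := fun p hp hp' => by
  by_cases hd : p.2 ≤ d
  · exact ⟨hd, h p hp hd⟩
  · exact absurd ((hs p (by omega)).1 hp) hp'

theorem exists_lowest_cons {X : Type*} {o : List (X × ℕ)} {t : ℕ}
    (ht : (t :: o.map Prod.snd).Nodup) : (∀ p ∈ o, t < p.2) ∨
      ∃ I m r, m < t ∧ o.Perm ((I, m) :: r) ∧ ∀ p ∈ r, m < p.2 := by
  rw [or_iff_not_imp_left]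
  intro h
  push Not at h
  obtain ⟨q, hq, hqt⟩ := h
  obtain ⟨⟨I, m⟩, hI, hmin⟩ := exists_min (List.ne_nil_of_mem hq)
  obtain ⟨r, hr⟩ := exists_perm_cons hI
  have hn := (hr.map Prod.snd).nodup_iff.1 (List.nodup_cons.1 ht).2
  refine ⟨I, m, r, lt_of_le_of_ne ((hmin q hq).trans hqt) ?_, hr, fun p hp => ?_⟩
  · rintro rfl
    exact (List.nodup_cons.1 ht).1 (List.mem_map.2 ⟨_, hI, rfl⟩)
  · refine lt_of_le_of_ne (hmin p (hr.symm.subset (List.mem_cons_of_mem _ hp))) fun e => ?_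
    exact (List.nodup_cons.1 hn).1 (List.mem_map.2 ⟨p, hp, e.symm⟩)

end Forest

namespace QTensor

open TaggedFamily Forest

variable {C : Type u} [Category.{v} C] {S : QTensor C} {c : S.Commutativity}

/-- `C` as a full subcategory of `Pre C`. -/
def Pre.incl (C : Type u) [Category.{v} C] : C ⥤ Pre C where
  obj := .of
  map f := Pre.homOf f

namespace Commutativity.Compatible

variable {h : c.Compatible} {n : ℕ} {w : Fin n → C}

variable (h w) in
/-- Transformations of the products of `X` and the trees of a forest, natural in the object `X`. -/
abbrev Shift (o o' : Forest n) : Type max u v :=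
  Pre.incl C ⋙ tagged (h.trees w) o ⟶ Pre.incl C ⋙ tagged (h.trees w) o'

/-- A shift at the object that belongs to a tree in front of the forest. -/
def Shift.at {o o' : Forest n} (θ : h.Shift w o o') (T : LTree n) (t t' : ℕ) :
    h.value w ((T, t) :: o) ⟶ h.value w ((T, t') :: o') := NatTrans.app θ ((S.canObj T).obj w)

variable (h w) in
/-- An arrow at the first place of a forest. -/
def onFirst {T T' : LTree n} (φ : (S.canObj T).obj w ⟶ (S.canObj T').obj w) (t t' : ℕ)
    (o : Forest n) : h.value w ((T, t) :: o) ⟶ h.value w ((T', t') :: o) :=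
  (tagged (h.trees w) o).map (Pre.homOf φ)

theorem Shift.onFirst_at {o o' : Forest n} (θ : h.Shift w o o') {T T' : LTree n}
    (φ : (S.canObj T).obj w ⟶ (S.canObj T').obj w) (t t' : ℕ) :
    h.onFirst w φ t t o ≫ θ.at T' t t' = θ.at T t t' ≫ h.onFirst w φ t' t' o' :=
  NatTrans.naturality θ φ

/-- The exchange of the tags of `X` and the tree `I`. -/
def Shift.tag (I : LTree n) (i j : ℕ) (r : Forest n) : h.Shift w ((I, i) :: r) ((I, j) :: r) :=
  Functor.whiskerRight (G := Pre.incl C ⋙ (h.trees w).act I) (H := Pre.incl C ⋙ (h.trees w).act I)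
    { app := fun X => Pre.homOf (S.qq X ((S.canObj I).obj w))
      naturality := fun _ _ f => S.onL_qq f _ } (tagged (h.trees w) r)

variable (h w) in
/-- The tree in front can be given the lowest tag by a shift. -/
theorem exists_first {o : Forest n} {t : ℕ} (ht : (t :: o.map Prod.snd).Nodup) :
    ∃ m o', ∃ θ : h.Shift w o o', m ≤ t ∧ (∀ p ∈ o', m < p.2) ∧ (∀ p, t < p.2 → (p ∈ o ↔ p ∈ o')) ∧
      ∀ T, ∃ f, (h.trees w).Moves ((T, t) :: o) ((T, m) :: o') f ∧ θ.at T t m = f.app .empty := by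
  rcases exists_lowest_cons ht with hmin | ⟨I, m, r, hm, hr, hmin⟩
  · exact ⟨t, o, 𝟙 _, le_rfl, hmin, fun _ _ => Iff.rfl, fun T => ⟨_, .refl _, rfl⟩⟩
  · obtain ⟨k, hk⟩ := Moves.of_perm (T := h.trees w) hr
    refine ⟨m, (I, t) :: r, Functor.whiskerLeft (Pre.incl C) k ≫ Shift.tag I m t r, hm.le,
      fun p hp => ?_, fun p hp => ?_, fun T => ⟨_, (hk.cons (T, t)).trans (Moves.tags T I t m r), rfl⟩⟩
    · rcases List.mem_cons.1 hp with rfl | hp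
      exacts [hm, hmin p hp]
    · have e₁ : p ≠ (I, m) := fun e => by subst e; exact absurd hp (lt_asymm hm)
      have e₂ : p ≠ (I, t) := fun e => by subst e; exact absurd hp (lt_irrefl _)
      simp only [hr.mem_iff, List.mem_cons, e₁, e₂, false_or]

variable (h w) in
/-- A tree behind the first one can be brought to the second place and be given the lowest tag by a
shift. -/
theorem exists_second {o : Forest n} {t : ℕ} (ht : (t :: o.map Prod.snd).Nodup) {W : LTree n}
    {s : ℕ} (hW : (W, s) ∈ o) :
    ∃ m o' t', ∃ θ : h.Shift w o ((W, m) :: o'), m ≤ s ∧ m < t' ∧ (∀ p ∈ o', m < p.2) ∧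
      ∀ T, SameAbove s ((T, t) :: o) ((T, t') :: (W, m) :: o') ∧
        ∃ f, (h.trees w).Moves ((T, t) :: o) ((T, t') :: (W, m) :: o') f ∧
          θ.at T t t' = f.app .empty := by
  obtain ⟨m, o', hm, hmix, hmin, hs⟩ := exists_lowest (List.nodup_cons.1 ht).2 hW
  obtain ⟨k, hk⟩ := Moves.exists (T := h.trees w) hmix.fst hmix.snd
  have hne : t ≠ m := fun e => (List.nodup_cons.1 ht).1
    (hmix.snd.symm.subset (by rw [e]; exact List.mem_cons_self))
  rcases lt_or_gt_of_ne hne with hlt | hlt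
  · refine ⟨t, o', m, Functor.whiskerLeft (Pre.incl C) k ≫ Shift.tag W m t o', hlt.le.trans hm, hlt,
      fun p hp => hlt.trans (hmin p hp), fun T => ⟨fun p hp => ?_, _,
        (hk.cons (T, t)).trans (Moves.tags T W t m o'), rfl⟩⟩
    have e : ∀ q : LTree n × ℕ, q.2 ≤ s → p ≠ q := fun q hq e => by subst e; omega
    have := hs p hp
    simp only [List.mem_cons, e (W, m) hm, e (T, t) (hlt.le.trans hm), e (T, m) hm,
      e (W, t) (hlt.le.trans hm), false_or] at this ⊢
    exact this
  · exact ⟨m, o', t, Functor.whiskerLeft (Pre.incl C) k, hm, hlt, hmin, fun T =>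
      ⟨hs.cons _, _, hk.cons (T, t), rfl⟩⟩

/-- A reduction of a forest as a reduction of the forest in which the first two trees are joined. -/
def join {A B : LTree n} {x y : ℕ} {o : Forest n} {Z : Pre C}
    (k : h.value w ((A, x) :: (B, y) :: o) ⟶ Z) (m : ℕ) : h.value w ((.node x A y B, m) :: o) ⟶ Z :=
  k

/-- A tree at the first place and the lowest tag can be split without any interchange. -/
theorem Red.split_first {A B : LTree n} {x y m : ℕ} {o : Forest n}
    (hF : Proper ((.node x A y B, m) :: o)) (hm : ∀ p ∈ o, m < p.2) {g k}
    (hg : h.Red w ((.node x A y B, m) :: o) g) (hk : h.Red w ((A, x) :: (B, y) :: o) k) :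
    g = join k m := by
  have hs : h.Step w m ((.node x A y B, m) :: o) x A y B m o ((𝟙 (tagged (h.trees w)
      ((.node x A y B, m) :: o)) : _ ⟶ _).app .empty) := by
    refine ⟨fun p hp hd => ?_, ⟨_, .refl _, rfl⟩, fun _ _ => Iff.rfl, hm, le_rfl⟩
    rcases List.mem_cons.1 hp with rfl | hp
    · exact hF.grows _ List.mem_cons_self
    · exact absurd hd (not_le_of_gt (hm p hp))
  exact (hg.unique hF (.step hs hk)).trans (Category.id_comp _)

/-- A tree at the second place and the lowest tag can be split by a reattachment. -/
theorem Red.split_second {T P R : LTree n} {t p q m : ℕ} {o : Forest n}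
    (hF : Proper ((T, t) :: (.node p P q R, m) :: o)) (ht : m < t) (hm : ∀ p ∈ o, m < p.2) {g k}
    (hg : h.Red w ((T, t) :: (.node p P q R, m) :: o) g)
    (hk : h.Red w ((T, t) :: (P, p) :: (R, q) :: o) k) :
    g = ((tagged (h.trees w) o).map (Pre.homOf (S.a' ((S.canObj T).obj w) ((S.canObj P).obj w)
      ((S.canObj R).obj w))) : h.value w ((T, t) :: (.node p P q R, m) :: o) ⟶
        h.value w ((T, t) :: (P, p) :: (R, q) :: o)) ≫ k := by
  have hF' := hF.perm (.swap _ _ _)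
  obtain ⟨k', hk'⟩ := exists_red h w hF'
  obtain ⟨r, hr⟩ := exists_red h w hF'.split
  have hm' : ∀ p ∈ (T, t) :: o, m < p.2 := fun p hp => by
    rcases List.mem_cons.1 hp with rfl | hp
    exacts [ht, hm p hp]
  have e₁ := hg.perm hF (.swap _ _ o) (.swap _ _ _) hk'
  have e₂ := hk'.split_first hF' hm' hr
  have e₃ := hr.perm hF'.split (((Moves.swap (R, q) (T, t) o).cons (P, p)).trans
    (Moves.swap (P, p) (T, t) ((R, q) :: o))) (((List.Perm.swap _ _ _).cons _).trans (.swap _ _ _))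
    hk
  have e₄ := congrArg (fun f => (tagged (h.trees w) o).map (Pre.homOf f))
    (h.split_front ((S.canObj T).obj w) ((S.canObj P).obj w) ((S.canObj R).obj w))
  simp only [Pre.homOf_comp, Functor.map_comp] at e₄
  rw [e₁, e₂, e₃]
  refine Eq.trans ?_ (congrArg (· ≫ k) e₄)
  exact (Category.assoc _ _ _).symm

variable (h w) in
/-- The arrow `a` that reattaches the second tree. -/
def reattach (A B D : LTree n) (l x y z l' : ℕ) (o : Forest n) :
    h.value w ((.node x A y B, l) :: (D, z) :: o) ⟶
      h.value w ((A, x) :: (.node y B z D, l') :: o) :=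
  (tagged (h.trees w) o).map (Pre.homOf (S.a ((S.canObj A).obj w) ((S.canObj B).obj w)
    ((S.canObj D).obj w)))

/-- Reattachment at a lowest tag. -/
theorem Red.reattach_lowest {A B D : LTree n} {l x y z : ℕ} {o : Forest n}
    (hF : Proper ((.node x A y B, l) :: (D, z) :: o)) (hF' : Proper ((A, x) :: (.node y B z D, l) :: o))
    (hl : ∀ p ∈ o, l < p.2) {g g'} (hg : h.Red w ((.node x A y B, l) :: (D, z) :: o) g)
    (hg' : h.Red w ((A, x) :: (.node y B z D, l) :: o) g') :
    g = h.reattach w A B D l x y z l o ≫ g' := by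
  obtain ⟨k, hk⟩ := exists_red h w hF.split
  have hlx : l < x := (hF.grows _ List.mem_cons_self).1
  have hlz : l < z := (hF'.grows _ (List.mem_cons_of_mem _ List.mem_cons_self)).2.1
  have hm : ∀ p ∈ (D, z) :: o, l < p.2 := fun p hp => by
    rcases List.mem_cons.1 hp with rfl | hp
    exacts [hlz, hl p hp]
  rw [hg.split_first hF hm hk, hg'.split_second hF' hlx hl hk]
  have e := congrArg (fun f => (tagged (h.trees w) o).map (Pre.homOf f))
    (S.a_a' ((S.canObj A).obj w) ((S.canObj B).obj w) ((S.canObj D).obj w))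
  simp only [Pre.homOf_comp, Functor.map_comp, Pre.homOf_id, CategoryTheory.Functor.map_id] at e
  exact ((Category.assoc _ _ _).symm.trans ((congrArg (· ≫ k) e).trans (Category.id_comp k))).symm

theorem paste_reattach {E : Type*} [Category E] {P P₁ P₂ P₃ P₄ P₅ P₆ : E} {k : P ⟶ P₁} {a₁ : P₁ ⟶ P₂}
    {a₂ : P₂ ⟶ P₃} {a₃ : P₃ ⟶ P₄} {r : P₄ ⟶ P₅} {Q Q₁ : E} {a : P ⟶ Q} {k' : Q ⟶ Q₁} {a' : P₁ ⟶ Q₁}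
    {s : Q₁ ⟶ P₅} {g : P₅ ⟶ P₆} (e₁ : a ≫ k' = k ≫ a') (e₂ : a' ≫ s = a₁ ≫ a₂ ≫ a₃ ≫ r) :
    (((k ≫ a₁) ≫ a₂) ≫ a₃) ≫ r ≫ g = a ≫ (k' ≫ s) ≫ g := by
  simp only [Category.assoc]
  rw [reassoc_of% e₁, reassoc_of% e₂]

/-- Reattachment at a tag below which there are only leaves. -/
theorem Red.reattach {A B D : LTree n} {l x y z : ℕ} {o : Forest n}
    (hF : Proper ((.node x A y B, l) :: (D, z) :: o)) (hF' : Proper ((A, x) :: (.node y B z D, l) :: o))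
    (hl : ∀ p ∈ o, p.2 < l → p.1.size = 0) {g g'}
    (hg : h.Red w ((.node x A y B, l) :: (D, z) :: o) g)
    (hg' : h.Red w ((A, x) :: (.node y B z D, l) :: o) g') :
    g = h.reattach w A B D l x y z l o ≫ g' := by
  have hY := hF.grows _ List.mem_cons_self
  have hY' := hF'.grows _ (List.mem_cons_of_mem _ List.mem_cons_self)
  have hlx : l < x := hY.1
  have hlz : l < z := hY'.2.1
  have hn : (l :: o.map Prod.snd).Nodup := (List.nodup_cons.1 hF'.snd_nodup).2
  rcases exists_lowest_cons hn with hmin | ⟨I, m, r, hm, hr, hmin⟩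
  · exact hg.reattach_lowest hF hF' hmin hg'
  · obtain ⟨k, hk⟩ := Moves.of_perm (T := h.trees w) hr
    have ho : ∀ p ∈ o, p.2 ≤ l → p.1.Grows l := fun p hp hpl => by
      refine LTree.grows_of_size (hl p hp (lt_of_le_of_ne hpl fun e => ?_)) _
      exact (List.nodup_cons.1 hn).1 (List.mem_map.2 ⟨p, hp, e⟩)
    have hlow : Low l ((.node x A y B, l) :: (D, z) :: o) := fun p hp hpl => by
      rcases List.mem_cons.1 hp with rfl | hp
      · exact hY
      · rcases List.mem_cons.1 hp with rfl | hp
        exacts [absurd hpl (not_le_of_gt hlz), ho p hp hpl]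
    have hlow' : Low l ((A, x) :: (.node y B z D, l) :: o) := fun p hp hpl => by
      rcases List.mem_cons.1 hp with rfl | hp
      · exact absurd hpl (not_le_of_gt hlx)
      · rcases List.mem_cons.1 hp with rfl | hp
        exacts [hY', ho p hp hpl]
    have e : ∀ q p : LTree n × ℕ, l < p.2 → q.2 ≤ l → p ≠ q := fun q p hp hq e => by
      subst e; omega
    have hs : SameAbove l ((.node x A y B, l) :: (D, z) :: o)
        ((.node x A y B, m) :: (D, z) :: (I, l) :: r) := fun p hp => by
      simp only [List.mem_cons, hr.mem_iff, e (_, l) p hp le_rfl, e (_, m) p hp hm.le, false_or]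
    have hs' : SameAbove l ((A, x) :: (.node y B z D, l) :: o)
        ((A, x) :: (.node y B z D, m) :: (I, l) :: r) := fun p hp => by
      simp only [List.mem_cons, hr.mem_iff, e (_, l) p hp le_rfl, e (_, m) p hp hm.le, false_or]
    -- the leaf `I` at the lowest tag `m` exchanges its tag with the internal node at `l`; before the
    -- reattachment, where that node is not adjacent to `I`, `I` is carried past `D` and back
    have hf := ((((hk.cons (D, z)).cons (.node x A y B, l)).trans
      ((Moves.swap (D, z) (I, m) r).cons (.node x A y B, l))).trans
      (Moves.tags (.node x A y B) I l m ((D, z) :: r))).trans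
      ((Moves.swap (I, l) (D, z) r).cons (.node x A y B, m))
    have hf' := ((hk.cons (.node y B z D, l)).cons (A, x)).trans
      ((Moves.tags (.node y B z D) I l m r).cons (A, x))
    have hG := hF.mixes_low hlow (Moves.mixes hf) hs
    have hG' := hF'.mixes_low hlow' (Moves.mixes hf') hs'
    obtain ⟨g₁, hg₁⟩ := exists_red h w hG
    obtain ⟨g₂, hg₂⟩ := exists_red h w hG'
    rw [hg.moves hF hf (.of_sameAbove hlow hs)
        (.of_sameAbove (hlow.mixes hF (Moves.mixes hf) hs) hs.symm) hg₁,
      hg'.moves hF' hf' (.of_sameAbove hlow' hs')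
        (.of_sameAbove (hlow'.mixes hF' (Moves.mixes hf') hs') hs'.symm) hg₂,
      hg₁.reattach_lowest hG hG' (fun p hp => by
        rcases List.mem_cons.1 hp with rfl | hp
        exacts [hm, hmin p hp]) hg₂]
    have e₁ := h.assoc_tag ((S.canObj A).obj w) ((S.canObj B).obj w) ((S.canObj D).obj w)
      ((S.canObj I).obj w)
    have e₂ := congrArg (fun f => (tagged (h.trees w) r).map (Pre.homOf f)) e₁
    simp only [Pre.homOf_comp, Functor.map_comp] at e₂
    have e₃ := k.naturality (Pre.homOf (S.a ((S.canObj A).obj w) ((S.canObj B).obj w)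
      ((S.canObj D).obj w)))
    exact paste_reattach e₃ e₂

variable (h w) in
/-- Primitive arrows at the first tree are compatible with the reductions of forests with fewer than
`k` internal nodes. -/
def PrimAgree (k : ℕ) : Prop := ∀ {T T' : LTree n} (f : Prim T T') {t : ℕ} {o : Forest n} {g g'},
  Forest.size ((T, t) :: o) < k → Proper ((T, t) :: o) → Proper ((T', t) :: o) →
    h.Red w ((T, t) :: o) g → h.Red w ((T', t) :: o) g' →
      g = h.onFirst w ((canPrim c f).hom.app w) t t o ≫ g'

/-- A tree behind the first one can be split before the arrow is applied, provided that its level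
is below `b`, and that up to `b` the first tree can be raised before and after the arrow. -/
theorem PrimAgree.descend {T T' : LTree n} {f : Prim T T'} {t : ℕ} {o : Forest n}
    (ih : h.PrimAgree w (Forest.size ((T, t) :: o))) (hF : Proper ((T, t) :: o))
    (hF' : Proper ((T', t) :: o)) {b : ℕ} (hb : ∀ s, t < s → s < b → T.Grows s ∧ T'.Grows s)
    (hW : ∃ p ∈ o, p.1.size ≠ 0 ∧ p.2 < b) {g g'} (hg : h.Red w ((T, t) :: o) g)
    (hg' : h.Red w ((T', t) :: o) g') :
    g = h.onFirst w ((canPrim c f).hom.app w) t t o ≫ g' := by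
  obtain ⟨⟨W, s⟩, ⟨hW, hWs, hsb⟩, hmin⟩ := Set.exists_min_image
    {p | p ∈ o ∧ p.1.size ≠ 0 ∧ p.2 < b} Prod.snd (o.finite_toSet.subset fun p hp => hp.1) hW
  obtain ⟨x, P, y, R, rfl⟩ := LTree.exists_node hWs
  have hlow : ∀ {T}, Proper ((T, t) :: o) → (t < s → T.Grows s) → Low s ((T, t) :: o) := by
    intro T hF hT p hp hps
    rcases List.mem_cons.1 hp with rfl | hp'
    · refine hT (lt_of_le_of_ne hps fun e => (List.nodup_cons.1 hF.snd_nodup).1 ?_)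
      exact List.mem_map.2 ⟨_, hW, e.symm⟩
    · by_cases hs : p.1.size = 0
      · exact LTree.grows_of_size hs s
      · have := le_antisymm hps (hmin p ⟨hp', hs, hps.trans_lt hsb⟩)
        have := hF.eq_of_snd hp (List.mem_cons_of_mem _ hW) this
        subst this
        exact hF.grows _ hp
  obtain ⟨m, o', t', θ, hms, hmt, ho', hθ⟩ := exists_second h w (t := t) hF.snd_nodup hW
  have key : ∀ {T} (_ : Proper ((T, t) :: o)) (_ : t < s → T.Grows s),
      Proper ((T, t') :: (P, x) :: (R, y) :: o') ∧
      (Forest.size ((T, t) :: o) = Forest.size ((T, t') :: (P, x) :: (R, y) :: o') + 1) ∧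
      ∀ {g k}, h.Red w ((T, t) :: o) g → h.Red w ((T, t') :: (P, x) :: (R, y) :: o') k →
        g = θ.at T t t' ≫ ((tagged (h.trees w) o').map (Pre.homOf (S.a' ((S.canObj T).obj w)
          ((S.canObj P).obj w) ((S.canObj R).obj w))) :
          h.value w ((T, t') :: (.node x P y R, m) :: o') ⟶
            h.value w ((T, t') :: (P, x) :: (R, y) :: o')) ≫ k := by
    intro T hF hT
    obtain ⟨hs, f, hf, e⟩ := hθ T
    have hl := hlow hF hT
    have hG := hF.mixes_low hl (Moves.mixes hf) hs
    have hperm : ((T, t') :: (P, x) :: (R, y) :: o').Perm ((P, x) :: (R, y) :: (T, t') :: o') :=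
      (List.Perm.swap _ _ _).trans ((List.Perm.swap _ _ _).cons _)
    refine ⟨(hG.perm (.swap _ _ _)).split.perm hperm.symm, ?_, fun {g k} hg hk => ?_⟩
    · rw [(Moves.mixes hf).size]
      simp only [size_cons, LTree.size]
      omega
    · obtain ⟨k', hk'⟩ := exists_red h w hG
      rw [hg.moves hF hf (.of_sameAbove hl hs)
        (.of_sameAbove (hl.mixes hF (Moves.mixes hf) hs) hs.symm) hk', e,
        hk'.split_second hG hmt ho' hk]
      rfl
  obtain ⟨hG, hsize, e⟩ := key hF fun hts => (hb s hts hsb).1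
  obtain ⟨hG', -, e'⟩ := key hF' fun hts => (hb s hts hsb).2
  obtain ⟨k, hk⟩ := exists_red h w hG
  obtain ⟨k', hk'⟩ := exists_red h w hG'
  rw [e hg hk, e' hg' hk', ih f (by omega) hG hG' hk hk', ← Category.assoc (h.onFirst w _ t t o),
    θ.onFirst_at, Category.assoc]
  congr 1
  have e₁ := congrArg (fun f => (tagged (h.trees w) o').map (Pre.homOf f))
    (S.onL_a' ((canPrim c f).hom.app w) ((S.canObj P).obj w) ((S.canObj R).obj w))
  simp only [Pre.homOf_comp, Functor.map_comp] at e₁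
  exact ((Category.assoc _ _ _).symm.trans (congrArg (· ≫ k') e₁.symm)).trans (Category.assoc _ _ _)

variable (h w) in
/-- The first tree can be split if the trees at lower tags are leaves. -/
theorem exists_split {o : Forest n} {t : ℕ} (hn : (t :: o.map Prod.snd).Nodup)
    (hl : ∀ p ∈ o, p.2 < t → p.1.size = 0) : ∃ m o', ∃ θ : h.Shift w o o',
      (∀ p, t < p.2 → (p ∈ o ↔ p ∈ o')) ∧
      ∀ {x A y B}, Proper ((.node x A y B, t) :: o) → Proper ((A, x) :: (B, y) :: o') ∧
        (Forest.size ((.node x A y B, t) :: o) = Forest.size ((A, x) :: (B, y) :: o') + 1) ∧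
        (∀ p ∈ o', p.2 ≤ t → p.1.size = 0) ∧
        ∀ {g k}, h.Red w ((.node x A y B, t) :: o) g → h.Red w ((A, x) :: (B, y) :: o') k →
          g = θ.at (.node x A y B) t m ≫ join k m := by
  have hl' : ∀ p ∈ o, p.2 ≤ t → p.1.size = 0 := fun p hp hpt =>
    hl p hp (lt_of_le_of_ne hpt fun e =>
      (List.nodup_cons.1 hn).1 (List.mem_map.2 ⟨p, hp, e⟩))
  obtain ⟨m, o', θ, hm, ho', hs, hθ⟩ := exists_first h w hn
  refine ⟨m, o', θ, hs, fun {x A y B} hF => ?_⟩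
  obtain ⟨f, hf, e⟩ := hθ (.node x A y B)
  have hmix := Moves.mixes hf
  have hs' : SameAbove t ((.node x A y B, t) :: o) ((.node x A y B, m) :: o') := fun p hp => by
    have e : ∀ q : LTree n × ℕ, q.2 ≤ t → p ≠ q := fun q hq e => by subst e; omega
    simp only [List.mem_cons, hs p hp, e (_, t) le_rfl, e (_, m) hm, false_or]
  have hlow : Low t ((.node x A y B, t) :: o) := fun p hp hpt => by
    rcases List.mem_cons.1 hp with rfl | hp
    exacts [hF.grows _ List.mem_cons_self, LTree.grows_of_size (hl' p hp hpt) _]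
  have hG := hF.mixes_low hlow hmix hs'
  refine ⟨hG.split, by rw [hmix.size, size_split], fun p hp hpt => ?_, fun {g k} hg hk => ?_⟩
  · have hp' : p ∈ (.node x A y B, m) :: o' := List.mem_cons_of_mem _ hp
    obtain ⟨j, hj⟩ := hmix.symm.exists_fst hp'
    have hjt := Mixes.le_of_sameAbove (T := p.1) (i := p.2) hF hmix hs' hp' hj hpt
    rcases List.mem_cons.1 hj with e | hj
    · exact absurd (List.mem_map.2 ⟨p, hp, (Prod.mk.inj e).1⟩)
        (List.nodup_cons.1 hG.fst_nodup).1
    · exact hl' (p.1, j) hj hjt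
  · obtain ⟨k', hk'⟩ := exists_red h w hG
    rw [hg.moves hF hf (.of_sameAbove hlow hs')
      (.of_sameAbove (hlow.mixes hF hmix hs') hs'.symm) hk', e, hk'.split_first hG ho' hk]

/-- The primitive arrows are compatible with the reductions. -/
theorem primAgree (h : c.Compatible) (w : Fin n → C) (k : ℕ) : h.PrimAgree w k := by
  induction k with
  | zero => intro T T' f t o g g' hs; omega
  | succ k ih =>
    intro T T' f t o g g' hk hF hF' hg hg'
    rcases Nat.lt_succ_iff_lt_or_eq.1 hk with hk | rfl
    · exact ih f hk hF hF' hg hg'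
    by_cases hW : ∃ p ∈ o, p.1.size ≠ 0 ∧ p.2 < t
    · exact PrimAgree.descend @ih hF hF' (fun s hs hst => absurd hs (lt_asymm hst)) hW hg hg'
    have hleaf : ∀ p ∈ o, p.2 < t → p.1.size = 0 := fun p hp hpt =>
      by_contra fun hs => hW ⟨p, hp, hs, hpt⟩
    obtain ⟨m, o', θ, hs, H⟩ := exists_split h w (t := t) hF.snd_nodup hleaf
    cases f with
    | left x y f B =>
      obtain ⟨hG, hsize, -, e⟩ := H hF
      obtain ⟨hG', -, -, e'⟩ := H hF'
      obtain ⟨r, hr⟩ := exists_red h w hG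
      obtain ⟨r', hr'⟩ := exists_red h w hG'
      rw [e hg hr, e' hg' hr', ← Category.assoc, θ.onFirst_at, Category.assoc]
      exact congrArg (_ ≫ ·) (ih f (by omega) hG hG' hr hr')
    | right x y A f =>
      obtain ⟨hG, hsize, -, e⟩ := H hF
      obtain ⟨hG', -, -, e'⟩ := H hF'
      obtain ⟨r, hr⟩ := exists_red h w hG
      obtain ⟨r', hr'⟩ := exists_red h w hG'
      -- the right subtree is carried to the first place
      obtain ⟨s, hs⟩ := exists_red h w (hG.perm (.swap _ _ _))
      obtain ⟨s', hs'⟩ := exists_red h w (hG'.perm (.swap _ _ _))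
      rw [e hg hr, e' hg' hr', ← Category.assoc, θ.onFirst_at, Category.assoc]
      rw [hr.perm hG (.swap _ _ o') (.swap _ _ _) hs, hr'.perm hG' (.swap _ _ o') (.swap _ _ _) hs',
        ih f (by simp only [size_cons] at hsize ⊢; omega) (hG.perm (.swap _ _ _))
          (hG'.perm (.swap _ _ _)) hs hs']
      refine congrArg (_ ≫ ·) ?_
      have e₁ := congrArg (fun f => (tagged (h.trees w) o').map (Pre.homOf f))
        (onR_cc c ((S.canObj A).obj w) ((canPrim c f).hom.app w))
      simp only [Pre.homOf_comp, Functor.map_comp] at e₁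
      exact ((Category.assoc _ _ _).symm.trans (congrArg (· ≫ s') e₁.symm)).trans
        (Category.assoc _ _ _)
    | swap x y A B =>
      obtain ⟨hG, hsize, -, e⟩ := H hF
      obtain ⟨hG', -, -, e'⟩ := H hF'
      obtain ⟨r, hr⟩ := exists_red h w hG
      obtain ⟨r', hr'⟩ := exists_red h w hG'
      rw [e hg hr, e' hg' hr', ← Category.assoc, θ.onFirst_at, Category.assoc]
      exact congrArg (_ ≫ ·) (hr.perm hG (.swap (A, x) (B, y) o') (.swap _ _ _) hr')
    | inter x y A B hxy =>
      obtain ⟨hG, hsize, -, e⟩ := H hF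
      obtain ⟨hG', -, -, e'⟩ := H hF'
      obtain ⟨r, hr⟩ := exists_red h w hG
      obtain ⟨r', hr'⟩ := exists_red h w hG'
      rw [e hg hr, e' hg' hr', ← Category.assoc, θ.onFirst_at, Category.assoc]
      -- `A` and `B` can both be placed at the higher of the two levels, as one sees from the source
      -- and from the target of the interchange
      have hA := (hF.grows _ List.mem_cons_self).2.2.1
      have hB := (hF'.grows _ List.mem_cons_self).2.2.2
      have key : ∀ i j i' j', i ≤ x → j ≤ x →
          MovedBelow x ((A, i) :: (B, j) :: o') ((A, i') :: (B, j') :: o') := by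
        intro i j i' j' hi hj p hp hp'
        simp only [List.mem_cons, not_or] at hp hp'
        rcases hp with rfl | rfl | hp
        exacts [⟨hi, hA⟩, ⟨hj, hB⟩, absurd hp hp'.2.2]
      exact congrArg (_ ≫ ·) (hr.moves hG (.tags A B x y o') (key _ _ _ _ le_rfl hxy.le)
        (key _ _ _ _ hxy.le le_rfl) hr')
    | assoc l x y z A B D =>
      by_cases hW' : ∃ p ∈ o, p.1.size ≠ 0 ∧ p.2 < l
      · refine PrimAgree.descend @ih hF hF' (fun s hts hsl => ?_) hW' hg hg'
        -- the root of the source can be raised up to `l`: the target shows that `l < z`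
        have h₁ := hF.grows _ List.mem_cons_self
        have h₂ := hF'.grows _ List.mem_cons_self
        exact ⟨⟨hsl, hsl.trans h₂.2.2.2.2.1, h₁.2.2⟩, ⟨hsl.trans h₁.2.2.1.1, hsl, h₂.2.2⟩⟩
      · obtain ⟨hG, hsize, ho', e⟩ := H hF
        obtain ⟨hG', -, -, e'⟩ := H hF'
        obtain ⟨r, hr⟩ := exists_red h w hG
        obtain ⟨r', hr'⟩ := exists_red h w hG'
        rw [e hg hr, e' hg' hr', ← Category.assoc, θ.onFirst_at, Category.assoc]
        refine congrArg (_ ≫ ·) (hr.reattach hG hG' (fun p hp hpl => ?_) hr')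
        by_cases hpt : p.2 ≤ t
        · exact ho' p hp hpt
        · exact by_contra fun hps => hW' ⟨p, (hs p (by omega)).2 hp, hps, hpl⟩

end Commutativity.Compatible

end QTensor

/-! ### Coherence -/

namespace Quiver

/-- Arrows of a free groupoid are composites of generators and their inverses. -/
theorem FreeGroupoid.hom_induction {V : Type*} [Quiver V] {X : Quiver.FreeGroupoid V}
    {P : ∀ {Y : Quiver.FreeGroupoid V}, (X ⟶ Y) → Prop} (id : P (𝟙 X))
    (of_comp : ∀ {Y Z : V} (f : X ⟶ (Quiver.FreeGroupoid.of V).obj Y) (e : Y ⟶ Z), P f → P (f ≫ (Quiver.FreeGroupoid.of V).map e))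
    (inv_comp : ∀ {Y Z : V} (f : X ⟶ (Quiver.FreeGroupoid.of V).obj Z) (e : Y ⟶ Z), P f → P (f ≫ inv ((Quiver.FreeGroupoid.of V).map e)))
    {Y : Quiver.FreeGroupoid V} (f : X ⟶ Y) : P f := by
  obtain ⟨X⟩ := X
  obtain ⟨Y⟩ := Y
  suffices h : ∀ p : Quiver.Path (V := Quiver.Symmetrify V) X Y, P (Quot.mk _ p) from
    Quot.inductionOn f h
  clear f
  intro p
  induction p with
  | nil => exact id
  | cons p e ih =>
    rcases e with e | e
    · exact of_comp _ e ih
    · have := inv_comp _ e ih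
      rw [← Groupoid.inv_eq_inv] at this
      exact this

end Quiver

namespace QTensor

variable {C : Type u} [Category.{v} C] {S : QTensor C} (c : S.Commutativity)

theorem can_map_of {n : ℕ} {B B' : NRBTree n} (f : B ⟶ B') :
    (can c n).map ((Quiver.FreeGroupoid.of _).map f) = (canPrim c f).hom :=
  Category.id_comp (canPrim c f).hom

theorem can_map_inv {n : ℕ} {B B' : NRBTree n} (f : B ⟶ B') :
    (can c n).map (inv ((Quiver.FreeGroupoid.of _).map f)) = (canPrim c f).inv := by
  rw [Functor.map_inv]
  refine IsIso.inv_eq_of_hom_inv_id ?_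
  rw [can_map_of]
  exact (canPrim c f).hom_inv_id

end QTensor

theorem NRBTree.proper {n : ℕ} (B : NRBTree n) : Forest.Proper [(B.tree, 0)] where
  levels := by simpa using B.levels.nodup_iff.2 List.nodup_range
  numbers := by simpa using B.numbers
  grows p hp := by
    obtain rfl := List.mem_singleton.1 hp
    exact B.grows

namespace QTensor

variable {C : Type u} [Category.{v} C] {S : QTensor C} {c : S.Commutativity}

namespace Commutativity.Compatible

/-- The image of an arrow of the coherence groupoid. -/
def image (h : c.Compatible) {n : ℕ} (w : Fin n → C) {B B' : Quiver.FreeGroupoid (NRBTree n)}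
    (f : B ⟶ B') : h.value w [(NRBTree.tree B.as, 0)] ⟶ h.value w [(NRBTree.tree B'.as, 0)] :=
  Pre.homOf (((can c n).map f).app w)

/-- Coherence: the reductions of trees form a cocone over the images of all arrows, and they are
isomorphisms. -/
theorem coherent (h : c.Compatible) : c.Coherent := by
  intro n B B' f g w
  choose Φ hΦ using fun B : NRBTree n => exists_red h w B.proper
  have gen : ∀ {B B' : NRBTree n} (e : B ⟶ B'), Φ B =
      h.onFirst w ((canPrim c e).hom.app w) 0 0 [] ≫ Φ B' := fun e =>
    primAgree h w _ e (Nat.lt_succ_self _) (NRBTree.proper _) (NRBTree.proper _) (hΦ _) (hΦ _)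
  have key : ∀ {B B' : Quiver.FreeGroupoid (NRBTree n)} (f : B ⟶ B'),
      image h w f ≫ Φ B'.as = Φ B.as := by
    intro B B' f
    induction f using Quiver.FreeGroupoid.hom_induction with
    | id =>
      have : image h w (𝟙 B) = 𝟙 _ := by
        rw [image, CategoryTheory.Functor.map_id]; rfl
      rw [this]
      exact Category.id_comp _
    | @of_comp Y Z f e ih =>
      have : image h w (f ≫ (Quiver.FreeGroupoid.of _).map e) =
          image h w f ≫ h.onFirst w ((canPrim c e).hom.app w) 0 0 [] := by
        rw [image, Functor.map_comp, can_map_of]; rfl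
      rw [this]
      exact (Category.assoc _ _ _).trans ((congrArg (_ ≫ ·) (gen e).symm).trans ih)
    | @inv_comp Y Z f e ih =>
      have e₀ : image h w (f ≫ inv ((Quiver.FreeGroupoid.of _).map e)) =
          image h w f ≫ h.onFirst w ((canPrim c e).inv.app w) 0 0 [] := by
        rw [image, Functor.map_comp, can_map_inv]; rfl
      have e₁ := congrArg Pre.homOf ((canPrim c e).inv_hom_id_app w)
      have e₂ := (congrArg (h.onFirst w ((canPrim c e).inv.app w) 0 0 [] ≫ ·) (gen e)).trans
        ((Category.assoc _ _ _).symm.trans ((congrArg (· ≫ Φ Z) e₁).trans (Category.id_comp _)))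
      rw [e₀]
      exact (Category.assoc _ _ _).trans ((congrArg (_ ≫ ·) e₂).trans ih)
  have := (hΦ B'.as).isIso
  exact (cancel_mono (Φ B'.as)).1 ((key f).trans (key g).symm)

end Commutativity.Compatible

end QTensor

/-! ### The four diagrams from coherence -/

namespace NRBTree

/-- The tree with two leaves, with levels `i`, `j` and numbers `a`, `b` from left to right. -/
def two (i j : ℕ) (a b : Fin 2) (h : [i, j].Perm [1, 2]) (hn : [a, b].Perm [0, 1]) : NRBTree 2 where
  tree := .node i (.leaf a) j (.leaf b)
  grows := by
    have : ∀ k ∈ [i, j], 0 < k := fun k hk => by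
      have := h.subset hk; simp at this; omega
    simpa [LTree.Grows] using this
  levels := h.cons 0
  numbers := hn

theorem perm_three {i j k : ℕ} (h : [i, j, k].Perm [2, 3, 4]) : 1 < i ∧ 1 < j ∧ 1 < k := by
  have : ∀ l ∈ [i, j, k], 1 < l := fun l hl => by
    have := h.subset hl; simp at this; omega
  simpa using this

/-- The tree with three leaves that branches to the left, with its internal node at level `1`. -/
def left (i j k : ℕ) (a b c : Fin 3) (h : [i, j, k].Perm [2, 3, 4])
    (hn : [a, b, c].Perm [0, 1, 2]) : NRBTree 3 where
  tree := .node 1 (.node i (.leaf a) j (.leaf b)) k (.leaf c)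
  grows := by
    have := perm_three h
    simp [LTree.Grows]; omega
  levels := by
    refine ((List.Perm.trans ?_ h).cons 1).cons 0
    exact List.perm_append_comm (l₁ := [k]) (l₂ := [i, j])
  numbers := hn

/-- The tree with three leaves that branches to the right, with its internal node at level `1`. -/
def right (i j k : ℕ) (a b c : Fin 3) (h : [i, j, k].Perm [2, 3, 4])
    (hn : [a, b, c].Perm [0, 1, 2]) : NRBTree 3 where
  tree := .node i (.leaf a) 1 (.node j (.leaf b) k (.leaf c))
  grows := by
    have := perm_three h
    simp [LTree.Grows]; omega
  levels := (List.Perm.trans (.swap 1 i _) (h.cons 1)).cons 0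
  numbers := hn

end NRBTree

namespace QTensor

variable {C : Type u} [Category.{v} C] {S : QTensor C} {c : S.Commutativity}

namespace Commutativity.Coherent

variable (h : c.Coherent)
include h

/-- The two composites from `α₂ β₁` to `β₁ α₂`, where indices are levels. -/
theorem square : c.Square := by
  intro α β
  let F := Quiver.FreeGroupoid.of (NRBTree 2)
  let s₁ : NRBTree.two 2 1 0 1 (by decide) (by decide) ⟶ .two 1 2 1 0 (by decide) (by decide) :=
    Prim.swap _ _ _ _
  let f₁ : NRBTree.two 2 1 0 1 (by decide) (by decide) ⟶ .two 1 2 0 1 (by decide) (by decide) :=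
    Prim.inter _ _ _ _ (by decide)
  let f₂ : NRBTree.two 2 1 1 0 (by decide) (by decide) ⟶ .two 1 2 0 1 (by decide) (by decide) :=
    Prim.swap _ _ _ _
  let f₃ : NRBTree.two 2 1 1 0 (by decide) (by decide) ⟶ .two 1 2 1 0 (by decide) (by decide) :=
    Prim.inter _ _ _ _ (by decide)
  have := h 2 _ _ (F.map s₁) (F.map f₁ ≫ inv (F.map f₂) ≫ F.map f₃) ![α, β]
  simp only [F, Functor.map_comp, can_map_of, can_map_inv] at this
  exact this

theorem hexagon : c.Hexagon := by
  intro α β γ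
  let F := Quiver.FreeGroupoid.of (NRBTree 3)
  let B := NRBTree.left 2 3 4 0 1 2 (by decide) (by decide)
  let D := NRBTree.right 3 4 2 1 2 0 (by decide) (by decide)
  let f₁ : B ⟶ .right 2 3 4 0 1 2 (by decide) (by decide) := Prim.assoc _ _ _ _ _ _ _
  let f₂ : NRBTree.right 2 3 4 0 1 2 (by decide) (by decide) ⟶
    .left 3 4 2 1 2 0 (by decide) (by decide) := Prim.swap _ _ _ _
  let f₃ : NRBTree.left 3 4 2 1 2 0 (by decide) (by decide) ⟶ D := Prim.assoc _ _ _ _ _ _ _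
  let g₁ : B ⟶ .left 3 2 4 1 0 2 (by decide) (by decide) := Prim.left _ _ (.swap _ _ _ _) _
  let g₂ : NRBTree.left 3 2 4 1 0 2 (by decide) (by decide) ⟶
    .right 3 2 4 1 0 2 (by decide) (by decide) := Prim.assoc _ _ _ _ _ _ _
  let g₃ : NRBTree.right 3 2 4 1 0 2 (by decide) (by decide) ⟶ D :=
    Prim.right _ _ _ (.swap _ _ _ _)
  have := h 3 _ _ (F.map f₁ ≫ F.map f₂ ≫ F.map f₃) (F.map g₁ ≫ F.map g₂ ≫ F.map g₃) ![α, β, γ]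
  simp only [F, Functor.map_comp, can_map_of] at this
  exact this

/-- Both sides lead from `(α₂ β₃)₁ γ₄` to `(β₂ α₄)₁ γ₃`, where indices are levels. -/
theorem decagon₁ : c.Decagon₁ := by
  intro α β γ
  let F := Quiver.FreeGroupoid.of (NRBTree 3)
  let B := NRBTree.left 2 3 4 0 1 2 (by decide) (by decide)
  let B₁ := NRBTree.left 3 2 4 1 0 2 (by decide) (by decide)
  let B₂ := NRBTree.left 2 3 4 1 0 2 (by decide) (by decide)
  let B₃ := NRBTree.right 2 3 4 1 0 2 (by decide) (by decide)
  let B₄ := NRBTree.right 2 4 3 1 0 2 (by decide) (by decide)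
  let D := NRBTree.left 2 4 3 1 0 2 (by decide) (by decide)
  let D₁ := NRBTree.right 2 3 4 0 1 2 (by decide) (by decide)
  let D₂ := NRBTree.right 2 4 3 0 1 2 (by decide) (by decide)
  let D₃ := NRBTree.left 2 4 3 0 1 2 (by decide) (by decide)
  let D₄ := NRBTree.left 4 2 3 0 1 2 (by decide) (by decide)
  let f₁ : B₁ ⟶ B := Prim.left _ _ (.swap _ _ _ _) _
  let f₂ : B₁ ⟶ B₂ := Prim.left _ _ (.inter _ _ _ _ (by decide)) _
  let f₃ : B₂ ⟶ B₃ := Prim.assoc _ _ _ _ _ _ _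
  let f₄ : B₄ ⟶ B₃ := Prim.right _ _ _ (.inter _ _ _ _ (by decide))
  let f₅ : D ⟶ B₄ := Prim.assoc _ _ _ _ _ _ _
  let g₁ : B ⟶ D₁ := Prim.assoc _ _ _ _ _ _ _
  let g₂ : D₂ ⟶ D₁ := Prim.right _ _ _ (.inter _ _ _ _ (by decide))
  let g₃ : D₃ ⟶ D₂ := Prim.assoc _ _ _ _ _ _ _
  let g₄ : D₄ ⟶ D₃ := Prim.left _ _ (.inter _ _ _ _ (by decide)) _
  let g₅ : D₄ ⟶ D := Prim.left _ _ (.swap _ _ _ _) _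
  have := h 3 _ _ (inv (F.map f₁) ≫ F.map f₂ ≫ F.map f₃ ≫ inv (F.map f₄) ≫ inv (F.map f₅))
    (F.map g₁ ≫ inv (F.map g₂) ≫ inv (F.map g₃) ≫ inv (F.map g₄) ≫ F.map g₅) ![α, β, γ]
  simp only [F, Functor.map_comp, can_map_of, can_map_inv] at this
  exact this

/-- Both sides lead from `α₂ (β₃ γ₄)₁` to `α₃ (γ₂ β₄)₁`, where indices are levels. -/
theorem decagon₂ : c.Decagon₂ := by
  intro α β γ
  let F := Quiver.FreeGroupoid.of (NRBTree 3)
  let B := NRBTree.right 2 3 4 0 1 2 (by decide) (by decide)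
  let B₁ := NRBTree.right 2 4 3 0 2 1 (by decide) (by decide)
  let B₂ := NRBTree.right 2 3 4 0 2 1 (by decide) (by decide)
  let B₃ := NRBTree.left 2 3 4 0 2 1 (by decide) (by decide)
  let B₄ := NRBTree.left 3 2 4 0 2 1 (by decide) (by decide)
  let D := NRBTree.right 3 2 4 0 2 1 (by decide) (by decide)
  let D₁ := NRBTree.left 2 3 4 0 1 2 (by decide) (by decide)
  let D₂ := NRBTree.left 3 2 4 0 1 2 (by decide) (by decide)
  let D₃ := NRBTree.right 3 2 4 0 1 2 (by decide) (by decide)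
  let D₄ := NRBTree.right 3 4 2 0 1 2 (by decide) (by decide)
  let f₁ : B₁ ⟶ B := Prim.right _ _ _ (.swap _ _ _ _)
  let f₂ : B₁ ⟶ B₂ := Prim.right _ _ _ (.inter _ _ _ _ (by decide))
  let f₃ : B₃ ⟶ B₂ := Prim.assoc _ _ _ _ _ _ _
  let f₄ : B₄ ⟶ B₃ := Prim.left _ _ (.inter _ _ _ _ (by decide)) _
  let f₅ : B₄ ⟶ D := Prim.assoc _ _ _ _ _ _ _
  let g₁ : D₁ ⟶ B := Prim.assoc _ _ _ _ _ _ _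
  let g₂ : D₂ ⟶ D₁ := Prim.left _ _ (.inter _ _ _ _ (by decide)) _
  let g₃ : D₂ ⟶ D₃ := Prim.assoc _ _ _ _ _ _ _
  let g₄ : D₄ ⟶ D₃ := Prim.right _ _ _ (.inter _ _ _ _ (by decide))
  let g₅ : D₄ ⟶ D := Prim.right _ _ _ (.swap _ _ _ _)
  have := h 3 _ _ (inv (F.map f₁) ≫ F.map f₂ ≫ inv (F.map f₃) ≫ inv (F.map f₄) ≫ F.map f₅)
    (inv (F.map g₁) ≫ inv (F.map g₂) ≫ F.map g₃ ≫ inv (F.map g₄) ≫ F.map g₅) ![α, β, γ]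
  simp only [F, Functor.map_comp, can_map_of, can_map_inv] at this
  exact this

end Commutativity.Coherent

end QTensor

theorem theorem5 {C : Type u} [Category.{v} C] (S : QTensor C) (hS : S.IsQPseudomonoidal)
    (hq : S.QSymmetric) (c : S.Commutativity) (hc : c.Symmetric) :
    c.Coherent ↔ c.Square ∧ c.Hexagon ∧ c.Decagon₁ ∧ c.Decagon₂ := by
  refine ⟨fun h => ⟨h.square, h.hexagon, h.decagon₁, h.decagon₂⟩, fun ⟨h₁, h₂, h₃, h₄⟩ => ?_⟩
  have h : c.Compatible := ⟨hS.qPentagon, hS.dodecagon, hS.quaddecagon₂, hq, hc, h₁, h₂, h₃, h₄⟩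
  exact h.coherent
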